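/- Theorem. For a loop-free connected undirected graph $G$, a set $P=\{1,\dots,k\}$ of $k\ge 1$ pebbles and start vertices $\sigma:P\to V(G)$, the problem Con-Num asks for a map $\mu:P\to V(G)$ (the end vertices; $\sigma$ and $\mu$ need not be injective) such that the subgraph of $G$ induced by the image $\mu[P]$ is connected and, subject to this, the number $|\{p\in P:\sigma(p)\ne\mu(p)\}|$ of moved pebbles is minimum. Con-Num on trees can be solved in $O(n\cdot k^2\cdot\log n)$ time, where $n=|V(G)|$. More precisely, there are a single program for a unit-cost word RAM with words of $O(\log(n+k))$ bits and a constant $C$ such that, for every tree $G$ on $n\ge 1$ vertices, every $k\ge 1$ and every $\sigma$, the program, given $n$, $k$, a list of the edges of $G$ (in any order) and the values $\sigma(1),\dots,\sigma(k)$, halts after at most $C\cdot n\cdot k^2\cdot(\lfloor\log_2 n\rfloor+1)$ steps and outputs an optimal solution $\mu$ of Con-Num. -/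

import Mathlib

/-! ## Pebble motion problems -/

/-- The connectivity predicate: the subgraph of `G` induced by the vertex set `U` is connected. -/
def IsConnectedGoal {V : Type*} (G : SimpleGraph V) (U : Set V) : Prop :=
  (G.induce U).Connected

/-- The number of moved pebbles: `σ p` is the start vertex and `μ p` the end vertex of `p`. -/
noncomputable def numMoved {P V : Type*} (σ μ : P → V) : ℕ :=
  Set.ncard {p : P | σ p ≠ μ p}

/-- `μ` is an optimal solution of the pebble motion problem with the goal predicate `ψ` and the
measure `c`: the set of end vertices satisfies `ψ`, and no solution has a smaller measure. -/
def IsOptimalMotion {P V : Type*} (ψ : Set V → Prop) (c : (P → V) → ℕ) (μ : P → V) : Prop :=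
  ψ (Set.range μ) ∧ ∀ ν : P → V, ψ (Set.range ν) → c μ ≤ c ν

/-- `L` lists every edge of `G` exactly once, in any order and with the two ends in any order. -/
def IsEdgeList {V : Type*} (G : SimpleGraph V) (L : List (V × V)) : Prop :=
  (L.map fun e => s(e.1, e.2)).Nodup ∧
    ∀ e : Sym2 V, e ∈ (L.map fun e => s(e.1, e.2)) ↔ e ∈ G.edgeSet

/-! ## A unit-cost word random access machine

Programs are structured (sequence, conditional, loop) and work on finitely many registers and on an
indirectly addressed memory. Each arithmetic operation, comparison, memory access, register access,
assignment and test costs one step. Every number that occurs has to be smaller than the word bound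
`W`; a computation that would produce a larger number has no run. -/

namespace WordRAM

/-- The contents of the registers and of the memory cells. -/
structure State where
  reg : ℕ → ℕ
  mem : ℕ → ℕ

/-- Expressions: constants, registers, memory cells given by an address, and the operations
addition, subtraction (truncated at `0`), multiplication and comparison (with value `1` or `0`). -/
inductive Term where
  | const (c : ℕ)
  | reg (x : ℕ)
  | load (addr : Term)
  | add (a b : Term)
  | sub (a b : Term)
  | mul (a b : Term)
  | lt (a b : Term)
  | eq (a b : Term)

/-- The value of an expression. -/
def Term.val (s : State) : Term → ℕ
  | .const c => c
  | .reg x => s.reg x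
  | .load a => s.mem (a.val s)
  | .add a b => a.val s + b.val s
  | .sub a b => a.val s - b.val s
  | .mul a b => a.val s * b.val s
  | .lt a b => if a.val s < b.val s then 1 else 0
  | .eq a b => if a.val s = b.val s then 1 else 0

/-- The number of steps needed to evaluate an expression. -/
def Term.cost : Term → ℕ
  | .const _ => 1
  | .reg _ => 1
  | .load a => a.cost + 1
  | .add a b => a.cost + b.cost + 1
  | .sub a b => a.cost + b.cost + 1
  | .mul a b => a.cost + b.cost + 1
  | .lt a b => a.cost + b.cost + 1
  | .eq a b => a.cost + b.cost + 1

/-- The value of the expression and of all its subexpressions is smaller than the word bound. -/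
def Term.Fits (W : ℕ) (s : State) : Term → Prop
  | .const c => c < W
  | .reg x => s.reg x < W
  | .load a => a.Fits W s ∧ (Term.load a).val s < W
  | .add a b => a.Fits W s ∧ b.Fits W s ∧ (Term.add a b).val s < W
  | .sub a b => a.Fits W s ∧ b.Fits W s ∧ (Term.sub a b).val s < W
  | .mul a b => a.Fits W s ∧ b.Fits W s ∧ (Term.mul a b).val s < W
  | .lt a b => a.Fits W s ∧ b.Fits W s ∧ (Term.lt a b).val s < W
  | .eq a b => a.Fits W s ∧ b.Fits W s ∧ (Term.eq a b).val s < W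

/-- Programs. -/
inductive Program where
  | skip
  | assign (x : ℕ) (e : Term)
  | store (addr e : Term)
  | seq (p q : Program)
  | ite (b : Term) (p q : Program)
  | loop (b : Term) (p : Program)

/-- `Runs W p s t s'`: with the word bound `W`, the program `p` started in the state `s` halts
after exactly `t` steps in the state `s'`. In a test, a nonzero value means true. -/
inductive Runs (W : ℕ) : Program → State → ℕ → State → Prop
  | skip (s : State) : Runs W .skip s 1 s
  | assign (x : ℕ) (e : Term) (s : State) (he : e.Fits W s) :
      Runs W (.assign x e) s (e.cost + 1) ⟨Function.update s.reg x (e.val s), s.mem⟩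
  | store (a e : Term) (s : State) (ha : a.Fits W s) (he : e.Fits W s) :
      Runs W (.store a e) s (a.cost + e.cost + 1)
        ⟨s.reg, Function.update s.mem (a.val s) (e.val s)⟩
  | seq (p q : Program) (s s₁ s₂ : State) (t₁ t₂ : ℕ)
      (hp : Runs W p s t₁ s₁) (hq : Runs W q s₁ t₂ s₂) :
      Runs W (.seq p q) s (t₁ + t₂) s₂
  | ite_true (b : Term) (p q : Program) (s s₁ : State) (t : ℕ)
      (hb : b.Fits W s) (h : b.val s ≠ 0) (hp : Runs W p s t s₁) :
      Runs W (.ite b p q) s (b.cost + 1 + t) s₁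
  | ite_false (b : Term) (p q : Program) (s s₁ : State) (t : ℕ)
      (hb : b.Fits W s) (h : b.val s = 0) (hq : Runs W q s t s₁) :
      Runs W (.ite b p q) s (b.cost + 1 + t) s₁
  | loop_true (b : Term) (p : Program) (s s₁ s₂ : State) (t₁ t₂ : ℕ)
      (hb : b.Fits W s) (h : b.val s ≠ 0)
      (hp : Runs W p s t₁ s₁) (hl : Runs W (.loop b p) s₁ t₂ s₂) :
      Runs W (.loop b p) s (b.cost + 1 + t₁ + t₂) s₂
  | loop_false (b : Term) (p : Program) (s : State)
      (hb : b.Fits W s) (h : b.val s = 0) :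
      Runs W (.loop b p) s (b.cost + 1) s

/-- The start state on a given input: the input stands in the cells `0, 1, 2, …` of the memory,
and all other cells and all registers are `0`. -/
def initState (input : List ℕ) : State where
  reg := fun _ => 0
  mem := fun i => input.getD i 0

end WordRAM

/-- The input word of an instance with `n` vertices and `k` pebbles: the numbers `n` and `k`, then
the two ends of each edge in the list `L`, then the start vertices of the pebbles. -/
def encodeInstance {n k : ℕ} (L : List (Fin n × Fin n)) (σ : Fin k → Fin n) : List ℕ :=
  [n, k] ++ (L.flatMap fun e => [(e.1 : ℕ), (e.2 : ℕ)]) ++ List.ofFn fun p => (σ p : ℕ)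

/-! Suppose the pebbles end exactly on a vertex set `U`. Every pebble that starts outside `U` moves,
and every vertex of `U` where no pebble starts (an empty vertex) receives a moved pebble. So the
number of moves is at least the maximum of `k` minus the weight of `U` and the number of empty
vertices of `U`, where the weight counts the pebbles that start in `U` (`sub_le_numMoved`,
`sum_emptyInd_le_numMoved`). If `U` has at most `k` elements, this maximum is attained: pebbles from
outside fill the empty vertices first, and if some are left over, surplus pebbles inside `U` fill
them while one representative stays at each occupied vertex (`exists_motion`). It remains to
minimize this maximum over connected sets.

Removing leaves one at a time orders the vertices so that every vertex but the last has exactly one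
later neighbour, its parent. A vertex set is connected exactly when it has a top and contains the
parent of each of its other elements (`exists_isBelow`, `connected_of_isBelow`). Hence a tree
knapsack applies: for each top `v` and each budget `b < k` of empty vertices besides `v`, record the
largest weight. Merging a vertex into its parent tries all splittings of all budgets, about `k ^ 2`
operations, and there are `n - 1` merges. Every connected image is dominated by a table entry
(`IsElimOrder.le_numMoved`).

Following the recorded choices from the last vertex of the order to the first gives a set `S`
realizing the best entry. It may have more than `k` vertices. In that case only the `k` elements
nearest the end of the order are kept, giving `T`. Each vertex of `T` is empty or has weight at
least 1, so `k` minus the weight of `T` is at most its number of empty vertices, which is at most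
that of `S`; the cost does not grow (`IsTrim.cost_le`).

For the machine, the algorithm is written in an array language with counting loops and compiled. All
stored numbers stay at most `(n + k + 2) ^ 3`, so every intermediate value is below a power of `n +
k + 2` whose exponent depends on the program text only. The running time is bounded by a monomial
read off from the loop nesting, here `n * k ^ 2`. The predicate `Sat` carries correctness, time and
boundedness together. -/

/-! ## Resource bounds for terms and programs -/

namespace WordRAM

/-- An exponent that bounds the values of a term whose registers and loaded cells are at most
`X ^ 3`. -/
def Term.deg : Term → ℕ
  | .const c => c + 1
  | .reg _ => 4
  | .load a => a.deg + 4
  | .add a b => a.deg + b.deg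
  | .sub a b => a.deg + b.deg
  | .mul a b => a.deg + b.deg
  | .lt a b => a.deg + b.deg
  | .eq a b => a.deg + b.deg

/-- All registers and memory cells that the term reads are at most `B`. -/
def Term.Small (B : ℕ) (s : State) : Term → Prop
  | .const _ => True
  | .reg x => s.reg x ≤ B
  | .load a => a.Small B s ∧ s.mem (a.val s) ≤ B
  | .add a b => a.Small B s ∧ b.Small B s
  | .sub a b => a.Small B s ∧ b.Small B s
  | .mul a b => a.Small B s ∧ b.Small B s
  | .lt a b => a.Small B s ∧ b.Small B s
  | .eq a b => a.Small B s ∧ b.Small B s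

theorem Term.one_le_deg (e : Term) : 1 ≤ e.deg := by
  induction e <;> simp only [Term.deg] <;> omega

theorem add_lt_pow_add {X a b x y : ℕ} (hx : x < X ^ a) (hy : y < X ^ b) :
    x + y < X ^ (a + b) := by
  rw [pow_add]
  nlinarith

theorem mul_lt_pow_add {X a b x y : ℕ} (hx : x < X ^ a) (hy : y < X ^ b) :
    x * y < X ^ (a + b) := by
  rw [pow_add]
  exact Nat.mul_lt_mul'' hx hy

/-- Only the contents that are read have to be bounded. Intermediate results, addresses included,
may be larger: under sums and products exponents add up, and a constant `c` is below `2 ^ c`, so the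
exponent depends on the term alone. -/
theorem Term.Small.val_lt {X : ℕ} (hX : 2 ≤ X) {s : State} {e : Term}
    (h : e.Small (X ^ 3) s) : e.val s < X ^ e.deg := by
  have h34 : X ^ 3 < X ^ 4 := Nat.pow_lt_pow_right (by omega) (by omega)
  have bool : ∀ m (p : Prop) [Decidable p], 1 ≤ m → (if p then 1 else 0) < X ^ m := by
    intro m p _ hm
    have : 1 < X ^ m := Nat.one_lt_pow (by omega) (by omega)
    split_ifs <;> omega
  induction e with
  | const c =>
    calc c < 2 ^ c := Nat.lt_two_pow_self
      _ ≤ X ^ c := Nat.pow_le_pow_left hX c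
      _ ≤ X ^ (c + 1) := Nat.pow_le_pow_right (by omega) (by omega)
  | reg x => exact lt_of_le_of_lt h h34
  | load a =>
    exact lt_of_le_of_lt h.2 (h34.trans_le (Nat.pow_le_pow_right (by omega) (by simp [Term.deg])))
  | add a b iha ihb => exact add_lt_pow_add (iha h.1) (ihb h.2)
  | sub a b iha ihb =>
    exact lt_of_le_of_lt ((Nat.sub_le _ _).trans (Nat.le_add_right _ _))
      (add_lt_pow_add (iha h.1) (ihb h.2))
  | mul a b iha ihb => exact mul_lt_pow_add (iha h.1) (ihb h.2)
  | lt a b => exact bool _ _ (Term.one_le_deg (.lt a b))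
  | eq a b => exact bool _ _ (Term.one_le_deg (.eq a b))

/-- Subterms have no larger exponent than the whole term, so one exponent serves for all of them. -/
theorem Term.Small.fits {X d : ℕ} (hX : 2 ≤ X) {s : State} {e : Term}
    (h : e.Small (X ^ 3) s) (hd : e.deg ≤ d) : e.Fits (X ^ d) s := by
  have key : ∀ e : Term, e.Small (X ^ 3) s → e.deg ≤ d → e.val s < X ^ d := fun e he hd =>
    (he.val_lt hX).trans_le (Nat.pow_le_pow_right (by omega) hd)
  induction e with
  | const c => exact key _ h hd
  | reg x => exact key _ h hd
  | load a iha => exact ⟨iha h.1 (by simp only [Term.deg] at hd; omega), key _ h hd⟩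
  | add a b iha ihb | sub a b iha ihb | mul a b iha ihb | lt a b iha ihb | eq a b iha ihb =>
    exact ⟨iha h.1 (by simp only [Term.deg] at hd; omega),
      ihb h.2 (by simp only [Term.deg] at hd; omega), key _ h hd⟩

/-- The sum of the exponents of all terms of a program. -/
def Program.deg : Program → ℕ
  | .skip => 0
  | .assign _ e => e.deg
  | .store a e => a.deg + e.deg
  | .seq p q => p.deg + q.deg
  | .ite b p q => b.deg + p.deg + q.deg
  | .loop b p => b.deg + p.deg

/-! ## An array language -/

/-- Variables of the array language. -/
inductive Var where
  | i | j | a | b | c | e | p | u | v | tmp | tail | best | sel | bv | bj | size | ne | nf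
  deriving DecidableEq

/-- Arrays of the array language. -/
inductive Arr where
  | deg | nbr | cnt | rep | start | queue | par | tab | ch | mark | bud | keep | emp
  deriving DecidableEq

/-- The number of the register that holds a variable. -/
def Var.code : Var → ℕ
  | .i => 4 | .j => 5 | .a => 6 | .b => 7 | .c => 8 | .e => 9 | .p => 10 | .u => 11 | .v => 12
  | .tmp => 13 | .tail => 14 | .best => 15 | .sel => 16 | .bv => 17 | .bj => 18 | .size => 19
  | .ne => 20 | .nf => 21

/-- The number of an array. -/
def Arr.code : Arr → ℕ
  | .deg => 0 | .nbr => 1 | .cnt => 2 | .rep => 3 | .start => 4 | .queue => 5 | .par => 6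
  | .tab => 7 | .ch => 8 | .mark => 9 | .bud => 10 | .keep => 11 | .emp => 12

theorem Var.four_le_code (x : Var) : 4 ≤ x.code := by cases x <;> decide

theorem Var.code_inj {x y : Var} : x.code = y.code ↔ x = y := by
  cases x <;> cases y <;> simp [Var.code]

theorem Arr.code_inj {x y : Arr} : x.code = y.code ↔ x = y := by
  cases x <;> cases y <;> simp [Arr.code]

theorem Arr.code_lt (x : Arr) : x.code < 16 := by cases x <;> decide

/-- The contents of the variables, of the (two-dimensional) arrays and of the cells of the
input area. -/
structure Store where
  reg : Var → ℕ
  arr : Arr → ℕ → ℕ → ℕ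
  raw : ℕ → ℕ

/-- Assignment to a variable. -/
def Store.setReg (h : Store) (x : Var) (v : ℕ) : Store :=
  ⟨fun y => if y = x then v else h.reg y, h.arr, h.raw⟩

/-- Assignment to an array entry. -/
def Store.setArr (h : Store) (r : Arr) (i j v : ℕ) : Store :=
  ⟨h.reg, fun r' i' j' => if r' = r ∧ i' = i ∧ j' = j then v else h.arr r' i' j', h.raw⟩

/-- Assignment to a cell of the input area. -/
def Store.setRaw (h : Store) (i v : ℕ) : Store :=
  ⟨h.reg, h.arr, fun i' => if i' = i then v else h.raw i'⟩

/-- Expressions of the array language. -/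
inductive Expr where
  | const (c : ℕ)
  | n
  | k
  | reg (x : Var)
  | get (r : Arr) (i j : Expr)
  | add (a b : Expr)
  | sub (a b : Expr)
  | mul (a b : Expr)
  | lt (a b : Expr)
  | eq (a b : Expr)

/-- The value of an expression. -/
def Expr.val (n k : ℕ) (h : Store) : Expr → ℕ
  | .const c => c
  | .n => n
  | .k => k
  | .reg x => h.reg x
  | .get r i j => h.arr r (i.val n k h) (j.val n k h)
  | .add a b => a.val n k h + b.val n k h
  | .sub a b => a.val n k h - b.val n k h
  | .mul a b => a.val n k h * b.val n k h
  | .lt a b => if a.val n k h < b.val n k h then 1 else 0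
  | .eq a b => if a.val n k h = b.val n k h then 1 else 0

/-- The address of an array entry. -/
def addr (n k : ℕ) (r : Arr) (i j : ℕ) : ℕ :=
  n + n + k + (16 * ((i + j) * (i + j) + i) + r.code)

theorem le_addr (n k : ℕ) (r : Arr) (i j : ℕ) : n + n + k ≤ addr n k r i j :=
  Nat.le_add_right _ _

/-- The residue modulo 16 gives the array. With `s = i + j`, the number `s ^ 2 + i` satisfies `s ^ 2
≤ s ^ 2 + i < (s + 1) ^ 2` because `i ≤ s`, so it determines `s`, then `i` and `j`. -/
theorem addr_inj {n k : ℕ} {r r' : Arr} {i i' j j' : ℕ} :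
    addr n k r i j = addr n k r' i' j' ↔ r = r' ∧ i = i' ∧ j = j' := by
  refine ⟨fun h => ?_, by rintro ⟨rfl, rfl, rfl⟩; rfl⟩
  have h1 := r.code_lt
  have h2 := r'.code_lt
  unfold addr at h
  have h3 : (i + j) * (i + j) + i = (i' + j') * (i' + j') + i' := by omega
  have h4 : r.code = r'.code := by omega
  have h5 : i + j = i' + j' := by
    rcases lt_trichotomy (i + j) (i' + j') with hl | hl | hl
    · nlinarith
    · exact hl
    · nlinarith
  rw [h5] at h3
  exact ⟨Arr.code_inj.1 h4, by omega, by omega⟩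

/-- The address of an array entry as a term. -/
def addrTerm (r : Arr) (i j : Term) : Term :=
  .add (.reg 0) (.add (.mul (.const 16) (.add (.mul (.add i j) (.add i j)) i)) (.const r.code))

/-- The translation of expressions; the registers `0`, `1`, `2`, `3` hold the numbers
`n + n + k`, `n`, `k`, `n - 1`. -/
def Expr.compile : Expr → Term
  | .const c => .const c
  | .n => .reg 1
  | .k => .reg 2
  | .reg x => .reg x.code
  | .get r i j => .load (addrTerm r i.compile j.compile)
  | .add a b => .add a.compile b.compile
  | .sub a b => .sub a.compile b.compile
  | .mul a b => .mul a.compile b.compile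
  | .lt a b => .lt a.compile b.compile
  | .eq a b => .eq a.compile b.compile

/-- The machine state `s` represents the store `h`. -/
structure Rep (n k : ℕ) (s : State) (h : Store) : Prop where
  reg_zero : s.reg 0 = n + n + k
  reg_one : s.reg 1 = n
  reg_two : s.reg 2 = k
  reg_three : s.reg 3 = n - 1
  reg : ∀ x : Var, s.reg x.code = h.reg x
  arr : ∀ r i j, s.mem (addr n k r i j) = h.arr r i j
  raw : ∀ i < n + n + k, s.mem i = h.raw i

/-- All numbers in the store are bounded. -/
structure Store.Bdd (n k : ℕ) (h : Store) : Prop where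
  reg : ∀ x, h.reg x ≤ (n + k + 2) ^ 3
  arr : ∀ r i j, h.arr r i j ≤ (n + k + 2) ^ 3
  raw : ∀ i, h.raw i ≤ (n + k + 2) ^ 3

theorem Rep.val_compile {n k : ℕ} {s : State} {h : Store} (hs : Rep n k s h) (e : Expr) :
    e.compile.val s = e.val n k h := by
  induction e with
  | const c => rfl
  | n => exact hs.reg_one
  | k => exact hs.reg_two
  | reg x => exact hs.reg x
  | get r i j ihi ihj =>
    simp only [Expr.compile, addrTerm, Term.val, Expr.val, ihi, ihj, hs.reg_zero, ← hs.arr, addr]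
  | add a b iha ihb | sub a b iha ihb | mul a b iha ihb | lt a b iha ihb | eq a b iha ihb =>
    simp only [Expr.compile, Term.val, Expr.val, iha, ihb]

theorem le_bound (n k : ℕ) : n + n + k ≤ (n + k + 2) ^ 3 := by
  have : (n + k + 2) ^ 3 = (n + k + 2) * ((n + k + 2) * (n + k + 2)) := by ring
  nlinarith

theorem Rep.small_compile {n k : ℕ} {s : State} {h : Store} (hs : Rep n k s h) (hb : h.Bdd n k)
    (e : Expr) : e.compile.Small ((n + k + 2) ^ 3) s := by
  have hB := le_bound n k
  induction e with
  | const c => trivial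
  | n => simp only [Expr.compile, Term.Small, hs.reg_one]; omega
  | k => simp only [Expr.compile, Term.Small, hs.reg_two]; omega
  | reg x => simp only [Expr.compile, Term.Small, hs.reg, hb.reg]
  | get r i j ihi ihj =>
    refine ⟨?_, ?_⟩
    · simp only [addrTerm, Term.Small, hs.reg_zero, ihi, ihj, hB, and_self]
    · rw [show s.mem _ = _ from hs.val_compile (.get r i j)]
      exact hb.arr _ _ _
  | add a b iha ihb | sub a b iha ihb | mul a b iha ihb | lt a b iha ihb | eq a b iha ihb =>
    exact ⟨iha, ihb⟩

theorem Rep.fits_compile {n k d : ℕ} {s : State} {h : Store} (hs : Rep n k s h) (hb : h.Bdd n k)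
    {e : Expr} (hd : e.compile.deg ≤ d) : e.compile.Fits ((n + k + 2) ^ d) s :=
  (hs.small_compile hb e).fits (by omega) hd

theorem Rep.setReg {n k : ℕ} {s : State} {h : Store} (hs : Rep n k s h) (x : Var) (v : ℕ) :
    Rep n k ⟨Function.update s.reg x.code v, s.mem⟩ (h.setReg x v) := by
  have hx := x.four_le_code
  refine ⟨?_, ?_, ?_, ?_, fun y => ?_, hs.arr, hs.raw⟩
  · exact (Function.update_of_ne (by omega) _ _).trans hs.reg_zero
  · exact (Function.update_of_ne (by omega) _ _).trans hs.reg_one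
  · exact (Function.update_of_ne (by omega) _ _).trans hs.reg_two
  · exact (Function.update_of_ne (by omega) _ _).trans hs.reg_three
  · simp only [Function.update_apply, Var.code_inj, Store.setReg, hs.reg]

theorem Rep.setArr {n k : ℕ} {s : State} {h : Store} (hs : Rep n k s h) (r : Arr) (i j v : ℕ) :
    Rep n k ⟨s.reg, Function.update s.mem (addr n k r i j) v⟩ (h.setArr r i j v) := by
  refine ⟨hs.reg_zero, hs.reg_one, hs.reg_two, hs.reg_three, hs.reg, fun r' i' j' => ?_,
    fun i' hi' => ?_⟩
  · simp only [Function.update_apply, addr_inj, Store.setArr, hs.arr]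
  · have := le_addr n k r i j
    simp only [Store.setArr]
    rw [Function.update_of_ne (by omega)]
    exact hs.raw i' hi'

theorem Rep.setRaw {n k : ℕ} {s : State} {h : Store} (hs : Rep n k s h) {i : ℕ}
    (hi : i < n + n + k) (v : ℕ) :
    Rep n k ⟨s.reg, Function.update s.mem i v⟩ (h.setRaw i v) := by
  refine ⟨hs.reg_zero, hs.reg_one, hs.reg_two, hs.reg_three, hs.reg, fun r' i' j' => ?_,
    fun i' hi' => ?_⟩
  · have := le_addr n k r' i' j'
    simp only [Store.setRaw]
    rw [Function.update_of_ne (by omega)]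
    exact hs.arr _ _ _
  · simp only [Function.update_apply, Store.setRaw, hs.raw i' hi']

theorem Store.Bdd.setReg {n k : ℕ} {h : Store} (hb : h.Bdd n k) (x : Var) {v : ℕ}
    (hv : v ≤ (n + k + 2) ^ 3) : (h.setReg x v).Bdd n k := by
  refine ⟨fun y => ?_, hb.arr, hb.raw⟩
  have := hb.reg y
  simp only [Store.setReg]
  split_ifs <;> assumption

theorem Store.Bdd.setArr {n k : ℕ} {h : Store} (hb : h.Bdd n k) (r : Arr) (i j : ℕ) {v : ℕ}
    (hv : v ≤ (n + k + 2) ^ 3) : (h.setArr r i j v).Bdd n k := by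
  refine ⟨hb.reg, fun r' i' j' => ?_, hb.raw⟩
  have := hb.arr r' i' j'
  simp only [Store.setArr]
  split_ifs <;> assumption

theorem Store.Bdd.setRaw {n k : ℕ} {h : Store} (hb : h.Bdd n k) (i : ℕ) {v : ℕ}
    (hv : v ≤ (n + k + 2) ^ 3) : (h.setRaw i v).Bdd n k := by
  refine ⟨hb.reg, hb.arr, fun i' => ?_⟩
  have := hb.raw i'
  simp only [Store.setRaw]
  split_ifs <;> assumption

/-- Bounds of counting loops. -/
inductive Bound where
  | n | pred | k

/-- The value of a loop bound. -/
def Bound.val (n k : ℕ) : Bound → ℕ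
  | .n => n
  | .pred => n - 1
  | .k => k

/-- The register that holds a loop bound. -/
def Bound.code : Bound → ℕ
  | .n => 1
  | .pred => 3
  | .k => 2

theorem Rep.bound {n k : ℕ} {s : State} {h : Store} (hs : Rep n k s h) (N : Bound) :
    s.reg N.code = N.val n k := by
  cases N
  · exact hs.reg_one
  · exact hs.reg_three
  · exact hs.reg_two

/-- Strictness matters: the final value of a loop counter is the loop bound itself and has to be
storable. -/
theorem Bound.val_lt (n k : ℕ) (N : Bound) : N.val n k < (n + k + 2) ^ 3 := by
  have : n + k + 2 ≤ (n + k + 2) ^ 3 := Nat.le_self_pow (by omega) _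
  cases N <;> simp only [Bound.val] <;> omega

/-- Commands of the array language: assignments to variables, array entries and cells of the input
area, composition, conditional and counting loop. -/
inductive Cmd where
  | skip
  | set (x : Var) (e : Expr)
  | getRaw (x : Var) (i : Expr)
  | putRaw (i e : Expr)
  | put (r : Arr) (i j e : Expr)
  | seq (p q : Cmd)
  | ite (b : Expr) (p q : Cmd)
  | upto (x : Var) (N : Bound) (p : Cmd)

/-- Sequential composition of a list of commands. -/
def Cmd.block : List Cmd → Cmd
  | [] => .skip
  | [p] => p
  | p :: q :: l => .seq p (block (q :: l))

/-- The translation of commands. -/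
def Cmd.compile : Cmd → Program
  | .skip => .skip
  | .set x e => .assign x.code e.compile
  | .getRaw x i => .assign x.code (.load i.compile)
  | .putRaw i e => .store i.compile e.compile
  | .put r i j e => .store (addrTerm r i.compile j.compile) e.compile
  | .seq p q => .seq p.compile q.compile
  | .ite b p q => .ite b.compile p.compile q.compile
  | .upto x N p => .seq (.assign x.code (.const 0))
      (.loop (.lt (.reg x.code) (.reg N.code))
        (.seq p.compile (.assign x.code (.add (.reg x.code) (.const 1)))))

/-- A bound for the running time of the translation. -/
def Cmd.cost (n k : ℕ) : Cmd → ℕ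
  | .skip => 1
  | .set _ e => e.compile.cost + 1
  | .getRaw _ i => i.compile.cost + 2
  | .putRaw i e => i.compile.cost + e.compile.cost + 1
  | .put r i j e => (addrTerm r i.compile j.compile).cost + e.compile.cost + 1
  | .seq p q => p.cost n k + q.cost n k
  | .ite b p q => b.compile.cost + 1 + (p.cost n k + q.cost n k)
  | .upto _ N p => N.val n k * (p.cost n k + 8) + 6

/-- The command may change the variable. -/
def Cmd.writesReg (y : Var) : Cmd → Bool
  | .set x _ => decide (x = y)
  | .getRaw x _ => decide (x = y)
  | .seq p q => p.writesReg y || q.writesReg y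
  | .ite _ p q => p.writesReg y || q.writesReg y
  | .upto x _ p => decide (x = y) || p.writesReg y
  | _ => false

/-- The command may change the array. -/
def Cmd.writesArr (r : Arr) : Cmd → Bool
  | .put r' _ _ _ => decide (r' = r)
  | .seq p q => p.writesArr r || q.writesArr r
  | .ite _ p q => p.writesArr r || q.writesArr r
  | .upto _ _ p => p.writesArr r
  | _ => false

/-- The command may change the input area. -/
def Cmd.writesRaw : Cmd → Bool
  | .putRaw _ _ => true
  | .seq p q => p.writesRaw || q.writesRaw
  | .ite _ p q => p.writesRaw || q.writesRaw
  | .upto _ _ p => p.writesRaw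
  | _ => false

/-- The stores `h` and `h'` differ only in places that the command may change. -/
structure Frame (p : Cmd) (h h' : Store) : Prop where
  reg : ∀ y, p.writesReg y = false → h'.reg y = h.reg y
  arr : ∀ r, p.writesArr r = false → h'.arr r = h.arr r
  raw : p.writesRaw = false → h'.raw = h.raw

theorem Frame.refl (p : Cmd) (h : Store) : Frame p h h :=
  ⟨fun _ _ => rfl, fun _ _ => rfl, fun _ => rfl⟩

theorem Frame.trans {p : Cmd} {h h₁ h₂ : Store} (f₁ : Frame p h h₁) (f₂ : Frame p h₁ h₂) :
    Frame p h h₂ :=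
  ⟨fun y hy => (f₂.reg y hy).trans (f₁.reg y hy), fun r hr => (f₂.arr r hr).trans (f₁.arr r hr),
    fun hr => (f₂.raw hr).trans (f₁.raw hr)⟩

theorem Frame.mono {p q : Cmd} {h h' : Store} (f : Frame p h h')
    (hreg : ∀ y, q.writesReg y = false → p.writesReg y = false)
    (harr : ∀ r, q.writesArr r = false → p.writesArr r = false)
    (hraw : q.writesRaw = false → p.writesRaw = false) : Frame q h h' :=
  ⟨fun y hy => f.reg y (hreg y hy), fun r hr => f.arr r (harr r hr), fun hr => f.raw (hraw hr)⟩

theorem Frame.seq_left {p q : Cmd} {h h' : Store} (f : Frame p h h') : Frame (.seq p q) h h' :=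
  f.mono (by simp +contextual [Cmd.writesReg]) (by simp +contextual [Cmd.writesArr])
    (by simp +contextual [Cmd.writesRaw])

theorem Frame.seq_right {p q : Cmd} {h h' : Store} (f : Frame q h h') : Frame (.seq p q) h h' :=
  f.mono (by simp +contextual [Cmd.writesReg]) (by simp +contextual [Cmd.writesArr])
    (by simp +contextual [Cmd.writesRaw])

theorem Frame.ite_left {b : Expr} {p q : Cmd} {h h' : Store} (f : Frame p h h') :
    Frame (.ite b p q) h h' :=
  f.mono (by simp +contextual [Cmd.writesReg]) (by simp +contextual [Cmd.writesArr])
    (by simp +contextual [Cmd.writesRaw])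

theorem Frame.ite_right {b : Expr} {p q : Cmd} {h h' : Store} (f : Frame q h h') :
    Frame (.ite b p q) h h' :=
  f.mono (by simp +contextual [Cmd.writesReg]) (by simp +contextual [Cmd.writesArr])
    (by simp +contextual [Cmd.writesRaw])

theorem Frame.upto_body {x : Var} {N : Bound} {p : Cmd} {h h' : Store} (f : Frame p h h') :
    Frame (.upto x N p) h h' :=
  f.mono (by simp +contextual [Cmd.writesReg]) (by simp +contextual [Cmd.writesArr])
    (by simp +contextual [Cmd.writesRaw])

theorem Frame.upto_setReg {x : Var} {N : Bound} {p : Cmd} (h : Store) (v : ℕ) :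
    Frame (.upto x N p) h (h.setReg x v) := by
  refine ⟨fun y hy => ?_, fun _ _ => rfl, fun _ => rfl⟩
  simp only [Cmd.writesReg, Bool.or_eq_false_iff, decide_eq_false_iff_not] at hy
  simp [Store.setReg, Ne.symm hy.1]

/-! ### Program logic: total correctness with time and size bounds -/

/-- Started in the store `h`, the command runs within its time bound and ends in a store that
satisfies `Q`. -/
def Sat (n k : ℕ) (p : Cmd) (h : Store) (Q : Store → Prop) : Prop :=
  h.Bdd n k → ∀ d, p.compile.deg ≤ d → ∀ s, Rep n k s h →
    ∃ t s' h', Runs ((n + k + 2) ^ d) p.compile s t s' ∧ t ≤ p.cost n k ∧ Rep n k s' h' ∧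
      h'.Bdd n k ∧ Frame p h h' ∧ Q h'

variable {n k : ℕ} {h : Store} {Q : Store → Prop}

theorem Sat.mono {p : Cmd} {Q' : Store → Prop} (hp : Sat n k p h Q')
    (hQ : ∀ h', Frame p h h' → Q' h' → Q h') : Sat n k p h Q := by
  intro hb d hd s hs
  obtain ⟨t, s', h', hr, ht, hs', hb', hf, hq⟩ := hp hb d hd s hs
  exact ⟨t, s', h', hr, ht, hs', hb', hf, hQ h' hf hq⟩

theorem Sat.seq {p q : Cmd} {Q' : Store → Prop} (hp : Sat n k p h Q')
    (hq : ∀ h', Frame p h h' → Q' h' → Sat n k q h' Q) : Sat n k (.seq p q) h Q := by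
  intro hb d hd s hs
  simp only [Cmd.compile, Program.deg] at hd
  obtain ⟨t₁, s₁, h₁, hr₁, ht₁, hs₁, hb₁, hf₁, hq₁⟩ := hp hb d (by omega) s hs
  obtain ⟨t₂, s₂, h₂, hr₂, ht₂, hs₂, hb₂, hf₂, hq₂⟩ := hq h₁ hf₁ hq₁ hb₁ d (by omega) s₁ hs₁
  exact ⟨t₁ + t₂, s₂, h₂, .seq _ _ _ _ _ _ _ hr₁ hr₂, by simp only [Cmd.cost]; omega, hs₂, hb₂,
    hf₁.seq_left.trans hf₂.seq_right, hq₂⟩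

/-- The weakest precondition, with counting loops left to `Sat`. -/
def wp (n k : ℕ) : Cmd → (Store → Prop) → Store → Prop
  | .skip, Q, h => Q h
  | .set x e, Q, h =>
      e.val n k h ≤ (n + k + 2) ^ 3 ∧ Q (h.setReg x (e.val n k h))
  | .getRaw x i, Q, h => i.val n k h < n + n + k ∧ Q (h.setReg x (h.raw (i.val n k h)))
  | .putRaw i e, Q, h => i.val n k h < n + n + k ∧
      e.val n k h ≤ (n + k + 2) ^ 3 ∧ Q (h.setRaw (i.val n k h) (e.val n k h))
  | .put r i j e, Q, h => e.val n k h ≤ (n + k + 2) ^ 3 ∧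
      Q (h.setArr r (i.val n k h) (j.val n k h) (e.val n k h))
  | .seq p q, Q, h => wp n k p (wp n k q Q) h
  | .ite b p q, Q, h => (b.val n k h ≠ 0 → wp n k p Q h) ∧ (b.val n k h = 0 → wp n k q Q h)
  | .upto x N p, Q, h => Sat n k (.upto x N p) h Q

/-- Loop-free code is executed symbolically; each counting loop met on the way leaves a `Sat` goal
for the invariant rule. Nested loops are treated by alternating the two. -/
theorem wp_sound {p : Cmd} (hp : wp n k p Q h) : Sat n k p h Q := by
  induction p generalizing h Q with
  | skip =>
    intro hb d hd s hs
    exact ⟨1, s, h, .skip s, le_rfl, hs, hb, Frame.refl _ _, hp⟩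
  | set x e =>
    intro hb d hd s hs
    refine ⟨_, _, _, .assign _ _ s (hs.fits_compile hb hd), le_rfl,
      by rw [hs.val_compile]; exact hs.setReg _ _, hb.setReg _ (hp.1),
      ⟨fun y hy => ?_, fun _ _ => rfl, fun _ => rfl⟩, hp.2⟩
    simp only [Cmd.writesReg, decide_eq_false_iff_not] at hy
    simp [Store.setReg, Ne.symm hy]
  | getRaw x i =>
    intro hb d hd s hs
    have hv : (Term.load i.compile).val s = h.raw (i.val n k h) := by
      rw [Term.val, hs.val_compile, hs.raw _ hp.1]
    have hsm : (Term.load i.compile).Small ((n + k + 2) ^ 3) s :=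
      ⟨hs.small_compile hb i, by rw [show s.mem _ = _ from hv]; exact hb.raw _⟩
    refine ⟨_, _, _, .assign _ _ s (hsm.fits (by omega) hd),
      by simp [Term.cost, Cmd.cost], by rw [hv]; exact hs.setReg _ _,
      hb.setReg _ (hb.raw _), ⟨fun y hy => ?_, fun _ _ => rfl, fun _ => rfl⟩, hp.2⟩
    simp only [Cmd.writesReg, decide_eq_false_iff_not] at hy
    simp [Store.setReg, Ne.symm hy]
  | putRaw i e =>
    intro hb d hd s hs
    simp only [Cmd.compile, Program.deg] at hd
    refine ⟨_, _, _, .store _ _ s (hs.fits_compile hb (by omega)) (hs.fits_compile hb (by omega)),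
      le_rfl, by rw [hs.val_compile, hs.val_compile]; exact hs.setRaw hp.1 _,
      hb.setRaw _ (hp.2.1), ⟨fun _ _ => rfl, fun _ _ => rfl, fun hr => ?_⟩, hp.2.2⟩
    simp [Cmd.writesRaw] at hr
  | put r i j e =>
    intro hb d hd s hs
    simp only [Cmd.compile, Program.deg] at hd
    have hv : (addrTerm r i.compile j.compile).val s
        = addr n k r (i.val n k h) (j.val n k h) := by
      simp only [addrTerm, Term.val, hs.val_compile, hs.reg_zero, addr]
    have hsm := hs.small_compile hb (.get r i j)
    refine ⟨_, _, _, .store _ _ s (hsm.1.fits (by omega) (by omega))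
      (hs.fits_compile hb (by omega)), le_rfl,
      by rw [hv, hs.val_compile]; exact hs.setArr _ _ _ _, hb.setArr _ _ _ (hp.1),
      ⟨fun _ _ => rfl, fun r' hr => ?_, fun _ => rfl⟩, hp.2⟩
    simp only [Cmd.writesArr, decide_eq_false_iff_not] at hr
    simp [Store.setArr, Ne.symm hr]
  | seq p q ihp ihq => exact Sat.seq (ihp hp) fun h' _ hq => ihq hq
  | ite b p q ihp ihq =>
    intro hb d hd s hs
    simp only [Cmd.compile, Program.deg] at hd
    by_cases hbv : b.val n k h = 0
    · obtain ⟨t, s', h', hr, ht, hs', hb', hf, hq⟩ := ihq (hp.2 hbv) hb d (by omega) s hs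
      exact ⟨_, s', h', .ite_false _ _ _ _ _ _ (hs.fits_compile hb (by omega))
        (by rw [hs.val_compile, hbv]) hr, by simp only [Cmd.cost]; omega, hs', hb',
        hf.ite_right, hq⟩
    · obtain ⟨t, s', h', hr, ht, hs', hb', hf, hq⟩ := ihp (hp.1 hbv) hb d (by omega) s hs
      exact ⟨_, s', h', .ite_true _ _ _ _ _ _ (hs.fits_compile hb (by omega))
        (by rw [hs.val_compile]; exact hbv) hr, by simp only [Cmd.cost]; omega, hs', hb',
        hf.ite_left, hq⟩
  | upto x N p ih => exact hp

/-- The invariant rule for counting loops. -/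
theorem Sat.upto_rule {x : Var} {N : Bound} {p : Cmd} (I : ℕ → Store → Prop)
    (hx : p.writesReg x = false) (h0 : I 0 (h.setReg x 0))
    (step : ∀ i < N.val n k, ∀ h', h'.Bdd n k → Frame (.upto x N p) h h' → h'.reg x = i → I i h' →
      Sat n k p h' fun h'' => I (i + 1) (h''.setReg x (i + 1)))
    (hQ : ∀ h', Frame (.upto x N p) h h' → I (N.val n k) h' → Q h') :
    Sat n k (.upto x N p) h Q := by
  intro hb d hd s hs
  simp only [Cmd.compile, Program.deg, Term.deg] at hd
  have hN := N.val_lt n k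
  have h3d : (n + k + 2) ^ 3 < (n + k + 2) ^ d := Nat.pow_lt_pow_right (by omega) (by omega)
  have test : ∀ s h', Rep n k s h' →
      (Term.lt (.reg x.code) (.reg N.code)).val s
        = if h'.reg x < N.val n k then 1 else 0 := by
    intro s h' hs
    simp only [Term.val, hs.reg, hs.bound]
  have testFits : ∀ s h', Rep n k s h' → h'.Bdd n k →
      (Term.lt (.reg x.code) (.reg N.code)).Fits ((n + k + 2) ^ d) s := by
    intro s h' hs hb
    refine ⟨?_, ?_, ?_⟩
    · simp only [Term.Fits, hs.reg]; exact (hb.reg x).trans_lt h3d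
    · simp only [Term.Fits, hs.bound]; omega
    · rw [test s h' hs]
      split_ifs <;> omega
  -- Induction on the number `m` of remaining rounds. The test costs 4 steps and the increment 4,
  -- hence 8 per round besides the body; the last, failing test costs 4, and the initial assignment
  -- 2 more.
  have main : ∀ m i, i + m = N.val n k → ∀ s h', Rep n k s h' → h'.Bdd n k →
      Frame (.upto x N p) h h' → h'.reg x = i → I i h' →
      ∃ t s' h'', Runs ((n + k + 2) ^ d) (.loop (.lt (.reg x.code) (.reg N.code))
        (.seq p.compile (.assign x.code (.add (.reg x.code) (.const 1))))) s t s' ∧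
        t ≤ m * (p.cost n k + 8) + 4 ∧ Rep n k s' h'' ∧ h''.Bdd n k ∧
        Frame (.upto x N p) h h'' ∧ I (N.val n k) h'' := by
    intro m
    induction m with
    | zero =>
      intro i hi s h' hs hb hf hxi hI
      refine ⟨_, s, h', .loop_false _ _ _ (testFits s h' hs hb) ?_, by simp [Term.cost], hs, hb, hf,
        ?_⟩
      · rw [test s h' hs, if_neg (by omega)]
      · rwa [show N.val n k = i by omega]
    | succ m ih =>
      intro i hi s h' hs hb hf hxi hI
      obtain ⟨t₁, s₁, h₁, hr₁, ht₁, hs₁, hb₁, hf₁, hI₁⟩ :=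
        step i (by omega) h' hb hf hxi hI hb d (by omega) s hs
      have hx₁ : h₁.reg x = i := by rw [hf₁.reg x hx, hxi]
      have hv : (Term.add (.reg x.code) (.const 1)).val s₁ = i + 1 := by
        simp only [Term.val, hs₁.reg, hx₁]
      have hr₂ := Runs.assign (W := (n + k + 2) ^ d) x.code (.add (.reg x.code) (.const 1)) s₁
        ⟨by simp only [Term.Fits, hs₁.reg, hx₁]; omega, by simp only [Term.Fits]; omega,
          by rw [hv]; omega⟩
      rw [hv] at hr₂
      obtain ⟨t₃, s₃, h₃, hr₃, ht₃, hs₃, hb₃, hf₃, hI₃⟩ := ih (i + 1) (by omega) _ _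
        (hs₁.setReg x (i + 1)) (hb₁.setReg x (by omega))
        ((hf.trans hf₁.upto_body).trans (Frame.upto_setReg _ _)) (by simp [Store.setReg]) hI₁
      refine ⟨_, s₃, h₃, .loop_true _ _ _ _ _ _ _ (testFits s h' hs hb)
        (by rw [test s h' hs, if_pos (by omega)]; omega) (.seq _ _ _ _ _ _ _ hr₁ hr₂) hr₃, ?_,
        hs₃, hb₃, hf₃, hI₃⟩
      simp only [Term.cost]
      rw [Nat.succ_mul]
      omega
  obtain ⟨t, s', h', hr, ht, hs', hb', hf', hI'⟩ := main (N.val n k) 0 (by omega) _ _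
    (hs.setReg x 0) (hb.setReg x (by omega)) (Frame.upto_setReg _ _) (by simp [Store.setReg]) h0
  refine ⟨_, s', h', .seq _ _ _ _ _ _ _ (.assign _ _ s ?_) hr, ?_, hs', hb', hf', hQ h' hf' hI'⟩
  · simp only [Term.Fits]; omega
  · simp only [Term.cost, Cmd.cost]; omega

/-! ### Running times as monomials in `n` and `k` -/

/-- The power of `n` in the running time. -/
def Cmd.degN : Cmd → ℕ
  | .seq p q => max p.degN q.degN
  | .ite _ p q => max p.degN q.degN
  | .upto _ .k p => p.degN
  | .upto _ _ p => p.degN + 1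
  | _ => 0

/-- The power of `k` in the running time. -/
def Cmd.degK : Cmd → ℕ
  | .seq p q => max p.degK q.degK
  | .ite _ p q => max p.degK q.degK
  | .upto _ .k p => p.degK + 1
  | .upto _ _ p => p.degK
  | _ => 0

/-- The running time is polynomial in `n` and `k`, with the computed exponents. -/
theorem Cmd.exists_cost_le (p : Cmd) : ∃ C, ∀ n k, 1 ≤ n → 1 ≤ k →
    p.cost n k ≤ C * (n ^ p.degN * k ^ p.degK) := by
  have const : ∀ p : Cmd, (∀ n k, p.cost n k = p.cost 0 0) → p.degN = 0 → p.degK = 0 →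
      ∃ C, ∀ n k, 1 ≤ n → 1 ≤ k → p.cost n k ≤ C * (n ^ p.degN * k ^ p.degK) :=
    fun p hp hn hk => ⟨p.cost 0 0, fun n k _ _ => by simp [hp n k, hn, hk]⟩
  have two : ∀ {p q : Cmd}, (∃ C, ∀ n k, 1 ≤ n → 1 ≤ k →
      p.cost n k ≤ C * (n ^ p.degN * k ^ p.degK)) → (∃ C, ∀ n k, 1 ≤ n → 1 ≤ k →
      q.cost n k ≤ C * (n ^ q.degN * k ^ q.degK)) → ∀ a, ∃ C, ∀ n k, 1 ≤ n → 1 ≤ k →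
      a + (p.cost n k + q.cost n k)
        ≤ C * (n ^ max p.degN q.degN * k ^ max p.degK q.degK) := by
    rintro p q ⟨C, hC⟩ ⟨D, hD⟩ a
    refine ⟨a + (C + D), fun n k hn hk => ?_⟩
    have h1 : 1 ≤ n ^ max p.degN q.degN * k ^ max p.degK q.degK :=
      Nat.mul_pos (Nat.pow_pos hn) (Nat.pow_pos hk)
    rw [Nat.add_mul, Nat.add_mul]
    refine Nat.add_le_add (Nat.le_mul_of_pos_right a h1) (Nat.add_le_add
      ((hC n k hn hk).trans ?_) ((hD n k hn hk).trans ?_))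
    all_goals
      gcongr <;> simp
  have loop : ∀ {p : Cmd} (N : Bound), (∃ C, ∀ n k, 1 ≤ n → 1 ≤ k →
      p.cost n k ≤ C * (n ^ p.degN * k ^ p.degK)) → ∃ C, ∀ n k, 1 ≤ n → 1 ≤ k →
      (N.val n k * (p.cost n k + 8) + 6 ≤ C * (max 1 (N.val n k) * (n ^ p.degN * k ^ p.degK))) := by
    rintro p N ⟨C, hC⟩
    refine ⟨C + 8 + 6, fun n k hn hk => ?_⟩
    have h1 : 1 ≤ n ^ p.degN * k ^ p.degK := Nat.mul_pos (Nat.pow_pos hn) (Nat.pow_pos hk)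
    -- The loop bound `n - 1` vanishes for `n = 1`, but the loop still costs a constant; the maximum
    -- with 1 absorbs it.
    have h2 : 1 ≤ max 1 (N.val n k) := le_max_left _ _
    have h3 : N.val n k ≤ max 1 (N.val n k) := le_max_right _ _
    have h4 := hC n k hn hk
    generalize n ^ p.degN * k ^ p.degK = y at *
    generalize max 1 (N.val n k) = z at *
    calc N.val n k * (p.cost n k + 8) + 6 ≤ z * (C * y + 8 * y) + 6 * (z * y) := by
          refine Nat.add_le_add (Nat.mul_le_mul h3 (by omega)) ?_
          have := Nat.mul_le_mul h2 h1
          omega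
      _ = _ := by ring
  induction p with
  | skip | set x e | getRaw x i | putRaw i e | put r i j e =>
    exact const _ (fun _ _ => rfl) rfl rfl
  | seq p q ihp ihq => simpa [Cmd.cost, Cmd.degN, Cmd.degK] using two ihp ihq 0
  | ite b p q ihp ihq => exact two ihp ihq (b.compile.cost + 1)
  | upto x N p ih =>
    obtain ⟨C, hC⟩ := loop N ih
    refine ⟨C, fun n k hn hk => (hC n k hn hk).trans (Nat.mul_le_mul_left C ?_)⟩
    cases N
    · simp only [Bound.val, Cmd.degN, Cmd.degK, max_eq_right hn, pow_succ]
      exact le_of_eq (by ring)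
    · simp only [Bound.val, Cmd.degN, Cmd.degK, pow_succ]
      calc _ ≤ n * (n ^ p.degN * k ^ p.degK) := Nat.mul_le_mul_right _ (by omega)
        _ = _ := by ring
    · simp only [Bound.val, Cmd.degN, Cmd.degK, max_eq_right hk, pow_succ]
      exact le_of_eq (by ring)

end WordRAM

/-! ## Leaf elimination orders and the tree knapsack -/

section

open Finset

/-- `q 0, …, q (n - 1)` lists the numbers below `n`, and every entry but the last has its parent
later in the list. -/
structure IsParentOrder (n : ℕ) (q par : ℕ → ℕ) : Prop where
  inj : ∀ i < n, ∀ j < n, q i = q j → i = j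
  lt : ∀ i < n, q i < n
  exists_par : ∀ i, i + 1 < n → ∃ j, i < j ∧ j < n ∧ par (q i) = q j

/-- The family of sets with top `v` whose other elements are closed under parents and stand among
the first `i` entries of the order. -/
def IsBelow (n : ℕ) (q par : ℕ → ℕ) (i v : ℕ) (U : Finset ℕ) : Prop :=
  v ∈ U ∧ ∀ x ∈ U, x ≠ v → (∃ l, l < i ∧ l + 1 < n ∧ x = q l) ∧ par x ∈ U

/-- `x` is a descendant of `c`. -/
inductive IsDesc (n : ℕ) (q par : ℕ → ℕ) (c : ℕ) : ℕ → Prop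
  | refl : IsDesc n q par c c
  | step (l : ℕ) (hl : l + 1 < n) (h : IsDesc n q par c (par (q l))) : IsDesc n q par c (q l)

/-- The indicator of an empty vertex. -/
def emptyInd (w : ℕ → ℕ) (v : ℕ) : ℕ := if w v = 0 then 1 else 0

/-- The table after the child `c` has been merged into its parent `p`, where `e` is the number of
empty vertices in `{c}`. -/
def mergeStep (k : ℕ) (g : ℕ → ℕ → ℕ) (c p e : ℕ) : ℕ → ℕ → ℕ := fun v b =>
  if v = p then
    max (g p b) ((range k).sup fun a => if a + e ≤ b then g p (b - (a + e)) + g c a else 0)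
  else g v b

/-- The table of the tree knapsack after `i` merges: entry `v b` is the largest weight of a set with
top `v` that contains at most `b` empty vertices besides `v`. -/
def table (n k : ℕ) (q par w : ℕ → ℕ) : ℕ → ℕ → ℕ → ℕ
  | 0 => fun v _ => w v
  | i + 1 =>
    if i + 1 < n then
      mergeStep k (table n k q par w i) (q i) (par (q i)) (emptyInd w (q i))
    else table n k q par w i

namespace IsParentOrder

variable {n k : ℕ} {q par w : ℕ → ℕ}

theorem exists_eq (h : IsParentOrder n q par) {v : ℕ} (hv : v < n) : ∃ i < n, q i = v := by
  have : Set.SurjOn q (range n) (range n) :=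
    Finset.surjOn_of_injOn_of_card_le q (fun i hi => by simpa using h.lt i (by simpa using hi))
      (fun i hi j hj hij => h.inj i (by simpa using hi) j (by simpa using hj) hij) le_rfl
  obtain ⟨i, hi, rfl⟩ := this (show v ∈ (range n : Set ℕ) by simpa using hv)
  exact ⟨i, by simpa using hi, rfl⟩

/-- Parents stand later in the order, so going down from `q i` only decreases the index. -/
theorem index_le_of_isDesc (h : IsParentOrder n q par) {i x : ℕ} (hi : i < n)
    (hx : IsDesc n q par (q i) x) : ∃ l ≤ i, x = q l := by
  induction hx with
  | refl => exact ⟨i, le_rfl, rfl⟩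
  | step l hl _ ih =>
    obtain ⟨l', hl', he⟩ := ih
    obtain ⟨j, hlj, hj, hpj⟩ := h.exists_par l hl
    have := h.inj l' (by omega) j hj (by rw [← he, hpj])
    exact ⟨l, by omega, rfl⟩

/-- Merge number `i` changes only the row of the parent of `q i`, which stands after position `i`.
So the row of `q l` is final once the first `l` merges are done. -/
theorem table_eq_of_le (h : IsParentOrder n q par) {l i : ℕ} (hl : l < n) (hi : l ≤ i) :
    table n k q par w i (q l) = table n k q par w l (q l) := by
  induction i, hi using Nat.le_induction with
  | base => rfl
  | succ i hi ih =>
    rw [← ih, table]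
    split_ifs with hin
    · obtain ⟨j, hij, hj, hp⟩ := h.exists_par i hin
      funext b
      rw [mergeStep, if_neg]
      intro he
      have := h.inj l hl j hj (by rw [he, hp])
      omega
    · rfl

/-- Optimality half of the knapsack. In the merge of `q i` into `v`, a set containing `q i` is cut
at this edge into the descendants of `q i` and the rest; induction applies to both pieces, with the
budget divided accordingly. All other sets already belong to the previous stage. -/
theorem sum_le_table (h : IsParentOrder n q par) {i v : ℕ} {U : Finset ℕ}
    (hU : IsBelow n q par i v U) {b : ℕ} (hb : ∑ x ∈ U.erase v, emptyInd w x ≤ b) (hbk : b < k) :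
    ∑ x ∈ U, w x ≤ table n k q par w i v b := by
  classical
  induction i generalizing v U b with
  | zero =>
    have : U = {v} := by
      refine Finset.eq_singleton_iff_unique_mem.2 ⟨hU.1, fun x hx => ?_⟩
      by_contra hne
      obtain ⟨⟨l, hl, _⟩, _⟩ := hU.2 x hx hne
      omega
    simp [this, table]
  | succ i ih =>
    rw [table]
    split_ifs with hin
    swap
    · refine ih ⟨hU.1, fun x hx hne => ?_⟩ hb hbk
      obtain ⟨⟨l, hl, hln, hxl⟩, hp⟩ := hU.2 x hx hne
      exact ⟨⟨l, by omega, hln, hxl⟩, hp⟩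
    obtain ⟨j, hij, hj, hp⟩ := h.exists_par i hin
    have restrict : ∀ V : Finset ℕ, IsBelow n q par (i + 1) v V → (q i ∈ V → q i = v) →
        IsBelow n q par i v V := by
      intro V hV hc
      refine ⟨hV.1, fun x hx hne => ?_⟩
      obtain ⟨⟨l, hl, hln, hxl⟩, hp⟩ := hV.2 x hx hne
      refine ⟨⟨l, lt_of_le_of_ne (by omega) ?_, hln, hxl⟩, hp⟩
      rintro rfl
      exact hne (hxl.trans (hc (hxl ▸ hx)))
    by_cases hv : v = par (q i)
    swap
    · rw [mergeStep, if_neg hv]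
      refine ih (restrict U hU fun hc => ?_) hb hbk
      by_contra hne
      have hpU := (hU.2 _ hc hne).2
      obtain ⟨⟨l, hl, hln, hxl⟩, _⟩ := hU.2 _ hpU (Ne.symm hv)
      have := h.inj j hj l (by omega) (by rw [← hp, hxl])
      omega
    rw [mergeStep, if_pos hv, ← hv]
    by_cases hc : q i ∈ U
    swap
    · exact (ih (restrict U hU fun hc' => absurd hc' hc) hb hbk).trans (le_max_left _ _)
    have hvj : v = q j := by rw [hv, hp]
    have hvD : ¬ IsDesc n q par (q i) v := by
      intro hD
      obtain ⟨l, hl, hvl⟩ := h.index_le_of_isDesc (by omega) hD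
      have := h.inj j hj l (by omega) (by rw [← hvj, hvl])
      omega
    -- Cutting at the edge from `q i` to `v`: `U₁` keeps the top `v` and loses `q i`, while `U₂` has
    -- `q i` as its top. So the non-top elements of both pieces stand before position `i`.
    set U₁ := U.filter fun x => ¬ IsDesc n q par (q i) x with hU₁
    set U₂ := U.filter fun x => IsDesc n q par (q i) x with hU₂
    have hsum : ∀ g : ℕ → ℕ, ∑ x ∈ U, g x = ∑ x ∈ U₁, g x + ∑ x ∈ U₂, g x := fun g => by
      rw [add_comm]; exact (Finset.sum_filter_add_sum_filter_not U _ g).symm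
    have hv₁ : v ∈ U₁ := by simp [hU₁, hU.1, hvD]
    have hc₂ : q i ∈ U₂ := by simp [hU₂, hc, IsDesc.refl]
    have hB₁ : IsBelow n q par i v U₁ := by
      refine ⟨hv₁, fun x hx hne => ?_⟩
      simp only [hU₁, Finset.mem_filter] at hx ⊢
      obtain ⟨⟨l, hl, hln, rfl⟩, hp⟩ := hU.2 x hx.1 hne
      refine ⟨⟨l, lt_of_le_of_ne (by omega) ?_, hln, rfl⟩, hp, fun hD => hx.2 (.step l hln hD)⟩
      rintro rfl
      exact hx.2 .refl
    have hB₂ : IsBelow n q par i (q i) U₂ := by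
      refine ⟨hc₂, fun x hx hne => ?_⟩
      simp only [hU₂, Finset.mem_filter] at hx ⊢
      have hxv : x ≠ v := by rintro rfl; exact hvD hx.2
      obtain ⟨⟨l, hl, hln, hxl⟩, hp⟩ := hU.2 x hx.1 hxv
      refine ⟨⟨l, lt_of_le_of_ne (by omega) ?_, hln, hxl⟩, hp, ?_⟩
      · rintro rfl
        exact hne hxl
      · cases hx.2 with
        | refl => exact absurd rfl hne
        | step l hl hD => exact hD
    have e₀ := Finset.add_sum_erase U (emptyInd w) hU.1
    have e₁ := Finset.add_sum_erase U₁ (emptyInd w) hv₁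
    have e₂ := Finset.add_sum_erase U₂ (emptyInd w) hc₂
    have e₃ := hsum (emptyInd w)
    -- The split `a` is the number of empty vertices of `U₂` besides `q i`; it is at most `b < k`
    -- and thus among the splits that the merge tries.
    have hab : ∑ x ∈ U₂.erase (q i), emptyInd w x + emptyInd w (q i) ≤ b := by omega
    refine le_trans ?_ (le_max_right _ _)
    refine le_trans ?_ (Finset.le_sup (f := fun a => if a + emptyInd w (q i) ≤ b then
      table n k q par w i v (b - (a + emptyInd w (q i))) + table n k q par w i (q i) a else 0)
      (Finset.mem_range.2 (show ∑ x ∈ U₂.erase (q i), emptyInd w x < k by omega)))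
    rw [if_pos hab, hsum w]
    exact Nat.add_le_add (ih hB₁ (by omega) (by omega)) (ih hB₂ le_rfl (by omega))

end IsParentOrder

/-! ### Top-down reconstruction of an optimal set -/

/-- The state of the top-down reconstruction of an optimal set when the entries from the `i`-th on
have been treated: `S` is the set of chosen vertices, and `bud` their budgets. -/
structure IsRecon (n k : ℕ) (q par w : ℕ → ℕ) (t b i : ℕ) (S : Finset ℕ) (bud : ℕ → ℕ) :
    Prop where
  mem : ∀ v ∈ S, ∃ l, i ≤ l ∧ l < n ∧ v = q l
  closed : ∀ v ∈ S, v ≠ t → par v ∈ S ∧ ∃ l, l + 1 < n ∧ v = q l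
  top : ((∃ l < i, q l = t) ∧ S = ∅) ∨ (t ∈ S ∧
    ∑ v ∈ S, table n k q par w i v (bud v) = table n k q par w n t b ∧
    ∑ v ∈ S, bud v + ∑ v ∈ S.erase t, emptyInd w v ≤ b)

namespace IsRecon

variable {n k : ℕ} {q par w : ℕ → ℕ} {t b i : ℕ} {S : Finset ℕ} {bud : ℕ → ℕ}

/-- Keeps all budgets below `k`, the range in which the recorded choices are meaningful. -/
theorem bud_le (h : IsRecon n k q par w t b i S bud) {v : ℕ} (hv : v ∈ S) : bud v ≤ b := by
  rcases h.top with ⟨_, rfl⟩ | ⟨_, _, hb⟩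
  · simp at hv
  · have := Finset.single_le_sum (f := bud) (fun _ _ => Nat.zero_le _) hv
    omega

theorem start (ho : IsParentOrder n q par) (ht : t < n) : IsRecon n k q par w t b n ∅ bud :=
  ⟨by simp, by simp, .inl ⟨by obtain ⟨l, hl, h⟩ := ho.exists_eq ht; exact ⟨l, hl, h⟩, rfl⟩⟩

theorem congr_bud (h : IsRecon n k q par w t b i S bud) {bud' : ℕ → ℕ}
    (hb : ∀ v ∈ S, bud' v = bud v) : IsRecon n k q par w t b i S bud' := by
  refine ⟨h.mem, h.closed, h.top.imp id fun ⟨h1, h2, h3⟩ => ⟨h1, ?_, ?_⟩⟩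
  · rw [← h2]; exact Finset.sum_congr rfl fun v hv => by rw [hb v hv]
  · rwa [Finset.sum_congr rfl hb]

/-- Everything chosen so far stands after `q i = t`. A nonempty `S` would already contain `t`, so
`S` is empty and the reconstruction starts here with the whole budget. -/
theorem step_top (ho : IsParentOrder n q par) (h : IsRecon n k q par w t b (i + 1) S bud)
    (hi : i < n) (hit : q i = t) (hbud : bud t = b) : S = ∅ ∧ IsRecon n k q par w t b i {t} bud := by
  have hS : S = ∅ := by
    rcases h.top with ⟨_, h⟩ | ⟨hm, _⟩
    · exact h
    · obtain ⟨l, hl, hln, hl'⟩ := h.mem t hm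
      have := ho.inj i hi l hln (by rw [hit, hl'])
      omega
  refine ⟨hS, fun v hv => ⟨i, le_rfl, hi, ?_⟩, fun v hv hne => ?_, .inr ⟨by simp, ?_, by simp [hbud]⟩⟩
  · rw [hit]; simpa using hv
  · exact absurd (by simpa using hv) hne
  · rw [Finset.sum_singleton, hbud, ← hit, ho.table_eq_of_le hi le_rfl,
      ho.table_eq_of_le hi (show i ≤ n by omega)]

theorem exists_lt (h : IsRecon n k q par w t b (i + 1) S bud) (hit : q i ≠ t) (hS : S = ∅) :
    ∃ l < i, q l = t := by
  rcases h.top with ⟨⟨l, hl, hlt⟩, _⟩ | ⟨hm, _⟩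
  · refine ⟨l, lt_of_le_of_ne (by omega) ?_, hlt⟩
    rintro rfl
    exact hit hlt
  · simp [hS] at hm

theorem step_same (h : IsRecon n k q par w t b (i + 1) S bud) (hit : q i ≠ t)
    (htab : ∀ v ∈ S, table n k q par w (i + 1) v (bud v) = table n k q par w i v (bud v)) :
    IsRecon n k q par w t b i S bud := by
  refine ⟨fun v hv => ?_, h.closed, ?_⟩
  · obtain ⟨l, hl, h⟩ := h.mem v hv
    exact ⟨l, by omega, h⟩
  · rcases h.top with ⟨_, hS⟩ | ⟨h1, h2, h3⟩
    · exact .inl ⟨h.exists_lt hit hS, hS⟩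
    · exact .inr ⟨h1, by rw [← h2]; exact Finset.sum_congr rfl fun v hv => (htab v hv).symm, h3⟩

theorem table_succ_of_ne {v : ℕ} (hv : i + 1 < n → v ≠ par (q i)) :
    table n k q par w (i + 1) v = table n k q par w i v := by
  rw [table]
  split_ifs with hin
  · funext b
    rw [mergeStep, if_neg (hv hin)]
  · rfl

theorem step_skip (h : IsRecon n k q par w t b (i + 1) S bud) (hit : q i ≠ t)
    (hp : par (q i) ∉ S) : IsRecon n k q par w t b i S bud :=
  h.step_same hit fun v hv => by
    rw [table_succ_of_ne]
    rintro _ rfl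
    exact hp hv

theorem step_leave (h : IsRecon n k q par w t b (i + 1) S bud) (hit : q i ≠ t)
    (htab : table n k q par w (i + 1) (par (q i)) (bud (par (q i)))
      = table n k q par w i (par (q i)) (bud (par (q i)))) : IsRecon n k q par w t b i S bud :=
  h.step_same hit fun v hv => by
    by_cases hv : v = par (q i)
    · rw [hv, htab]
    · rw [table_succ_of_ne fun _ => hv]

/-- Rules out the last vertex of the order, which has no parent: a vertex is examined for inclusion
below a chosen parent only when a later vertex exists. -/
theorem succ_lt (h : IsRecon n k q par w t b (i + 1) S bud) {v : ℕ} (hv : v ∈ S) : i + 1 < n := by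
  obtain ⟨l, hl, hln, _⟩ := h.mem _ hv
  omega

theorem notMem (ho : IsParentOrder n q par) (h : IsRecon n k q par w t b (i + 1) S bud)
    (hi : i < n) : q i ∉ S := by
  intro hm
  obtain ⟨l, hl, hln, he⟩ := h.mem _ hm
  have := ho.inj i hi l hln he
  omega

/-- Undoing one merge: the old budget of `p` is divided into `a` for the new vertex, its own
emptiness, and the remainder for `p`. Both the sum of the table entries and the sum of budgets and
spent empty vertices are preserved. -/
theorem step_take (ho : IsParentOrder n q par) (h : IsRecon n k q par w t b (i + 1) S bud)
    (hit : q i ≠ t) {p a : ℕ} (hpar : p = par (q i)) (hp : p ∈ S)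
    (hle : a + emptyInd w (q i) ≤ bud p)
    (htab : table n k q par w (i + 1) p (bud p)
      = table n k q par w i p (bud p - (a + emptyInd w (q i))) + table n k q par w i (q i) a)
    {bud' : ℕ → ℕ} (hbc : bud' (q i) = a) (hbp : bud' p = bud p - (a + emptyInd w (q i)))
    (hbo : ∀ v ∈ S, v ≠ p → bud' v = bud v) :
    IsRecon n k q par w t b i (insert (q i) S) bud' := by
  have hin := h.succ_lt hp
  have hcS := h.notMem ho (by omega)
  refine ⟨fun v hv => ?_, fun v hv hne => ?_, .inr ?_⟩
  · rcases Finset.mem_insert.1 hv with rfl | hv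
    · exact ⟨i, le_rfl, by omega, rfl⟩
    · obtain ⟨l, hl, h⟩ := h.mem v hv
      exact ⟨l, by omega, h⟩
  · rcases Finset.mem_insert.1 hv with rfl | hv
    · exact ⟨Finset.mem_insert_of_mem (hpar ▸ hp), i, hin, rfl⟩
    · exact ⟨Finset.mem_insert_of_mem (h.closed v hv hne).1, (h.closed v hv hne).2⟩
  · rcases h.top with ⟨_, rfl⟩ | ⟨h1, h2, h3⟩
    · simp at hp
    refine ⟨Finset.mem_insert_of_mem h1, ?_, ?_⟩
    · rw [← h2, Finset.sum_insert hcS, hbc, ← Finset.add_sum_erase S _ hp,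
        ← Finset.add_sum_erase S _ hp, hbp, htab]
      have : ∑ x ∈ S.erase p, table n k q par w i x (bud' x)
          = ∑ x ∈ S.erase p, table n k q par w (i + 1) x (bud x) := by
        refine Finset.sum_congr rfl fun x hx => ?_
        rw [Finset.mem_erase] at hx
        rw [hbo x hx.2 hx.1, table_succ_of_ne fun _ => hpar ▸ hx.1]
      rw [this]
      ring
    · rw [Finset.erase_insert_of_ne hit, Finset.sum_insert (fun hm => hcS (Finset.mem_of_mem_erase hm)),
        Finset.sum_insert hcS, hbc, ← Finset.add_sum_erase S bud' hp, hbp]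
      have h4 := Finset.add_sum_erase S bud hp
      have : ∑ x ∈ S.erase p, bud' x = ∑ x ∈ S.erase p, bud x := by
        refine Finset.sum_congr rfl fun x hx => ?_
        rw [Finset.mem_erase] at hx
        exact hbo x hx.2 hx.1
      omega

theorem sum_eq (h : IsRecon n k q par w t b 0 S bud) :
    ∑ v ∈ S, w v = table n k q par w n t b := by
  rcases h.top with ⟨⟨l, hl, _⟩, _⟩ | ⟨_, h2, _⟩
  · omega
  · exact h2

theorem sum_emptyInd_le (h : IsRecon n k q par w t b 0 S bud) :
    ∑ v ∈ S, emptyInd w v ≤ b + emptyInd w t := by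
  rcases h.top with ⟨⟨l, hl, _⟩, _⟩ | ⟨h1, _, h3⟩
  · omega
  · rw [← Finset.add_sum_erase S _ h1]
    omega

theorem isBelow (h : IsRecon n k q par w t b 0 S bud) : IsBelow n q par n t S := by
  rcases h.top with ⟨⟨l, hl, _⟩, _⟩ | ⟨h1, _, _⟩
  · omega
  · refine ⟨h1, fun x hx hne => ?_⟩
    obtain ⟨hp, l, hl, he⟩ := h.closed x hx hne
    exact ⟨⟨l, by omega, hl, he⟩, hp⟩

end IsRecon

/-! ### Trimming a connected set to at most `k` vertices -/

/-- The state of the trimming pass when the entries from the `i`-th on have been treated: the set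
`T` of kept elements of `S` has at most `k` elements. -/
structure IsTrim (n k : ℕ) (q par : ℕ → ℕ) (t : ℕ) (S : Finset ℕ) (i : ℕ) (T : Finset ℕ) :
    Prop where
  mem : ∀ v ∈ T, v ∈ S ∧ ∃ l, i ≤ l ∧ l < n ∧ v = q l
  closed : ∀ v ∈ T, v ≠ t → par v ∈ T
  top : T.Nonempty → t ∈ T
  card_le : T.card ≤ k
  full : T.card < k → ∀ l, i ≤ l → l < n → q l ∈ S → q l ∈ T

namespace IsTrim

variable {n k : ℕ} {q par w : ℕ → ℕ} {t i : ℕ} {S T : Finset ℕ}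

theorem start : IsTrim n k q par t S n ∅ :=
  ⟨by simp, by simp, by simp, by simp, fun _ l hl hn => by omega⟩

theorem notMem (ho : IsParentOrder n q par) (h : IsTrim n k q par t S (i + 1) T) (hi : i < n) :
    q i ∉ T := by
  intro hm
  obtain ⟨_, l, hl, hln, he⟩ := h.mem _ hm
  have := ho.inj i hi l hln he
  omega

/-- While fewer than `k` vertices are kept, no later element of `S` has been dropped; the parent of
`q i` is one of them, so the kept set stays closed under parents. -/
theorem step_keep (ho : IsParentOrder n q par) (hS : IsBelow n q par n t S)
    (h : IsTrim n k q par t S (i + 1) T) (hi : i < n) (hm : q i ∈ S) (hT : T.card < k) :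
    IsTrim n k q par t S i (insert (q i) T) := by
  have hpar : q i ≠ t → par (q i) ∈ T := by
    intro hne
    obtain ⟨⟨l, _, hln, hl⟩, hp⟩ := hS.2 _ hm hne
    obtain rfl := ho.inj i hi l (by omega) hl
    obtain ⟨j, hij, hj, he⟩ := ho.exists_par i hln
    rw [he] at hp ⊢
    exact h.full hT j hij hj hp
  refine ⟨fun v hv => ?_, fun v hv hne => ?_, fun _ => ?_, ?_, fun _ l hl hln hlS => ?_⟩
  · rcases Finset.mem_insert.1 hv with rfl | hv
    · exact ⟨hm, i, le_rfl, hi, rfl⟩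
    · obtain ⟨h1, l, hl, h2⟩ := h.mem v hv
      exact ⟨h1, l, by omega, h2⟩
  · rcases Finset.mem_insert.1 hv with rfl | hv
    · exact Finset.mem_insert_of_mem (hpar hne)
    · exact Finset.mem_insert_of_mem (h.closed v hv hne)
  · by_cases hne : q i = t
    · simp [hne]
    · exact Finset.mem_insert_of_mem (h.top ⟨_, hpar hne⟩)
  · rw [Finset.card_insert_of_notMem (h.notMem ho hi)]
    omega
  · rcases Nat.eq_or_lt_of_le hl with rfl | hl
    · simp
    · exact Finset.mem_insert_of_mem (h.full hT l hl hln hlS)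

theorem step_drop (h : IsTrim n k q par t S (i + 1) T) (hm : q i ∈ S → k ≤ T.card) :
    IsTrim n k q par t S i T := by
  refine ⟨fun v hv => ?_, h.closed, h.top, h.card_le, fun hT l hl hln hlS => ?_⟩
  · obtain ⟨h1, l, hl, h2⟩ := h.mem v hv
    exact ⟨h1, l, by omega, h2⟩
  · rcases Nat.eq_or_lt_of_le hl with rfl | hl
    · have := hm hlS
      omega
    · exact h.full hT l hl hln hlS

theorem eq_of_card_lt (ho : IsParentOrder n q par) (h : IsTrim n k q par t S 0 T)
    (hS : ∀ v ∈ S, v < n) (hT : T.card < k) : T = S := by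
  refine Finset.Subset.antisymm (fun v hv => (h.mem v hv).1) fun v hv => ?_
  obtain ⟨l, hl, rfl⟩ := ho.exists_eq (hS v hv)
  exact h.full hT l (Nat.zero_le _) hl hv

/-- Since `0 < k`, an empty `T` would be an untrimmed `S`, but `S` contains `t`; so `T` is nonempty
and contains the top. -/
theorem isBelow (ho : IsParentOrder n q par) (hk : 0 < k) (h : IsTrim n k q par t S 0 T)
    (hSn : ∀ v ∈ S, v < n) (hS : IsBelow n q par n t S) : IsBelow n q par n t T := by
  have hne : T.Nonempty := by
    by_contra hne
    rw [Finset.not_nonempty_iff_eq_empty] at hne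
    have := h.eq_of_card_lt ho hSn (by simp [hne, hk])
    rw [hne] at this
    exact absurd hS.1 (by simp [← this])
  exact ⟨h.top hne, fun x hx hxt => ⟨(hS.2 x (h.mem x hx).1 hxt).1, h.closed x hx hxt⟩⟩

theorem one_le_add (w : ℕ → ℕ) (v : ℕ) : 1 ≤ w v + emptyInd w v := by
  unfold emptyInd
  split_ifs <;> omega

/-- Trimming does not increase the cost. -/
theorem cost_le (ho : IsParentOrder n q par) (h : IsTrim n k q par t S 0 T)
    (hS : ∀ v ∈ S, v < n) :
    max (k - ∑ v ∈ T, w v) (∑ v ∈ T, emptyInd w v)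
      ≤ max (k - ∑ v ∈ S, w v) (∑ v ∈ S, emptyInd w v) := by
  rcases Nat.eq_or_lt_of_le h.card_le with hc | hc
  · have h1 : ∑ v ∈ T, emptyInd w v ≤ ∑ v ∈ S, emptyInd w v :=
      Finset.sum_le_sum_of_subset fun v hv => (h.mem v hv).1
    have h2 : ∑ v ∈ T, 1 ≤ ∑ v ∈ T, (w v + emptyInd w v) :=
      Finset.sum_le_sum fun v _ => one_le_add w v
    rw [Finset.sum_add_distrib] at h2
    simp only [Finset.sum_const, smul_eq_mul, mul_one] at h2
    omega
  · rw [h.eq_of_card_lt ho hS hc]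

end IsTrim

end

/-! ## Connected vertex sets of a tree -/

/-- A leaf elimination order of a tree together with the parents. -/
structure IsElimOrder {n : ℕ} (G : SimpleGraph (Fin n)) (q par : ℕ → ℕ) : Prop extends
    IsParentOrder n q par where
  adj : ∀ (u v : Fin n) (l j : ℕ), l < j → j < n → (u : ℕ) = q l → (v : ℕ) = q j →
    (G.Adj u v ↔ par (q l) = q j)

namespace IsElimOrder

variable {n k : ℕ} {G : SimpleGraph (Fin n)} {q par w : ℕ → ℕ}

/-- Every element reaches the top by climbing to its parent repeatedly; the position in the order
increases at each step. -/
theorem connected_of_isBelow (h : IsElimOrder G q par) {t : ℕ} {U : Finset ℕ}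
    (hU : IsBelow n q par n t U) (hn : ∀ v ∈ U, v < n) :
    (G.induce {v : Fin n | (v : ℕ) ∈ U}).Connected := by
  have ht : (⟨t, hn t hU.1⟩ : Fin n) ∈ {v : Fin n | (v : ℕ) ∈ U} := hU.1
  have key : ∀ m l, l < n → n - l ≤ m → ∀ (v : Fin n) (hv : v ∈ {v : Fin n | (v : ℕ) ∈ U}),
      (v : ℕ) = q l → (G.induce {v : Fin n | (v : ℕ) ∈ U}).Reachable ⟨v, hv⟩ ⟨_, ht⟩ := by
    intro m
    induction m with
    | zero => intro l hl hm; omega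
    | succ m ih =>
      intro l hl hm v hv hvl
      by_cases hvt : (v : ℕ) = t
      · have : v = ⟨t, hn t hU.1⟩ := Fin.ext hvt
        subst this
        exact .refl _
      · obtain ⟨⟨l', _, hl', he⟩, hp⟩ := hU.2 v hv hvt
        obtain rfl := h.inj l hl l' (by omega) (by rw [← hvl, he])
        obtain ⟨j, hlj, hj, hpj⟩ := h.exists_par l hl'
        rw [hvl] at hp
        have hadj : G.Adj v ⟨par (q l), hn _ hp⟩ := (h.adj _ _ l j hlj hj hvl hpj).2 hpj
        have hr := ih j hj (by omega) ⟨par (q l), hn _ hp⟩ hp hpj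
        refine SimpleGraph.Reachable.trans (SimpleGraph.Adj.reachable ?_) hr
        exact hadj
  have : Nonempty {v : Fin n | (v : ℕ) ∈ U} := ⟨⟨_, ht⟩⟩
  have toTop : ∀ x : {v : Fin n | (v : ℕ) ∈ U},
      (G.induce {v : Fin n | (v : ℕ) ∈ U}).Reachable x ⟨_, ht⟩ := by
    rintro ⟨v, hv⟩
    obtain ⟨l, hl, he⟩ := h.exists_eq v.2
    exact key _ l hl le_rfl v hv he.symm
  exact ⟨fun x y => (toTop x).trans (toTop y).symm⟩

/-- The top is the last element of the set in the order. For another element `x`, a walk to the top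
inside the set must leave the descendants of `x`, and the only edge leaving them goes from `x` to
its parent, which therefore lies in the set. -/
theorem exists_isBelow (h : IsElimOrder G q par) {S : Set (Fin n)} (hS : (G.induce S).Connected)
    {U : Finset ℕ} (hU : ∀ v, v ∈ U ↔ ∃ hv : v < n, (⟨v, hv⟩ : Fin n) ∈ S) :
    ∃ t, IsBelow n q par n t U := by
  classical
  obtain ⟨⟨x₀, hx₀⟩⟩ := hS.nonempty
  obtain ⟨l₀, hl₀, he₀⟩ := h.exists_eq x₀.2
  have hne : ((Finset.range n).filter fun l => q l ∈ U).Nonempty :=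
    ⟨l₀, by simp only [Finset.mem_filter, Finset.mem_range, he₀, hU]; exact ⟨hl₀, x₀.2, hx₀⟩⟩
  obtain ⟨m, hm, hmax⟩ := Finset.exists_max_image _ id hne
  simp only [Finset.mem_filter, Finset.mem_range, id] at hm hmax
  refine ⟨q m, hm.2, fun x hx hxt => ?_⟩
  obtain ⟨hxn, hxS⟩ := (hU x).1 hx
  obtain ⟨l, hl, rfl⟩ := h.exists_eq hxn
  have hlm : l < m := lt_of_le_of_ne (hmax l ⟨hl, hx⟩) fun he => hxt (he ▸ rfl)
  refine ⟨⟨l, hl, by omega, rfl⟩, ?_⟩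
  obtain ⟨hmn, hmS⟩ := (hU _).1 hm.2
  obtain ⟨p⟩ := hS.preconnected ⟨_, hxS⟩ ⟨_, hmS⟩
  obtain ⟨d, -, hd₁, hd₂⟩ := p.exists_boundary_dart {y | IsDesc n q par (q l) (y : Fin n)} .refl
    (fun hD => by
      obtain ⟨l', hl', he⟩ := h.index_le_of_isDesc hl hD
      have := h.inj m hm.1 l' (by omega) he
      omega)
  obtain ⟨⟨⟨⟨u, hun⟩, huS⟩, ⟨⟨v, hvn⟩, hvS⟩⟩, hadj⟩ := d
  simp only [SimpleGraph.comap_adj, Function.Embedding.subtype_apply, Set.mem_ofPred_eq] at hadj hd₁ hd₂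
  have hvU : v ∈ U := (hU v).2 ⟨hvn, hvS⟩
  obtain ⟨a, ha, rfl⟩ := h.exists_eq hun
  obtain ⟨b, hb, rfl⟩ := h.exists_eq hvn
  -- The later end of an edge is the parent of the earlier one. If `q b` is the parent of `q a`,
  -- then `q a` must be `x` itself, as otherwise `q b` would be a descendant too; if `q a` is the
  -- parent of `q b`, then `q b` is a descendant, a contradiction.
  rcases lt_trichotomy a b with hab | rfl | hab
  · have hp := (h.adj _ _ a b hab hb rfl rfl).1 hadj
    generalize hy : q a = y at hd₁
    cases hd₁ with
    | refl => rwa [← hy, hp]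
    | step l' hl' hD =>
      obtain rfl := h.inj a ha l' (by omega) hy
      rw [hp] at hD
      exact absurd hD hd₂
  · exact absurd hadj (G.irrefl)
  · have hp := (h.adj _ _ b a hab ha rfl rfl).1 hadj.symm
    exact absurd (IsDesc.step b (by omega) (hp ▸ hd₁)) hd₂

end IsElimOrder

/-! ## The cost of a set of end vertices -/

section Cost

variable {n k : ℕ}

/-- The number of pebbles that start at a vertex. -/
def startCount (σ : Fin k → Fin n) (v : ℕ) : ℕ := (Finset.univ.filter fun p => (σ p : ℕ) = v).card

theorem numMoved_eq_card (σ μ : Fin k → Fin n) :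
    numMoved σ μ = (Finset.univ.filter fun p => σ p ≠ μ p).card := by
  classical
  rw [numMoved, Set.ncard_eq_toFinset_card']
  congr 1
  ext p
  simp

theorem sum_startCount (σ : Fin k → Fin n) (U : Finset ℕ) :
    ∑ v ∈ U, startCount σ v = (Finset.univ.filter fun p => (σ p : ℕ) ∈ U).card := by
  classical
  rw [Finset.card_eq_sum_card_fiberwise (f := fun p => (σ p : ℕ)) (t := U)
    (fun p hp => by simpa using hp)]
  refine Finset.sum_congr rfl fun v hv => ?_
  rw [startCount, Finset.filter_filter]
  congr 1
  ext p
  simp only [Finset.mem_filter, Finset.mem_univ, true_and]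
  exact ⟨fun h => ⟨h ▸ hv, h⟩, fun h => h.2⟩

theorem sum_emptyInd (σ : Fin k → Fin n) (U : Finset ℕ) :
    ∑ v ∈ U, emptyInd (startCount σ) v = (U.filter fun v => startCount σ v = 0).card := by
  simp only [emptyInd, Finset.card_filter]

theorem startCount_pos (σ : Fin k → Fin n) (p : Fin k) : startCount σ (σ p) ≠ 0 :=
  (Finset.card_pos.2 ⟨p, by simp⟩).ne'

/-- An unmoved pebble starts at its end vertex, which lies in `U`. -/
theorem sub_le_numMoved (σ ν : Fin k → Fin n) {U : Finset ℕ} (hU : ∀ p, (ν p : ℕ) ∈ U) :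
    k - ∑ v ∈ U, startCount σ v ≤ numMoved σ ν := by
  classical
  rw [sum_startCount, numMoved_eq_card]
  have h1 := Finset.card_filter_add_card_filter_not (s := (Finset.univ : Finset (Fin k)))
    (fun p => σ p ≠ ν p)
  have h2 : (Finset.univ.filter fun p => ¬ σ p ≠ ν p).card
      ≤ (Finset.univ.filter fun p => (σ p : ℕ) ∈ U).card := by
    refine Finset.card_le_card fun p hp => ?_
    simp only [Finset.mem_filter, Finset.mem_univ, true_and, not_not] at hp ⊢
    rw [hp]
    exact hU p
  rw [Finset.card_univ, Fintype.card_fin] at h1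
  omega

/-- A pebble that ends at an empty vertex has moved, and different vertices need different pebbles.
-/
theorem sum_emptyInd_le_numMoved (σ ν : Fin k → Fin n) {U : Finset ℕ}
    (hU : ∀ v ∈ U, ∃ p, (ν p : ℕ) = v) :
    ∑ v ∈ U, emptyInd (startCount σ) v ≤ numMoved σ ν := by
  classical
  rw [sum_emptyInd, numMoved_eq_card]
  refine le_trans (Finset.card_le_card (t := (Finset.univ.filter fun p => σ p ≠ ν p).image
    fun p => (ν p : ℕ)) fun v hv => ?_) Finset.card_image_le
  simp only [Finset.mem_filter, Finset.mem_image, Finset.mem_univ, true_and] at hv ⊢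
  obtain ⟨p, hp⟩ := hU v hv.1
  refine ⟨p, fun he => startCount_pos σ p ?_, hp⟩
  rw [he, hp]
  exact hv.2

/-- The minimum over all table entries is a lower bound for the number of moved pebbles. -/
theorem IsElimOrder.le_numMoved {G : SimpleGraph (Fin n)} {q par : ℕ → ℕ} (h : IsElimOrder G q par)
    (hk : 0 < k) (σ : Fin k → Fin n) {m : ℕ}
    (hm : ∀ v < n, ∀ j < k, m ≤ max (k - table n k q par (startCount σ) n v j)
      (j + emptyInd (startCount σ) v))
    (ν : Fin k → Fin n) (hν : IsConnectedGoal G (Set.range ν)) : m ≤ numMoved σ ν := by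
  classical
  set U : Finset ℕ := Finset.univ.image fun p => (ν p : ℕ) with hU
  have hUν : ∀ v, v ∈ U ↔ ∃ p, (ν p : ℕ) = v := fun v => by simp [hU]
  obtain ⟨t, ht⟩ := h.exists_isBelow hν (U := U) fun v => by
    rw [hUν]
    constructor
    · rintro ⟨p, rfl⟩
      exact ⟨(ν p).2, p, rfl⟩
    · rintro ⟨hv, p, hp⟩
      exact ⟨p, by rw [hp]⟩
  have htn : t < n := by
    obtain ⟨p, hp⟩ := (hUν t).1 ht.1
    exact hp ▸ (ν p).2
  have h1 := sub_le_numMoved σ ν (U := U) fun p => (hUν _).2 ⟨p, rfl⟩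
  have h2 := sum_emptyInd_le_numMoved σ ν (U := U) fun v hv => (hUν v).1 hv
  have h3 := Finset.add_sum_erase U (emptyInd (startCount σ)) ht.1
  by_cases hj : ∑ x ∈ U.erase t, emptyInd (startCount σ) x < k
  · have h4 := h.sum_le_table (w := startCount σ) ht le_rfl hj
    have h5 := hm t htn _ hj
    omega
  -- With at least `k` empty vertices besides the top, `ν` moves at least `k` pebbles, whereas the
  -- table entry for `t` and budget 0 costs at most `max k 1 = k`. So budgets below `k` suffice.
  · have h5 := hm t htn 0 hk
    have h6 : emptyInd (startCount σ) t ≤ 1 := by unfold emptyInd; split_ifs <;> omega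
    omega

end Cost

/-! ## Leaf elimination -/

/-- The state of the leaf elimination after `i` vertices have been removed: `R` is the set of
remaining vertices, `q 0, …, q (tail - 1)` are the removed vertices and the current leaves, and
`deg` and `nbr` give the number and the sum of the remaining neighbours. -/
structure IsElimState {n : ℕ} (G : SimpleGraph (Fin n)) [DecidableRel G.Adj] (i tail : ℕ)
    (q par deg nbr : ℕ → ℕ) (R : Finset (Fin n)) : Prop where
  le_tail : i ≤ tail
  inj : ∀ l < tail, ∀ l' < tail, q l = q l' → l = l'
  lt : ∀ l < tail, q l < n
  mem : ∀ v, v ∈ R ↔ ∀ l < i, q l ≠ (v : ℕ)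
  card : R.card + i = n
  conn : (G.induce (R : Set (Fin n))).Preconnected
  deg_eq : ∀ v ∈ R, deg v = (R.filter (G.Adj v)).card
  nbr_eq : ∀ v ∈ R, nbr v = ∑ u ∈ R.filter (G.Adj v), (u : ℕ)
  queue_iff : ∀ v ∈ R, deg v ≤ 1 ↔ ∃ l < tail, q l = (v : ℕ)
  par_spec : ∀ l < i, ∃ u : Fin n, par (q l) = u ∧ (∀ l' ≤ l, q l' ≠ (u : ℕ)) ∧
    ∀ c u' : Fin n, (c : ℕ) = q l → (∀ l' ≤ l, q l' ≠ (u' : ℕ)) → (G.Adj c u' ↔ u' = u)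

namespace IsElimState

variable {n : ℕ} {G : SimpleGraph (Fin n)} [DecidableRel G.Adj] {i tail : ℕ}
  {q par deg nbr : ℕ → ℕ} {R : Finset (Fin n)}

theorem tail_le (h : IsElimState G i tail q par deg nbr R) : tail ≤ n := by
  have := Finset.card_le_card_of_injOn (s := Finset.range tail) (t := Finset.range n) q
    (fun l hl => by simpa using h.lt l (by simpa using hl))
    (fun l hl l' hl' he => h.inj l (by simpa using hl) l' (by simpa using hl') he)
  simpa using this

/-- The remaining vertices induce a tree with at least two vertices. It has a leaf, which is in the
queue and not yet removed, so the queue is not exhausted. The next queue entry has degree at most 1,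
hence exactly 1 by connectedness, and the sum of its remaining neighbours is that neighbour itself.
-/
theorem exists_leaf (h : IsElimState G i tail q par deg nbr R) (hG : G.IsAcyclic)
    (hi : i + 1 < n) : i < tail ∧ ∃ c p : Fin n, q i = c ∧ nbr c = p ∧ c ∈ R ∧ p ∈ R ∧
      R.filter (G.Adj c) = {p} := by
  have hnt : Nontrivial (R : Set (Fin n)) := by
    rw [Set.nontrivial_coe_sort, Finset.nontrivial_coe, ← Finset.one_lt_card_iff_nontrivial]
    have := h.card
    omega
  have htree : (G.induce (R : Set (Fin n))).IsTree := ⟨⟨h.conn⟩, hG.induce _⟩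
  obtain ⟨⟨v, hv⟩, hdv⟩ := htree.exists_vert_degree_one_of_nontrivial
  rw [SimpleGraph.degree_eq_one_iff_existsUnique_adj] at hdv
  obtain ⟨⟨u, hu⟩, huv, huniq⟩ := hdv
  have hfv : R.filter (G.Adj v) = {u} := by
    refine Finset.eq_singleton_iff_unique_mem.2 ⟨Finset.mem_filter.2 ⟨hu, huv⟩, fun x hx => ?_⟩
    rw [Finset.mem_filter] at hx
    exact congrArg Subtype.val (huniq ⟨x, hx.1⟩ hx.2)
  obtain ⟨l, hl, hql⟩ := (h.queue_iff v hv).1 (by rw [h.deg_eq v hv, hfv]; simp)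
  have hil : i ≤ l := by
    by_contra hli
    exact (h.mem v).1 hv l (by omega) hql
  have hit : i < tail := by omega
  have hc : (⟨q i, h.lt i hit⟩ : Fin n) ∈ R := by
    rw [h.mem]
    intro l hl he
    have := h.inj l (by omega) i hit he
    omega
  obtain ⟨⟨p, hp⟩, hadj⟩ := h.conn.exists_adj_of_nontrivial ⟨_, hc⟩
  have hfc : R.filter (G.Adj ⟨q i, h.lt i hit⟩) = {p} := by
    have h1 : (R.filter (G.Adj ⟨q i, h.lt i hit⟩)).card ≤ 1 := by
      rw [← h.deg_eq _ hc]
      exact (h.queue_iff _ hc).2 ⟨i, hit, rfl⟩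
    have hm : p ∈ R.filter (G.Adj ⟨q i, h.lt i hit⟩) := Finset.mem_filter.2 ⟨hp, hadj⟩
    exact Finset.eq_singleton_iff_unique_mem.2 ⟨hm, fun x hx => Finset.card_le_one.1 h1 x hx p hm⟩
  exact ⟨hit, ⟨q i, h.lt i hit⟩, p, rfl, by rw [h.nbr_eq _ hc, hfc]; simp, hc, hp, hfc⟩

theorem preconnected_erase {c p : Fin n} (hR : (G.induce (R : Set (Fin n))).Preconnected)
    (hf : R.filter (G.Adj c) = {p}) :
    (G.induce (R.erase c : Set (Fin n))).Preconnected := by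
  have key := hR.induce_of_degree_eq_one (s := {x | (x : Fin n) ≠ c}) (by
    rintro ⟨v, hv⟩ hvc
    simp only [Set.mem_ofPred_eq, not_not] at hvc
    subst hvc
    rintro ⟨a, ha⟩ haa ⟨b, hb⟩ hbb
    have h1 : a ∈ R.filter (G.Adj v) := Finset.mem_filter.2 ⟨ha, haa⟩
    have h2 : b ∈ R.filter (G.Adj v) := Finset.mem_filter.2 ⟨hb, hbb⟩
    rw [hf, Finset.mem_singleton] at h1 h2
    exact Subtype.ext (h1.trans h2.symm))
  rintro ⟨u, hu⟩ ⟨v, hv⟩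
  have hu' : u ≠ c ∧ u ∈ R := Finset.mem_erase.1 hu
  have hv' : v ≠ c ∧ v ∈ R := Finset.mem_erase.1 hv
  exact (key ⟨⟨u, hu'.2⟩, hu'.1⟩ ⟨⟨v, hv'.2⟩, hv'.1⟩).map
    (⟨fun x => ⟨x.1.1, Finset.mem_erase.2 ⟨x.2, x.1.2⟩⟩, fun {a b} hab => hab⟩ :
      _ →g G.induce (R.erase c : Set (Fin n)))

/-- Removal of the next leaf from the tree. -/
theorem step (h : IsElimState G i tail q par deg nbr R) {c p : Fin n}
    (hit : i < tail) (hqc : q i = c) (hc : c ∈ R) (hp : p ∈ R) (hf : R.filter (G.Adj c) = {p})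
    {tail' : ℕ} {q' par' deg' nbr' : ℕ → ℕ} (hpar : ∀ v, par' v = if v = c then (p : ℕ) else par v)
    (hdeg : ∀ v, deg' v = if v = p then deg p - 1 else deg v)
    (hnbr : ∀ v, nbr' v = if v = p then nbr p - c else nbr v)
    (hqueue : (deg p - 1 = 1 ∧ tail' = tail + 1 ∧ ∀ l, q' l = if l = tail then (p : ℕ) else q l) ∨
      (deg p - 1 ≠ 1 ∧ tail' = tail ∧ q' = q)) :
    IsElimState G (i + 1) tail' q' par' deg' nbr' (R.erase c) := by
  have hq' : ∀ l < tail, q' l = q l := by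
    intro l hl
    rcases hqueue with ⟨_, _, h⟩ | ⟨_, _, h⟩
    · rw [h, if_neg (by omega)]
    · rw [h]
  have htt : tail ≤ tail' := by rcases hqueue with ⟨_, h, _⟩ | ⟨_, h, _⟩ <;> omega
  have hpf : p ∈ R.filter (G.Adj c) := by rw [hf]; simp
  have hcp : G.Adj c p := (Finset.mem_filter.1 hpf).2
  have hpc : p ≠ c := hcp.ne'
  have hcf : c ∈ R.filter (G.Adj p) := Finset.mem_filter.2 ⟨hc, hcp.symm⟩
  have honly : ∀ v ∈ R, G.Adj v c → v = p := fun v hv hvc => by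
    have : v ∈ R.filter (G.Adj c) := Finset.mem_filter.2 ⟨hv, hvc.symm⟩
    rw [hf] at this
    simpa using this
  have herase : ∀ v, (R.erase c).filter (G.Adj v) = (R.filter (G.Adj v)).erase c := fun v =>
    Finset.filter_erase _ _ _
  have hno : ∀ v ∈ R, v ≠ p → (R.filter (G.Adj v)).erase c = R.filter (G.Adj v) := fun v hv hvp =>
    Finset.erase_eq_of_notMem fun hm => hvp (honly v hv (Finset.mem_filter.1 hm).2)
  have hmem : ∀ v, v ∈ R.erase c ↔ ∀ l < i + 1, q' l ≠ (v : ℕ) := by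
    intro v
    rw [Finset.mem_erase, h.mem]
    constructor
    · rintro ⟨hvc, hv⟩ l hl
      rw [hq' l (by omega)]
      rcases Nat.lt_succ_iff_lt_or_eq.1 hl with hl | rfl
      · exact hv l hl
      · rw [hqc]
        exact fun he => hvc (Fin.ext he.symm)
    · intro hv
      refine ⟨?_, fun l hl => ?_⟩
      · rintro rfl
        exact hv i (by omega) (by rw [hq' i hit, hqc])
      · have := hv l (by omega)
        rwa [hq' l (by omega)] at this
  have hdeg' : ∀ v ∈ R.erase c, deg' v = ((R.erase c).filter (G.Adj v)).card := by
    intro v hv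
    have hvR := Finset.mem_of_mem_erase hv
    rw [hdeg, herase]
    split_ifs with hvp
    · obtain rfl := Fin.ext hvp
      rw [h.deg_eq v hvR, Finset.card_erase_of_mem hcf]
    · rw [hno v hvR (fun he => hvp (by rw [he])), h.deg_eq v hvR]
  -- The vertex `p` is pushed only when its degree drops from 2 to 1. With degree 2 it was not in
  -- the queue before, so no vertex is pushed twice. A drop from 1 to 0 concerns a vertex that is
  -- already in the queue.
  have hlt_tail : ∀ v ∈ R, deg p - 1 = 1 → (∃ l < tail, q l = (v : ℕ)) → v ≠ p := by
    rintro v hv hd hl rfl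
    have := (h.queue_iff v hv).2 hl
    omega
  refine ⟨by omega, ?_, ?_, hmem, ?_, preconnected_erase h.conn hf, hdeg', ?_, ?_, ?_⟩
  · rcases hqueue with ⟨hd, rfl, hq⟩ | ⟨_, rfl, rfl⟩
    · intro l hl l' hl' he
      rw [hq, hq] at he
      split_ifs at he with h1 h2 h2
      · omega
      · exact absurd rfl (hlt_tail p hp hd ⟨l', by omega, he.symm⟩)
      · exact absurd rfl (hlt_tail p hp hd ⟨l, by omega, he⟩)
      · exact h.inj l (by omega) l' (by omega) he
    · exact h.inj
  · rcases hqueue with ⟨hd, rfl, hq⟩ | ⟨_, rfl, rfl⟩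
    · intro l hl
      rw [hq]
      split_ifs
      · exact p.2
      · exact h.lt l (by omega)
    · exact h.lt
  · have := h.card
    have := Finset.card_erase_add_one hc
    omega
  · intro v hv
    have hvR := Finset.mem_of_mem_erase hv
    rw [hnbr, herase]
    split_ifs with hvp
    · obtain rfl := Fin.ext hvp
      rw [h.nbr_eq v hvR, ← Finset.add_sum_erase _ (fun u : Fin n => (u : ℕ)) hcf]
      simp
    · rw [hno v hvR (fun he => hvp (by rw [he])), h.nbr_eq v hvR]
  · intro v hv
    have hvR := Finset.mem_of_mem_erase hv
    rw [hdeg]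
    split_ifs with hvp
    · obtain rfl := Fin.ext hvp
      rcases hqueue with ⟨hd, rfl, hq⟩ | ⟨hd, rfl, rfl⟩
      · exact ⟨fun _ => ⟨tail, by omega, by rw [hq, if_pos rfl]⟩, fun _ => by omega⟩
      · rw [← h.queue_iff v hvR]
        have : 0 < deg v := by rw [h.deg_eq v hvR]; exact Finset.card_pos.2 ⟨c, hcf⟩
        omega
    · rw [h.queue_iff v hvR]
      rcases hqueue with ⟨hd, rfl, hq⟩ | ⟨hd, rfl, rfl⟩
      · constructor
        · rintro ⟨l, hl, he⟩
          exact ⟨l, by omega, by rw [hq' l hl, he]⟩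
        · rintro ⟨l, hl, he⟩
          rw [hq] at he
          split_ifs at he with h1
          · exact absurd he.symm hvp
          · exact ⟨l, by omega, he⟩
      · exact Iff.rfl
  · intro l hl
    have hql : ∀ l' ≤ l, q' l' = q l' := fun l' hl' => hq' l' (by omega)
    rw [hql l le_rfl, hpar]
    rcases Nat.lt_succ_iff_lt_or_eq.1 hl with hl | rfl
    · obtain ⟨u, hu, hu', hadj⟩ := h.par_spec l hl
      rw [if_neg ((h.mem c).1 hc l hl)]
      refine ⟨u, hu, fun l' hl' => by rw [hql l' hl']; exact hu' l' hl', fun d u' hd hu'' => ?_⟩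
      exact hadj d u' hd fun l' hl' => by rw [← hql l' hl']; exact hu'' l' hl'
    · rw [if_pos hqc]
      have hpR : p ∈ R.erase c := Finset.mem_erase.2 ⟨hpc, hp⟩
      refine ⟨p, rfl, fun l' hl' => (hmem p).1 hpR l' (by omega), fun d u' hd hu' => ?_⟩
      obtain rfl : d = c := Fin.ext (by rw [hd, hqc])
      have hu'R : u' ∈ R.erase d := (hmem u').2 fun l' hl' => hu' l' (by omega)
      refine ⟨fun hadj => honly u' (Finset.mem_of_mem_erase hu'R) hadj.symm, ?_⟩
      rintro rfl
      exact hcp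

/-- When one vertex is left, the queue is a leaf elimination order. -/
theorem isElimOrder (h : IsElimState G i tail q par deg nbr R) (hi : i + 1 = n) :
    IsElimOrder G q par := by
  have h1 : R.card = 1 := by have := h.card; omega
  obtain ⟨r, rfl⟩ := Finset.card_eq_one.1 h1
  have hr : r ∈ ({r} : Finset (Fin n)) := by simp
  have hdr : deg r ≤ 1 := by
    rw [h.deg_eq r hr]
    exact (Finset.card_le_card (Finset.filter_subset _ _)).trans h1.le
  obtain ⟨l, hl, hql⟩ := (h.queue_iff r hr).1 hdr
  have hil : i ≤ l := by
    by_contra hli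
    exact (h.mem r).1 hr l (by omega) hql
  -- The last vertex has degree 0, so it is in the queue, at a position at least `i = n - 1`; the
  -- queue therefore lists all vertices.
  have htail : tail = n := by have := h.tail_le; omega
  subst htail
  have hsurj : ∀ v < tail, ∃ j < tail, q j = v := by
    intro v hv
    have : Set.SurjOn q (Finset.range tail) (Finset.range tail) :=
      Finset.surjOn_of_injOn_of_card_le q (fun i hi => by simpa using h.lt i (by simpa using hi))
        (fun i hi j hj hij => h.inj i (by simpa using hi) j (by simpa using hj) hij) le_rfl
    obtain ⟨j, hj, rfl⟩ := this (show v ∈ (Finset.range tail : Set ℕ) by simpa using hv)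
    exact ⟨j, by simpa using hj, rfl⟩
  refine ⟨⟨h.inj, h.lt, fun l hl => ?_⟩, fun u v l j hlj hj hu hv => ?_⟩
  · obtain ⟨u, hu, hu', -⟩ := h.par_spec l (by omega)
    obtain ⟨j, hj, he⟩ := hsurj u u.2
    refine ⟨j, ?_, hj, by rw [hu, he]⟩
    by_contra hjl
    exact hu' j (by omega) he
  · obtain ⟨u₀, hu₀, -, hadj⟩ := h.par_spec l (by omega)
    rw [hadj u v hu fun l' hl' he => ?_, hu₀, ← hv, Fin.ext_iff, eq_comm]
    have := h.inj l' (by omega) j hj (by rw [he, hv])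
    omega

end IsElimState

/-! ## The program -/

namespace WordRAM

/-- The entry of a one-dimensional array. -/
abbrev Expr.entry (r : Arr) (x : Var) : Expr := .get r (.reg x) (.const 0)

/-- Assignment to the entry of a one-dimensional array. -/
abbrev Cmd.putEntry (r : Arr) (x : Var) (e : Expr) : Cmd := .put r (.reg x) (.const 0) e

namespace Cmd

/-- Computes the degrees and the sums of the neighbours. -/
def readEdges : Cmd :=
  .upto .i .pred <| block [
    .getRaw .u (.add (.const 2) (.mul (.const 2) (.reg .i))),
    .getRaw .v (.add (.const 3) (.mul (.const 2) (.reg .i))),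
    putEntry .deg .u (.add (.entry .deg .u) (.const 1)),
    putEntry .nbr .u (.add (.entry .nbr .u) (.reg .v)),
    putEntry .deg .v (.add (.entry .deg .v) (.const 1)),
    putEntry .nbr .v (.add (.entry .nbr .v) (.reg .u))]

/-- Computes the numbers of pebbles at the vertices, and one pebble at each occupied vertex. -/
def readPebbles : Cmd :=
  .upto .i .k <| block [
    .getRaw .v (.add (.add .n .n) (.reg .i)),
    putEntry .cnt .v (.add (.entry .cnt .v) (.const 1)),
    putEntry .rep .v (.reg .i),
    putEntry .start .i (.reg .v)]

/-- Puts the leaves into the queue. -/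
def pushLeaves : Cmd :=
  block [
    .set .tail (.const 0),
    .upto .i .n <| .ite (.lt (.entry .deg .i) (.const 2))
      (block [putEntry .queue .tail (.reg .i), .set .tail (.add (.reg .tail) (.const 1))]) .skip]

/-- Removes leaves until one vertex is left. -/
def eliminate : Cmd :=
  .upto .i .pred <| block [
    .set .c (.entry .queue .i),
    .set .p (.entry .nbr .c),
    putEntry .par .c (.reg .p),
    putEntry .deg .p (.sub (.entry .deg .p) (.const 1)),
    putEntry .nbr .p (.sub (.entry .nbr .p) (.reg .c)),
    .ite (.eq (.entry .deg .p) (.const 1))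
      (block [putEntry .queue .tail (.reg .p), .set .tail (.add (.reg .tail) (.const 1))]) .skip]

/-- Initializes the table of the tree knapsack. -/
def initTable : Cmd :=
  .upto .i .n <| .upto .j .k <| .put .tab (.reg .i) (.reg .j) (.entry .cnt .i)

/-- Computes one entry of the table after the child `c` has been merged into `p`. -/
def mergeEntry : Cmd :=
  .upto .a .k <| .ite (.lt (.add (.reg .a) (.reg .e)) (.add (.reg .b) (.const 1)))
    (block [
      .set .tmp (.add (.get .tab (.reg .p) (.sub (.reg .b) (.add (.reg .a) (.reg .e))))
        (.get .tab (.reg .c) (.reg .a))),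
      .ite (.lt (.reg .best) (.reg .tmp))
        (block [.set .best (.reg .tmp), .set .sel (.add (.reg .a) (.const 1))]) .skip]) .skip

/-- Computes the row of `p` after the child `c` has been merged into `p`. -/
def mergeRow : Cmd :=
  .upto .j .k <| block [
    .set .b (.sub (.sub .k (.const 1)) (.reg .j)),
    .set .best (.get .tab (.reg .p) (.reg .b)),
    .set .sel (.const 0),
    mergeEntry,
    .put .tab (.reg .p) (.reg .b) (.reg .best),
    .put .ch (.reg .c) (.reg .b) (.reg .sel)]

/-- Merges all vertices but the last into their parents. -/
def mergeAll : Cmd :=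
  .upto .i .pred <| block [
    .set .c (.entry .queue .i),
    .set .p (.entry .par .c),
    .set .e (.eq (.entry .cnt .c) (.const 0)),
    mergeRow]

/-- Computes in `x` the cost of the table entry `v j`. -/
def entryCost (v j : Expr) : Cmd :=
  block [
    .set .tmp (.sub .k (.get .tab v j)),
    .set .u (.add j (.eq (.get .cnt v (.const 0)) (.const 0))),
    .ite (.lt (.reg .tmp) (.reg .u)) (.set .tmp (.reg .u)) .skip]

/-- Finds a table entry of minimum cost. -/
def findBest : Cmd :=
  block [
    .set .bv (.const 0),
    .set .bj (.const 0),
    entryCost (.const 0) (.const 0),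
    .set .best (.reg .tmp),
    .upto .i .n <| .upto .j .k <| block [
      entryCost (.reg .i) (.reg .j),
      .ite (.lt (.reg .tmp) (.reg .best))
        (block [.set .best (.reg .tmp), .set .bv (.reg .i), .set .bj (.reg .j)]) .skip]]

/-- Marks the vertices of a set that realizes the best table entry. -/
def reconstruct : Cmd :=
  .upto .i .n <| block [
    .set .a (.sub (.sub .n (.const 1)) (.reg .i)),
    .set .c (.entry .queue .a),
    .ite (.eq (.reg .c) (.reg .bv))
      (block [putEntry .mark .c (.const 1), putEntry .bud .c (.reg .bj)])
      (block [
        .set .p (.entry .par .c),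
        .ite (.entry .mark .p)
          (block [
            .set .b (.entry .bud .p),
            .set .sel (.get .ch (.reg .c) (.reg .b)),
            .ite (.reg .sel)
              (block [
                putEntry .mark .c (.const 1),
                .set .sel (.sub (.reg .sel) (.const 1)),
                putEntry .bud .c (.reg .sel),
                .set .e (.eq (.entry .cnt .c) (.const 0)),
                putEntry .bud .p (.sub (.reg .b) (.add (.reg .sel) (.reg .e)))]) .skip]) .skip])]

/-- Keeps at most `k` of the marked vertices and lists the empty ones among them. -/
def trim : Cmd :=
  block [
    .set .size (.const 0),
    .set .ne (.const 0),
    .upto .i .n <| block [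
      .set .a (.sub (.sub .n (.const 1)) (.reg .i)),
      .set .c (.entry .queue .a),
      .ite (.mul (.entry .mark .c) (.lt (.reg .size) .k))
        (block [
          putEntry .keep .c (.const 1),
          .set .size (.add (.reg .size) (.const 1)),
          .ite (.eq (.entry .cnt .c) (.const 0))
            (block [putEntry .emp .ne (.reg .c), .set .ne (.add (.reg .ne) (.const 1))]) .skip])
        .skip]]

/-- Sends the pebble `i` to the next empty vertex, or to the vertex `u` if there is none left. -/
def sendPebble : Cmd :=
  .ite (.lt (.reg .nf) (.reg .ne))
    (block [.putRaw (.reg .i) (.entry .emp .nf), .set .nf (.add (.reg .nf) (.const 1))])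
    (.putRaw (.reg .i) (.reg .u))

/-- Sends the pebbles that start outside of the kept set. -/
def sendOutside : Cmd :=
  block [
    .set .nf (.const 0),
    .upto .i .k <| block [
      .set .v (.entry .start .i),
      .ite (.entry .keep .v) .skip (block [.set .u (.reg .bv), sendPebble])]]

/-- Sends the pebbles that start in the kept set. -/
def sendInside : Cmd :=
  .upto .i .k <| block [
    .set .v (.entry .start .i),
    .ite (.entry .keep .v)
      (.ite (.eq (.entry .rep .v) (.reg .i)) (.putRaw (.reg .i) (.reg .v))
        (block [.set .u (.reg .v), sendPebble])) .skip]

/-- The program for the connected goal on trees. -/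
def solve : Cmd :=
  block [readEdges, readPebbles, pushLeaves, eliminate, initTable, mergeAll, findBest, reconstruct,
    trim, sendOutside, sendInside]

theorem degN_solve : solve.degN = 1 := rfl

/-- The deepest nesting of loops over pebbles is in the merge: all splittings of all budgets. -/
theorem degK_solve : solve.degK = 2 := rfl

end Cmd

end WordRAM

/-! ## Reading the instance and eliminating leaves -/

namespace WordRAM

section

variable {n k : ℕ} {G : SimpleGraph (Fin n)} {h : Store}

/-- Summation over the edges at a vertex. -/
theorem sum_incident [DecidableRel G.Adj] {L : List (Fin n × Fin n)} (hL : IsEdgeList G L)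
    (F : Fin n → ℕ) (v : Fin n) :
    (L.map fun e => (if e.1 = v then F e.2 else 0) + (if e.2 = v then F e.1 else 0)).sum
      = ∑ u ∈ Finset.univ.filter (G.Adj v), F u := by
  classical
  -- The contribution of an edge to `v` is symmetric in its ends, so the list sum becomes a sum over
  -- unordered edges, of which only those at `v` count.
  let g : Sym2 (Fin n) → ℕ := Sym2.lift ⟨fun a b => (if a = v then F b else 0) +
    (if b = v then F a else 0), fun a b => add_comm _ _⟩
  have h1 : (L.map fun e => (if e.1 = v then F e.2 else 0) + (if e.2 = v then F e.1 else 0))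
      = (L.map fun e => s(e.1, e.2)).map g := by
    rw [List.map_map]
    rfl
  rw [h1, ← List.sum_toFinset g hL.1]
  have hsub : (Finset.univ.filter (G.Adj v)).image (fun u => s(v, u))
      ⊆ (L.map fun e => s(e.1, e.2)).toFinset := by
    intro e he
    simp only [Finset.mem_image, Finset.mem_filter, Finset.mem_univ, true_and] at he
    obtain ⟨u, hu, rfl⟩ := he
    rw [List.mem_toFinset, hL.2]
    exact hu
  rw [← Finset.sum_subset hsub, Finset.sum_image]
  · refine Finset.sum_congr rfl fun u hu => ?_
    have : u ≠ v := (Finset.mem_filter.1 hu).2.ne'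
    simp [this]
  · intro a _ b _ hab
    simp only [Sym2.eq_iff, true_and] at hab
    rcases hab with rfl | ⟨rfl, rfl⟩ <;> rfl
  · intro e he hne
    rw [List.mem_toFinset, hL.2] at he
    induction e with
    | h a b =>
      simp only [Finset.mem_image, Finset.mem_filter, Finset.mem_univ, true_and] at hne
      have ha : a ≠ v := by
        rintro rfl
        exact hne ⟨b, he, rfl⟩
      have hb : b ≠ v := by
        rintro rfl
        exact hne ⟨a, G.adj_symm he, Sym2.eq_swap⟩
      simp [ha, hb]

/-- No adjacency lists are stored: the degree and the sum of the neighbours are enough to recognize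
a leaf and its neighbour during the elimination. -/
theorem sat_readEdges [DecidableRel G.Adj] {L : List (Fin n × Fin n)} (hL : IsEdgeList G L)
    (hlen : L.length = n - 1)
    (hraw : ∀ i (hi : i < L.length), h.raw (2 + 2 * i) = L[i].1 ∧ h.raw (3 + 2 * i) = L[i].2)
    (hdeg : ∀ v, h.arr .deg v 0 = 0) (hnbr : ∀ v, h.arr .nbr v 0 = 0) :
    Sat n k .readEdges h fun h' => ∀ v : Fin n,
      h'.arr .deg v 0 = (Finset.univ.filter (G.Adj v)).card ∧
      h'.arr .nbr v 0 = ∑ u ∈ Finset.univ.filter (G.Adj v), (u : ℕ) := by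
  -- Guards against overflow: fewer than `n` edges, each contributing at most `2 * B`.
  have hbound : ∀ (F : Fin n → ℕ) (v : Fin n) (B i : ℕ), (∀ u, F u ≤ B) → i < n - 1 →
      ((L.take i).map fun e => (if e.1 = v then F e.2 else 0) +
        (if e.2 = v then F e.1 else 0)).sum ≤ n * (2 * B) := by
    intro F v B i hF hi
    refine (List.sum_le_card_nsmul _ (2 * B) ?_).trans ?_
    · intro x hx
      simp only [List.mem_map] at hx
      obtain ⟨e, -, rfl⟩ := hx
      have := hF e.1
      have := hF e.2
      split_ifs <;> omega
    · rw [smul_eq_mul]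
      refine Nat.mul_le_mul_right _ ?_
      simp only [List.length_map, List.length_take]
      omega
  have hM : n * (2 * 1) + 2 ≤ (n + k + 2) ^ 3 ∧ n * (2 * n) + 2 * n ≤ (n + k + 2) ^ 3 := by
    have : (n + k + 2) ^ 3 = (n + k + 2) * ((n + k + 2) * (n + k + 2)) := by ring
    constructor <;> nlinarith [Nat.zero_le (n * k)]
  refine Sat.upto_rule (fun i h' => ∀ v : Fin n,
    h'.arr .deg v 0 = ((L.take i).map fun e => (if e.1 = v then 1 else 0) +
      (if e.2 = v then 1 else 0)).sum ∧
    h'.arr .nbr v 0 = ((L.take i).map fun e => (if e.1 = v then (e.2 : ℕ) else 0) +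
      (if e.2 = v then (e.1 : ℕ) else 0)).sum) rfl (fun v => ?_) (fun i hi h' hb hf hi' hI => ?_)
      fun h' _ hI v => ?_
  · simp [Store.setReg, hdeg, hnbr]
  · simp only [Bound.val] at hi
    have hr := hraw i (by omega)
    have hfr : h'.raw = h.raw := hf.raw rfl
    have hd := hI L[i].1
    have hd' := hI L[i].2
    have b1 := hbound (fun _ => 1) L[i].1 1 i (fun _ => le_rfl) hi
    have b2 := hbound (fun _ => 1) L[i].2 1 i (fun _ => le_rfl) hi
    have b3 := hbound (fun u => u) L[i].1 n i (fun u => u.2.le) hi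
    have b4 := hbound (fun u => u) L[i].2 n i (fun u => u.2.le) hi
    have l1 := L[i].1.2
    have l2 := L[i].2.2
    refine wp_sound ?_
    have htake : L.take (i + 1) = L.take i ++ [L[i]] := (List.take_append_getElem (by omega)).symm
    simp only [Cmd.block, wp, Expr.val, Store.setReg, Store.setArr, hi', hfr, hr, htake,
      List.map_append, List.sum_append, List.map_cons, List.map_nil, List.sum_singleton]
    simp [-List.map_take, -List.sum_map_add, hr]
    refine ⟨by omega, by omega, by omega, by omega, by split_ifs <;> omega,
      by split_ifs <;> omega, fun v => ?_⟩
    rw [← (hI v).1, ← (hI v).2]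
    simp only [Fin.val_inj, eq_comm (b := v)]
    constructor <;> split_ifs <;> (simp_all; try omega)
  · simp only [Bound.val, ← hlen, List.take_length] at hI
    rw [(hI v).1, (hI v).2, sum_incident hL (fun _ => 1), sum_incident hL (fun u => (u : ℕ)),
      Finset.card_eq_sum_ones]
    exact ⟨rfl, rfl⟩

theorem card_filter_lt_succ {i : ℕ} (hi : i < k) (P : Fin k → Prop) [DecidablePred P] :
    (Finset.univ.filter fun p : Fin k => (p : ℕ) < i + 1 ∧ P p).card
      = (Finset.univ.filter fun p : Fin k => (p : ℕ) < i ∧ P p).card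
        + if P ⟨i, hi⟩ then 1 else 0 := by
  have hsplit : (Finset.univ.filter fun p : Fin k => (p : ℕ) < i + 1 ∧ P p)
      = (Finset.univ.filter fun p : Fin k => (p : ℕ) < i ∧ P p)
        ∪ (({⟨i, hi⟩} : Finset (Fin k)).filter P) := by
    ext p
    simp only [Finset.mem_filter, Finset.mem_univ, true_and, Finset.mem_union,
      Finset.mem_singleton, Fin.ext_iff, ← or_and_right, Nat.lt_succ_iff_lt_or_eq]
  rw [hsplit, Finset.card_union_of_disjoint, Finset.filter_singleton]
  · split_ifs <;> simp
  · rw [Finset.disjoint_left]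
    intro p hp hp'
    simp only [Finset.mem_filter, Finset.mem_univ, true_and, Finset.mem_singleton,
      Fin.ext_iff] at hp hp'
    omega

/-- The representative of a vertex is the last pebble read there. Start vertices are copied to an
array because the output later overwrites the input cells. -/
theorem sat_readPebbles {σ : Fin k → Fin n} (hraw : ∀ p : Fin k, h.raw (n + n + p) = σ p)
    (hcnt : ∀ v, h.arr .cnt v 0 = 0) :
    Sat n k .readPebbles h fun h' => (∀ v, h'.arr .cnt v 0 = startCount σ v) ∧
      (∀ p : Fin k, h'.arr .start p 0 = σ p) ∧
      ∀ p : Fin k, ∃ p' : Fin k, h'.arr .rep (σ p) 0 = p' ∧ σ p' = σ p := by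
  refine Sat.upto_rule (fun i h' => (∀ v, h'.arr .cnt v 0
      = (Finset.univ.filter fun p : Fin k => (p : ℕ) < i ∧ (σ p : ℕ) = v).card) ∧
    (∀ p : Fin k, (p : ℕ) < i → h'.arr .start p 0 = σ p) ∧
    ∀ p : Fin k, (p : ℕ) < i → ∃ p' : Fin k, h'.arr .rep (σ p) 0 = p' ∧ σ p' = σ p) rfl ?_
      (fun i hi h' hb hf hi' hI => ?_) fun h' _ hI => ?_
  · simp [Store.setReg, hcnt]
  · simp only [Bound.val] at hi
    have hr := hraw ⟨i, hi⟩
    have hfr : h'.raw = h.raw := hf.raw rfl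
    have hM : n + k + 2 ≤ (n + k + 2) ^ 3 := Nat.le_self_pow (by omega) _
    have hc := hI.1 (σ ⟨i, hi⟩)
    have hle : (Finset.univ.filter fun p : Fin k =>
        (p : ℕ) < i ∧ (σ p : ℕ) = σ ⟨i, hi⟩).card ≤ k := by
      simpa using Finset.card_filter_le (Finset.univ : Finset (Fin k)) _
    have l1 := (σ ⟨i, hi⟩).2
    obtain ⟨hI1, hI2, hI3⟩ := hI
    refine wp_sound ?_
    simp only [] at hr
    simp [Cmd.block, wp, Expr.val, Store.setReg, Store.setArr, hi', hfr, hr,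
      card_filter_lt_succ hi, -Order.lt_add_one_iff]
    refine ⟨by omega, by omega, by omega, by omega, fun v => ?_, fun p hp => ?_, fun p hp => ?_⟩
    · rw [hI1]
      split_ifs with h1 h2 h2
      · rw [h1]
      · exact absurd h1.symm h2
      · exact absurd h2.symm h1
      · exact hI1 v
    · split_ifs with hpi
      · rw [← hr, ← hpi, hraw]
      · exact hI2 p (by omega)
    · split_ifs with hpi
      · exact ⟨⟨i, hi⟩, rfl, Fin.ext hpi.symm⟩
      · refine hI3 p (lt_of_le_of_ne (by omega) ?_)
        rintro rfl
        exact hpi rfl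
  · obtain ⟨hI1, hI2, hI3⟩ := hI
    simp only [Bound.val, Fin.is_lt, true_and, forall_const] at hI1 hI2 hI3
    exact ⟨hI1, hI2, hI3⟩

/-- The threshold is degree at most 1 rather than exactly 1, so that the vertex of a one-vertex tree
enters the queue as well. -/
theorem sat_pushLeaves [DecidableRel G.Adj] (hG : G.Preconnected)
    (hdeg : ∀ v : Fin n, h.arr .deg v 0 = (Finset.univ.filter (G.Adj v)).card)
    (hnbr : ∀ v : Fin n, h.arr .nbr v 0 = ∑ u ∈ Finset.univ.filter (G.Adj v), (u : ℕ)) :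
    Sat n k .pushLeaves h fun h' =>
      IsElimState G 0 (h'.reg .tail) (fun l => h'.arr .queue l 0) (fun v => h'.arr .par v 0)
        (fun v => h'.arr .deg v 0) (fun v => h'.arr .nbr v 0) Finset.univ := by
  refine wp_sound ?_
  refine ⟨Nat.zero_le _, ?_⟩
  refine Sat.upto_rule (fun i h' => h'.reg .tail ≤ i ∧
    (∀ l < h'.reg .tail, h'.arr .queue l 0 < i ∧ h.arr .deg (h'.arr .queue l 0) 0 ≤ 1) ∧
    (∀ l < h'.reg .tail, ∀ l' < h'.reg .tail,
      h'.arr .queue l 0 = h'.arr .queue l' 0 → l = l') ∧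
    ∀ v < i, h.arr .deg v 0 ≤ 1 → ∃ l < h'.reg .tail, h'.arr .queue l 0 = v) rfl ?_
      (fun i hi h' hb hf hi' hI => ?_) fun h' hf hI => ?_
  · simp [Store.setReg, Expr.val]
  · simp only [Bound.val] at hi
    have hfd : h'.arr .deg = h.arr .deg := hf.arr _ rfl
    have hM : n + k + 2 ≤ (n + k + 2) ^ 3 := Nat.le_self_pow (by omega) _
    obtain ⟨hI1, hI2, hI3, hI4⟩ := hI
    refine wp_sound ?_
    simp [Cmd.block, wp, Expr.val, Store.setReg, Store.setArr, hi', hfd]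
    refine ⟨fun hd => ⟨by omega, by omega, by omega, fun l hl => ?_, fun l hl l' hl' => ?_,
      fun v hv hvd => ?_⟩, fun hd => ⟨by omega, fun l hl => ?_, hI3, fun v hv hvd => ?_⟩⟩
    · split_ifs with h1
      · omega
      · have := hI2 l (by omega)
        omega
    · split_ifs with h1 h2 h2
      · omega
      · have := hI2 l' (by omega)
        omega
      · have := hI2 l (by omega)
        omega
      · exact hI3 l (by omega) l' (by omega)
    · by_cases hvi : v = i
      · exact ⟨_, le_rfl, by rw [if_pos rfl, hvi]⟩
      · obtain ⟨l, hl, he⟩ := hI4 v (by omega) hvd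
        exact ⟨l, by omega, by rw [if_neg (by omega), he]⟩
    · have := hI2 l hl
      omega
    · refine hI4 v (lt_of_le_of_ne (by omega) ?_) hvd
      rintro rfl
      omega
  · have hfd : h'.arr .deg = h.arr .deg := hf.arr _ rfl
    have hfn : h'.arr .nbr = h.arr .nbr := hf.arr _ rfl
    obtain ⟨hI1, hI2, hI3, hI4⟩ := hI
    simp only [Bound.val] at hI1 hI2 hI4
    refine ⟨Nat.zero_le _, hI3, fun l hl => (hI2 l hl).1, by simp, by simp, ?_, fun v _ => ?_,
      fun v _ => ?_, fun v _ => ⟨fun hd => hI4 v v.2 (hfd ▸ hd), ?_⟩, by simp⟩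
    · rintro ⟨u, hu⟩ ⟨v, hv⟩
      exact (hG u v).map (⟨fun x => ⟨x, by simp⟩, fun {a b} hab => hab⟩ :
        G →g G.induce ((Finset.univ : Finset (Fin n)) : Set (Fin n)))
    · rw [hfd, hdeg]
    · rw [hfn, hnbr]
    · rintro ⟨l, hl, he⟩
      rw [hfd, ← he]
      exact (hI2 l hl).2

theorem sat_eliminate [DecidableRel G.Adj] (hG : G.IsAcyclic) (hn : 0 < n)
    (hs : IsElimState G 0 (h.reg .tail) (fun l => h.arr .queue l 0) (fun v => h.arr .par v 0)
      (fun v => h.arr .deg v 0) (fun v => h.arr .nbr v 0) Finset.univ) :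
    Sat n k .eliminate h fun h' =>
      IsElimOrder G (fun l => h'.arr .queue l 0) (fun v => h'.arr .par v 0) := by
  refine Sat.upto_rule (fun i h' => ∃ R, IsElimState G i (h'.reg .tail)
    (fun l => h'.arr .queue l 0) (fun v => h'.arr .par v 0)
    (fun v => h'.arr .deg v 0) (fun v => h'.arr .nbr v 0) R) rfl ⟨_, hs⟩ ?_ ?_
  · rintro i hi h' hb - hi' ⟨R, hR⟩
    simp only [Bound.val] at hi
    obtain ⟨hit, c, p, hc, hp, hcR, hpR, hf⟩ := hR.exists_leaf hG (by omega)
    have htail := hR.tail_le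
    refine wp_sound ?_
    simp [Cmd.block, wp, Expr.val, Store.setReg, Store.setArr, hi', hc, hp]
    have hM : n + k + 2 ≤ (n + k + 2) ^ 3 := Nat.le_self_pow (by omega) _
    have b1 := hb.arr .deg p 0
    have b2 := hb.arr .nbr p 0
    refine ⟨by omega, by omega, by omega, by omega,
      fun hd => ⟨by omega, by omega, R.erase c, ?_⟩, fun hd => ⟨R.erase c, ?_⟩⟩
    · exact hR.step hit hc hcR hpR hf (fun _ => rfl) (fun _ => rfl) (fun _ => rfl)
        (.inl ⟨by omega, rfl, fun _ => rfl⟩)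
    · exact hR.step hit hc hcR hpR hf (fun _ => rfl) (fun _ => rfl) (fun _ => rfl)
        (.inr ⟨by omega, rfl, rfl⟩)
  · rintro h' - ⟨R, hR⟩
    exact hR.isElimOrder (by simp only [Bound.val]; omega)

end

end WordRAM

/-! ## Filling the table -/

/-- Merging does not produce numbers larger than the total weight. -/
theorem IsParentOrder.table_add_le {n k : ℕ} {q par w : ℕ → ℕ} (h : IsParentOrder n q par) {i : ℕ}
    (hi : i + 1 < n) (a b : ℕ) :
    table n k q par w i (par (q i)) b + table n k q par w i (q i) a
      ≤ ∑ l ∈ Finset.range n, w (q l) := by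
  -- Here `s v` bounds the whole row of `v`. A merge adds the bound of the child to that of its
  -- parent while the child leaves the sum, so the sum over the vertices not yet merged never
  -- exceeds the total weight.
  have key : ∀ i ≤ n, ∃ s : ℕ → ℕ, (∀ v b, table n k q par w i v b ≤ s v) ∧
      ∑ l ∈ Finset.Ico i n, s (q l) ≤ ∑ l ∈ Finset.range n, w (q l) := by
    intro i
    induction i with
    | zero => exact fun _ => ⟨w, fun v b => le_rfl, by rw [Finset.range_eq_Ico]⟩
    | succ i ih =>
      intro hi
      obtain ⟨s, hs, hsum⟩ := ih (by omega)
      rw [Finset.sum_eq_sum_Ico_succ_bot (by omega)] at hsum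
      rw [table]
      split_ifs with hin
      swap
      · exact ⟨s, hs, by omega⟩
      obtain ⟨j, hij, hj, hp⟩ := h.exists_par i hin
      refine ⟨fun v => if v = par (q i) then s v + s (q i) else s v, fun v b => ?_, ?_⟩
      · simp only [mergeStep]
        split_ifs with hv
        · subst hv
          refine max_le ((hs _ b).trans (Nat.le_add_right _ _)) (Finset.sup_le fun a _ => ?_)
          split_ifs
          · exact Nat.add_le_add (hs _ _) (hs _ _)
          · exact Nat.zero_le _
        · exact hs v b
      · have hjm : j ∈ Finset.Ico (i + 1) n := Finset.mem_Ico.2 ⟨hij, hj⟩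
        rw [← Finset.add_sum_erase _ _ hjm]
        beta_reduce
        rw [if_pos hp.symm, Finset.sum_congr rfl fun l hl => if_neg ?_]
        · rw [← Finset.add_sum_erase _ _ hjm] at hsum
          omega
        · intro he
          rw [Finset.mem_erase, Finset.mem_Ico] at hl
          exact hl.1 (h.inj l hl.2.2 j hj (by rw [he, hp]))
  obtain ⟨s, hs, hsum⟩ := key i (by omega)
  refine le_trans ?_ hsum
  obtain ⟨j, hij, hj, hp⟩ := h.exists_par i hi
  rw [Finset.sum_eq_sum_Ico_succ_bot (by omega), add_comm]
  refine Nat.add_le_add (hs _ _) ((hs _ _).trans ?_)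
  rw [hp]
  exact Finset.single_le_sum (f := fun l => s (q l)) (fun _ _ => Nat.zero_le _)
    (Finset.mem_Ico.2 ⟨hij, hj⟩)

/-- `s` records how the entry `m` for the budget `b` arises in the merge of `c` into `p`. -/
def IsChoice (k : ℕ) (g : ℕ → ℕ → ℕ) (c p e b s m : ℕ) : Prop :=
  (s = 0 ∧ m = g p b) ∨ ∃ a, s = a + 1 ∧ a < k ∧ a + e ≤ b ∧ m = g p (b - (a + e)) + g c a

theorem IsChoice.le {k c p e b s m : ℕ} {g : ℕ → ℕ → ℕ} (h : IsChoice k g c p e b s m) : s ≤ k := by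
  rcases h with h | ⟨a, h⟩ <;> omega

namespace WordRAM

variable {n k : ℕ} {h : Store}

theorem le_cube (n k : ℕ) : n + k + 2 ≤ (n + k + 2) ^ 3 := Nat.le_self_pow (by omega) _

theorem sat_initTable :
    Sat n k .initTable h fun h' => ∀ v < n, ∀ b < k, h'.arr .tab v b = h.arr .cnt v 0 := by
  refine Sat.upto_rule (fun i h' => ∀ v < i, ∀ b < k, h'.arr .tab v b = h.arr .cnt v 0) rfl
    (by simp) (fun i hi h' hb hf hi' hI => ?_) fun h' _ hI => hI
  have hfc : h'.arr .cnt = h.arr .cnt := hf.arr _ rfl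
  refine Sat.upto_rule (fun j h'' => (∀ v < i, ∀ b < k, h''.arr .tab v b = h.arr .cnt v 0) ∧
    ∀ b < j, h''.arr .tab i b = h.arr .cnt i 0) rfl (by simpa [Store.setReg] using hI)
    (fun j hj h'' hb' hf' hj' hI' => ?_) fun h'' _ hI' v hv b hbk => ?_
  · have hfc' : h''.arr .cnt = h'.arr .cnt := hf'.arr _ rfl
    have hfi' : h''.reg .i = h'.reg .i := hf'.reg _ rfl
    have hbc := hb'.arr .cnt i 0
    obtain ⟨h1, h2⟩ := hI'
    refine wp_sound ?_
    simp only [wp, Expr.val, Store.setArr, Store.setReg, hfc', hfc, hfi', hi', hj', true_and]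
      at hbc ⊢
    refine ⟨hbc, fun v hv b hbk => ?_, fun b hbj => ?_⟩
    · rw [if_neg (by omega)]
      exact h1 v hv b hbk
    · split_ifs with hb1
      · rfl
      · exact h2 b (by omega)
  · rcases Nat.lt_succ_iff_lt_or_eq.1 hv with hv | rfl
    · exact hI'.1 v hv b hbk
    · exact hI'.2 b hbk

/-- After `i` rounds the running maximum covers the splits below `i`. The recorded choice is 0 if
the child is left out and `a + 1` for the split `a`; it changes only on strict improvement. -/
theorem sat_mergeEntry {c p e b : ℕ} {g : ℕ → ℕ → ℕ} (hc : h.reg .c = c) (hp : h.reg .p = p)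
    (he : h.reg .e = e) (hb : h.reg .b = b) (hbest : h.reg .best = g p b) (hsel : h.reg .sel = 0)
    (hgp : ∀ x ≤ b, h.arr .tab p x = g p x) (hgc : ∀ x < k, h.arr .tab c x = g c x)
    (hle : ∀ a < k, ∀ x ≤ b, g p x + g c a ≤ n + k) :
    Sat n k .mergeEntry h fun h' => h'.reg .best = mergeStep k g c p e p b ∧
      IsChoice k g c p e b (h'.reg .sel) (h'.reg .best) := by
  refine Sat.upto_rule (fun i h' => h'.reg .best = max (g p b) ((Finset.range i).sup fun a =>
      if a + e ≤ b then g p (b - (a + e)) + g c a else 0) ∧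
    IsChoice k g c p e b (h'.reg .sel) (h'.reg .best)) rfl ?_
    (fun i hi h' hbd hf hi' hI => ?_) fun h' _ hI => ?_
  · simp [Store.setReg, hbest, hsel, IsChoice]
  · have f1 : h'.reg .c = h.reg .c := hf.reg _ rfl
    have f2 : h'.reg .p = h.reg .p := hf.reg _ rfl
    have f3 : h'.reg .e = h.reg .e := hf.reg _ rfl
    have f4 : h'.reg .b = h.reg .b := hf.reg _ rfl
    have f5 : h'.arr .tab = h.arr .tab := hf.arr _ rfl
    have hM := le_cube n k
    simp only [Bound.val] at hi
    obtain ⟨hI1, hI2⟩ := hI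
    have hlei := hle i hi (b - (i + e)) (Nat.sub_le _ _)
    refine wp_sound ?_
    simp only [Finset.range_add_one, Finset.sup_insert]
    simp [Cmd.block, wp, Expr.val, Store.setReg, f1, f2, f3, f4, f5, hc, hp, he, hb, hi',
      hgp (b - (i + e)) (Nat.sub_le _ _), hgc i hi, -Order.lt_add_one_iff, Nat.lt_succ_iff]
    refine ⟨fun hie => ⟨by omega, fun hlt => ⟨by omega, by omega, ?_, ?_⟩, fun hlt => ⟨?_, hI2⟩⟩,
      fun hie => ⟨?_, hI2⟩⟩
    · rw [if_pos hie]
      change _ = max (g p b) (max _ _)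
      omega
    · exact .inr ⟨i, rfl, hi, hie, rfl⟩
    · rw [if_pos hie, hI1]
      change _ = max (g p b) (max _ _)
      omega
    · rw [if_neg (by omega), hI1]
      change _ = max (g p b) (max _ _)
      omega
  · simp only [Bound.val] at hI
    refine ⟨?_, hI.2⟩
    rw [hI.1, mergeStep, if_pos rfl]

/-- The row of `p` is updated in place. Budgets are treated in decreasing order, because the new
entry for `b` reads the old entries of `p` for budgets up to `b`. -/
theorem sat_mergeRow {c p e : ℕ} {g : ℕ → ℕ → ℕ} (hc : h.reg .c = c) (hp : h.reg .p = p)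
    (he : h.reg .e = e) (hcp : c ≠ p) (hpn : p < n) (hcn : c < n)
    (hg : ∀ v < n, ∀ x < k, h.arr .tab v x = g v x)
    (hle : ∀ a x, g p x + g c a ≤ n + k) :
    Sat n k .mergeRow h fun h' =>
      (∀ v < n, ∀ x < k, h'.arr .tab v x = mergeStep k g c p e v x) ∧
      (∀ x < k, IsChoice k g c p e x (h'.arr .ch c x) (mergeStep k g c p e p x)) ∧
      ∀ v x, v ≠ c → h'.arr .ch v x = h.arr .ch v x := by
  refine Sat.upto_rule (fun j h' =>
      (∀ v < n, ∀ x < k, h'.arr .tab v x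
        = if v = p ∧ k ≤ x + j then mergeStep k g c p e p x else g v x) ∧
      (∀ x < k, k ≤ x + j →
        IsChoice k g c p e x (h'.arr .ch c x) (mergeStep k g c p e p x)) ∧
      ∀ v x, v ≠ c → h'.arr .ch v x = h.arr .ch v x) rfl ?_
    (fun j hj h' hbd hf hj' hI => ?_) fun h' _ hI => ?_
  · refine ⟨fun v hv x hx => ?_, fun x hx hx' => by omega, fun v x _ => rfl⟩
    rw [if_neg (by omega)]
    exact hg v hv x hx
  · have f1 : h'.reg .c = h.reg .c := hf.reg _ rfl
    have f2 : h'.reg .p = h.reg .p := hf.reg _ rfl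
    have f3 : h'.reg .e = h.reg .e := hf.reg _ rfl
    have hM := le_cube n k
    simp only [Bound.val] at hj
    obtain ⟨hI1, hI2, hI3⟩ := hI
    have hlej := hle 0 (k - 1 - j)
    have htab : h'.arr .tab p (k - 1 - j) = g p (k - 1 - j) := by
      rw [hI1 p hpn _ (by omega), if_neg (by omega)]
    refine wp_sound ?_
    simp [Cmd.block, wp, Expr.val, Store.setReg, f2, hp, hj', htab]
    refine ⟨by omega, by omega, ?_⟩
    refine (sat_mergeEntry (c := c) (p := p) (e := e) (b := k - 1 - j) (g := g)
      (by simp [f1, hc]) (by simp [f2, hp]) (by simp [f3, he]) (by simp) (by simp) (by simp)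
      (fun x hx => ?_) (fun x hx => ?_) (fun a _ x _ => hle a x)).mono fun h'' hf' hQ => ?_
    · simp only []
      rw [hI1 p hpn _ (by omega), if_neg (by omega)]
    · simp only []
      rw [hI1 c hcn _ hx, if_neg (by omega)]
    · have g1 : h''.reg .c = c := by rw [hf'.reg _ rfl]; simp [f1, hc]
      have g2 : h''.reg .p = p := by rw [hf'.reg _ rfl]; simp [f2, hp]
      have g3 : h''.reg .b = k - 1 - j := by rw [hf'.reg _ rfl]; simp
      have g4 : h''.arr .tab = h'.arr .tab := hf'.arr _ rfl
      have g5 : h''.arr .ch = h'.arr .ch := hf'.arr _ rfl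
      obtain ⟨hQ1, hQ2⟩ := hQ
      have hsel := hQ2.le
      have hbest : h''.reg .best ≤ n + k := by
        rcases hQ2 with ⟨_, h2⟩ | ⟨a, _, _, _, h2⟩
        · have := hle 0 (k - 1 - j)
          omega
        · have := hle a (k - 1 - j - (a + e))
          omega
      simp [Store.setArr, g1, g2, g3, g4, g5]
      refine ⟨by omega, by omega, fun v hv x hx => ?_, fun x hx hx' => ?_, fun v x hv => ?_⟩
      · by_cases hvx : v = p ∧ x = k - 1 - j
        · rw [if_pos hvx, if_pos ⟨hvx.1, by omega⟩, hQ1, hvx.2]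
        · rw [if_neg hvx, hI1 v hv x hx]
          refine if_congr (and_congr_right fun hvp => ?_) rfl rfl
          have : x ≠ k - 1 - j := fun he => hvx ⟨hvp, he⟩
          omega
      · split_ifs with hxj
        · rw [hxj, ← hQ1]
          exact hQ2
        · exact hI2 x hx (by omega)
      · rw [if_neg (fun hh => hv hh.1)]
        exact hI3 v x hv
  · refine ⟨fun v hv x hx => (hI.1 v hv x hx).trans ?_,
      fun x hx => hI.2.1 x hx (Nat.le_add_left _ _), hI.2.2⟩
    by_cases hvp : v = p
    · rw [hvp]
      exact if_pos ⟨rfl, Nat.le_add_left _ _⟩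
    · exact (if_neg fun hh => hvp hh.1).trans (if_neg hvp).symm

theorem sat_mergeAll {q par w : ℕ → ℕ} (ho : IsParentOrder n q par)
    (hq : ∀ l, h.arr .queue l 0 = q l) (hpar : ∀ v, h.arr .par v 0 = par v)
    (hw : ∀ v, h.arr .cnt v 0 = w v) (hsum : ∑ l ∈ Finset.range n, w (q l) ≤ k)
    (htab : ∀ v < n, ∀ b < k, h.arr .tab v b = w v) :
    Sat n k .mergeAll h fun h' =>
      (∀ v < n, ∀ b < k, h'.arr .tab v b = table n k q par w n v b) ∧
      ∀ l, l + 1 < n → ∀ b < k, IsChoice k (table n k q par w l) (q l) (par (q l))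
        (emptyInd w (q l)) b (h'.arr .ch (q l) b) (table n k q par w (l + 1) (par (q l)) b) := by
  refine Sat.upto_rule (fun i h' =>
      (∀ v < n, ∀ b < k, h'.arr .tab v b = table n k q par w i v b) ∧
      ∀ l < i, ∀ b < k, IsChoice k (table n k q par w l) (q l) (par (q l))
        (emptyInd w (q l)) b (h'.arr .ch (q l) b) (table n k q par w (l + 1) (par (q l)) b)) rfl
    ⟨htab, by simp⟩ (fun i hi h' hbd hf hi' hI => ?_) fun h' _ hI => ?_
  · have f1 : h'.arr .queue = h.arr .queue := hf.arr _ rfl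
    have f2 : h'.arr .par = h.arr .par := hf.arr _ rfl
    have f3 : h'.arr .cnt = h.arr .cnt := hf.arr _ rfl
    have hM := le_cube n k
    simp only [Bound.val] at hi
    obtain ⟨hI1, hI2⟩ := hI
    have hin : i + 1 < n := by omega
    obtain ⟨j, hij, hj, hp⟩ := ho.exists_par i hin
    have hcn := ho.lt i (by omega)
    have hpn : par (q i) < n := hp ▸ ho.lt j hj
    refine wp_sound ?_
    simp [Cmd.block, wp, Expr.val, Store.setReg, f1, f2, f3, hq, hpar, hw, hi']
    refine ⟨by omega, by omega, by split_ifs <;> omega, ?_⟩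
    refine (sat_mergeRow (c := q i) (p := par (q i)) (e := emptyInd w (q i))
      (g := table n k q par w i) (by simp) (by simp) (by simp [emptyInd]) (fun he => ?_) hpn hcn (by exact hI1)
      (fun a x => (ho.table_add_le hin a x).trans (by omega))).mono fun h'' hf' hQ => ?_
    · have := ho.inj i (by omega) j hj (by rw [he, hp])
      omega
    · obtain ⟨hQ1, hQ2, hQ3⟩ := hQ
      have hT : table n k q par w (i + 1)
          = mergeStep k (table n k q par w i) (q i) (par (q i)) (emptyInd w (q i)) := by
        rw [table, if_pos hin]
      refine ⟨fun v hv b hb => ?_, fun l hl b hb => ?_⟩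
      · rw [hT]
        exact hQ1 v hv b hb
      · rcases Nat.lt_or_eq_of_le hl with hl | rfl
        · have hne : q l ≠ q i := fun he => by
            have := ho.inj l (by omega) i (by omega) he
            omega
          have := hI2 l hl b hb
          simp only [hQ3 _ b hne]
          exact this
        · rw [hT]
          exact hQ2 b hb
  · simp only [Bound.val] at hI
    refine ⟨fun v hv b hb => ?_, fun l hl => hI.2 l (by omega)⟩
    rw [hI.1 v hv b hb]
    -- The loop makes `n - 1` merges; the last step of `table` changes nothing, since the last
    -- vertex has no parent.
    obtain ⟨m, rfl⟩ : ∃ m, n = m + 1 := ⟨n - 1, by omega⟩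
    conv_rhs => rw [table, if_neg (by omega)]
    rfl

/-- The cost of a table entry. -/
def entryValue (n k : ℕ) (q par w : ℕ → ℕ) (v j : ℕ) : ℕ :=
  max (k - table n k q par w n v j) (j + emptyInd w v)

theorem sat_findBest {q par w : ℕ → ℕ} (hn : 0 < n) (hk : 0 < k)
    (hw : ∀ v, h.arr .cnt v 0 = w v)
    (htab : ∀ v < n, ∀ b < k, h.arr .tab v b = table n k q par w n v b) :
    Sat n k .findBest h fun h' => h'.reg .bv < n ∧ h'.reg .bj < k ∧
      ∀ v < n, ∀ j < k,
        entryValue n k q par w (h'.reg .bv) (h'.reg .bj) ≤ entryValue n k q par w v j := by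
  have hM := le_cube n k
  have hemp : ∀ v, (if w v = 0 then 1 else 0) = emptyInd w v := fun v => rfl
  have hemp1 : ∀ v, emptyInd w v ≤ 1 := fun v => by unfold emptyInd; split_ifs <;> omega
  have start : ∀ h₁ : Store, h₁.arr .cnt = h.arr .cnt → h₁.arr .tab = h.arr .tab →
      h₁.reg .bv = 0 → h₁.reg .bj = 0 → h₁.reg .best = entryValue n k q par w 0 0 →
      Sat n k (.upto .i .n <| .upto .j .k <| .block [
        Cmd.entryCost (.reg .i) (.reg .j),
        .ite (.lt (.reg .tmp) (.reg .best))
          (.block [.set .best (.reg .tmp), .set .bv (.reg .i), .set .bj (.reg .j)]) .skip]) h₁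
        fun h' => h'.reg .bv < n ∧ h'.reg .bj < k ∧
      ∀ v < n, ∀ j < k,
        entryValue n k q par w (h'.reg .bv) (h'.reg .bj) ≤ entryValue n k q par w v j := by
    intro h₁ e1 e2 e3 e4 e5
    refine Sat.upto_rule (fun i h' => h'.reg .bv < n ∧ h'.reg .bj < k ∧
      h'.reg .best = entryValue n k q par w (h'.reg .bv) (h'.reg .bj) ∧
      ∀ v < i, ∀ j < k, h'.reg .best ≤ entryValue n k q par w v j) rfl ?_
      (fun i hi h' hbd hf hi' hI => ?_) fun h' _ hI => ?_
    · simp [Store.setReg, e3, e4, e5, hn, hk]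
    · have f1 : h'.arr .cnt = h.arr .cnt := by rw [hf.arr _ rfl, e1]
      have f2 : h'.arr .tab = h.arr .tab := by rw [hf.arr _ rfl, e2]
      simp only [Bound.val] at hi
      refine Sat.upto_rule (fun j h'' => h''.reg .bv < n ∧ h''.reg .bj < k ∧
        h''.reg .best = entryValue n k q par w (h''.reg .bv) (h''.reg .bj) ∧
        (∀ v < i, ∀ j < k, h''.reg .best ≤ entryValue n k q par w v j) ∧
        ∀ j' < j, h''.reg .best ≤ entryValue n k q par w i j') rfl ?_
        (fun j hj h'' hbd hf' hj' hI => ?_) fun h'' _ hI => ?_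
      · simpa [Store.setReg] using hI
      · have g1 : h''.arr .cnt = h.arr .cnt := by rw [hf'.arr _ rfl, f1]
        have g2 : h''.arr .tab = h.arr .tab := by rw [hf'.arr _ rfl, f2]
        have g3 : h''.reg .i = i := by rw [hf'.reg _ rfl, hi']
        simp only [Bound.val] at hj
        obtain ⟨hI1, hI2, hI3, hI4, hI5⟩ := hI
        have hev : entryValue n k q par w i j
          = max (k - table n k q par w n i j) (j + emptyInd w i) := rfl
        have := hemp1 i
        refine wp_sound ?_
        simp [Cmd.block, Cmd.entryCost, wp, Expr.val, Store.setReg, g1, g2, g3, hj', hw, hemp,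
          htab i hi j hj, -Order.lt_add_one_iff]
        have hcase : ∀ j' < j + 1, j' < j ∨ j' = j := fun j' hj' => by omega
        refine ⟨by omega, by omega, fun h1 => ⟨by omega, fun h2 => ⟨by omega, by omega, by omega,
          hi, hj, by omega, fun v hv j' hj' => ?_, fun j' hj' => ?_⟩, fun h2 => ⟨hI1, hI2, hI3, hI4,
          fun j' hj' => ?_⟩⟩, fun h1 => ⟨fun h2 => ⟨by omega, by omega, by omega,
          hi, hj, by omega, fun v hv j' hj' => ?_, fun j' hj' => ?_⟩, fun h2 => ⟨hI1, hI2, hI3, hI4,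
          fun j' hj' => ?_⟩⟩⟩
        all_goals first
          | (have := hI4 v hv j' hj'; omega)
          | (rcases hcase j' hj' with hj' | rfl
             · have := hI5 j' hj'
               omega
             · omega)
      · obtain ⟨hI1, hI2, hI3, hI4, hI5⟩ := hI
        refine ⟨hI1, hI2, hI3, fun v hv j hj => ?_⟩
        rcases Nat.lt_succ_iff_lt_or_eq.1 hv with hv | rfl
        · exact hI4 v hv j hj
        · exact hI5 j hj
    · simp only [Bound.val] at hI
      exact ⟨hI.1, hI.2.1, fun v hv j hj => hI.2.2.1 ▸ hI.2.2.2 v hv j hj⟩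
  have := hemp1 0
  have hev : entryValue n k q par w 0 0
    = max (k - table n k q par w n 0 0) (0 + emptyInd w 0) := rfl
  refine wp_sound ?_
  simp only [Cmd.findBest, Cmd.entryCost, Cmd.block]
  simp [wp, Expr.val, Store.setReg, hw, hemp, htab 0 hn 0 hk]
  refine ⟨by omega, by omega, fun h1 => ⟨by omega, ?_⟩, fun h1 => ?_⟩
  · exact start _ rfl rfl (by simp) (by simp) (by simp; omega)
  · refine ⟨by omega, ?_⟩
    exact start _ rfl rfl (by simp) (by simp) (by simp; omega)

end WordRAM

/-! ## Reconstruction of an optimal solution -/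

namespace WordRAM

variable {n k : ℕ} {h : Store}

theorem sat_reconstruct {q par w : ℕ → ℕ} (ho : IsParentOrder n q par)
    (hq : ∀ l, h.arr .queue l 0 = q l) (hpar : ∀ v, h.arr .par v 0 = par v)
    (hw : ∀ v, h.arr .cnt v 0 = w v) (hmark : ∀ v, h.arr .mark v 0 = 0) {t b : ℕ}
    (ht : h.reg .bv = t) (hb : h.reg .bj = b) (htn : t < n) (hbk : b < k)
    (hch : ∀ l, l + 1 < n → ∀ b < k, IsChoice k (table n k q par w l) (q l) (par (q l))
      (emptyInd w (q l)) b (h.arr .ch (q l) b) (table n k q par w (l + 1) (par (q l)) b)) :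
    Sat n k .reconstruct h fun h' => ∃ S bud, IsRecon n k q par w t b 0 S bud ∧
      ∀ v, h'.arr .mark v 0 = if v ∈ S then 1 else 0 := by
  refine Sat.upto_rule (fun i h' => ∃ S, IsRecon n k q par w t b (n - i) S
      (fun v => h'.arr .bud v 0) ∧ ∀ v, h'.arr .mark v 0 = if v ∈ S then 1 else 0) rfl
    ⟨∅, IsRecon.start ho htn, by simpa [Store.setReg] using hmark⟩ (fun ii hii h' hbd hf hii' hI => ?_)
    fun h' _ hI => ?_
  · have f1 : h'.arr .queue = h.arr .queue := hf.arr _ rfl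
    have f2 : h'.arr .par = h.arr .par := hf.arr _ rfl
    have f3 : h'.arr .cnt = h.arr .cnt := hf.arr _ rfl
    have f4 : h'.arr .ch = h.arr .ch := hf.arr _ rfl
    have f5 : h'.reg .bv = h.reg .bv := hf.reg _ rfl
    have f6 : h'.reg .bj = h.reg .bj := hf.reg _ rfl
    have hM := le_cube n k
    simp only [Bound.val] at hii
    obtain ⟨S, hS, hm⟩ := hI
    -- The counter `ii` goes up while the order is traversed from its end, so that parents are
    -- decided before their children.
    obtain ⟨i, hi⟩ : ∃ i, i = n - 1 - ii := ⟨_, rfl⟩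
    have e1 : n - ii = i + 1 := by omega
    have e2 : n - (ii + 1) = i := by omega
    rw [e1] at hS
    have hin : i < n := by omega
    have hcn := ho.lt i hin
    have hcS := hS.notMem ho hin
    have b1 := hbd.arr .par (q i) 0
    have b2 := hbd.arr .bud (par (q i)) 0
    have b3 := hbd.arr .ch (q i) (h'.arr .bud (par (q i)) 0)
    rw [f2, hpar] at b1
    rw [f4] at b3
    refine wp_sound ?_
    simp only [e2]
    simp [Cmd.block, wp, Expr.val, Store.setReg, Store.setArr, f1, f2, f3, f4, f5, f6, hq, hpar, hw,
      hii', ht, hb, ← hi, hm]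
    have hpc : ∀ {p}, p ∈ S → p ≠ q i := fun hp he => hcS (he ▸ hp)
    refine ⟨by omega, by omega, fun hct => ⟨by omega, by omega, {q i}, ?_, fun v => ?_⟩,
      fun hct => ⟨b1, fun hp => ⟨b2, b3, fun hs => ⟨by omega, by omega,
        by split_ifs <;> omega, by split_ifs <;> omega, insert (q i) S, ?_, fun v => ?_⟩, fun hs => ⟨S, ?_, fun _ => rfl⟩⟩,
        fun hp => ⟨S, hS.step_skip hct hp, fun _ => rfl⟩⟩⟩
    · have h1 := hS.congr_bud (bud' := fun v => if v = q i then b else h'.arr .bud v 0)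
        fun v hv => if_neg (hpc hv)
      rw [hct] at h1 ⊢
      exact (h1.step_top ho hin hct (if_pos rfl)).2
    · have hS0 : S = ∅ := (hS.congr_bud (bud' := fun v => if v = q i then b else h'.arr .bud v 0)
        fun v hv => if_neg (hpc hv)).step_top ho hin hct (if_pos hct.symm) |>.1
      simp [hS0]
    · have hc := hch i (hS.succ_lt hp) _ ((hS.bud_le hp).trans_lt hbk)
      rcases hc with ⟨h0, _⟩ | ⟨a, ha, _, hle, htab⟩
      · exact absurd h0 hs
      · rw [ha, Nat.add_sub_cancel]
        refine hS.step_take ho hct rfl hp hle htab ?_ ?_ fun v hv hvp => ?_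
        · simp [Ne.symm (hpc hp)]
        · simp [emptyInd]
        · simp [hvp, hpc hv]
    · by_cases hvc : v = q i <;> simp [hvc]
    · have hc := hch i (hS.succ_lt hp) _ ((hS.bud_le hp).trans_lt hbk)
      rcases hc with ⟨_, htab⟩ | ⟨a, ha, _⟩
      · exact hS.step_leave hct htab
      · omega
  · obtain ⟨S, hS, hm⟩ := hI
    simp only [Bound.val, Nat.sub_self] at hS
    exact ⟨S, _, hS, hm⟩

/-- `f 0, …, f (m - 1)` lists the empty vertices of `T`. -/
structure ListsEmpty (w : ℕ → ℕ) (T : Finset ℕ) (m : ℕ) (f : ℕ → ℕ) : Prop where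
  mem : ∀ x < m, f x ∈ T
  card : m = (T.filter fun v => w v = 0).card
  exists_eq : ∀ v ∈ T, w v = 0 → ∃ x < m, f x = v

theorem sat_trim {q par w : ℕ → ℕ} (ho : IsParentOrder n q par)
    (hq : ∀ l, h.arr .queue l 0 = q l) (hw : ∀ v, h.arr .cnt v 0 = w v)
    (hkeep : ∀ v, h.arr .keep v 0 = 0) {t : ℕ} {S : Finset ℕ}
    (hmark : ∀ v, h.arr .mark v 0 = if v ∈ S then 1 else 0) (hS : IsBelow n q par n t S) :
    Sat n k .trim h fun h' => ∃ T, IsTrim n k q par t S 0 T ∧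
      (∀ v, h'.arr .keep v 0 = if v ∈ T then 1 else 0) ∧
      ListsEmpty w T (h'.reg .ne) fun x => h'.arr .emp x 0 := by
  refine wp_sound ⟨Nat.zero_le _, Nat.zero_le _, ?_⟩
  refine Sat.upto_rule (fun i h' => ∃ T, IsTrim n k q par t S (n - i) T ∧
      h'.reg .size = T.card ∧
      (∀ v, h'.arr .keep v 0 = if v ∈ T then 1 else 0) ∧
      ListsEmpty w T (h'.reg .ne) fun x => h'.arr .emp x 0) rfl
    ⟨∅, IsTrim.start, rfl, by simpa [Store.setReg] using hkeep, ⟨fun x hx => absurd hx (Nat.not_lt_zero x), rfl,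
      by simp⟩⟩ (fun ii hii h' hbd hf hii' hI => ?_) fun h' _ hI => ?_
  · have f1 : h'.arr .queue = h.arr .queue := hf.arr _ rfl
    have f2 : h'.arr .mark = h.arr .mark := hf.arr _ rfl
    have f3 : h'.arr .cnt = h.arr .cnt := hf.arr _ rfl
    have hM := le_cube n k
    simp only [Bound.val] at hii
    obtain ⟨T, hT, hsize, hkp, hemp⟩ := hI
    obtain ⟨i, hi⟩ : ∃ i, i = n - 1 - ii := ⟨_, rfl⟩
    have e1 : n - ii = i + 1 := by omega
    have e2 : n - (ii + 1) = i := by omega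
    rw [e1] at hT
    have hin : i < n := by omega
    have hcn := ho.lt i hin
    have hcT := hT.notMem ho hin
    have hne : h'.reg .ne ≤ T.card := hemp.card ▸ Finset.card_filter_le _ _
    have hTk := hT.card_le
    have hins : (insert (q i) T).card = T.card + 1 := Finset.card_insert_of_notMem hcT
    have hkp' : ∀ v, (if v = q i then 1 else if v ∈ T then 1 else 0)
        = if v ∈ insert (q i) T then 1 else 0 := fun v => by
      by_cases hvc : v = q i <;> simp [hvc]
    refine wp_sound ?_
    simp only [e2]
    simp [Cmd.block, wp, Expr.val, Store.setReg, Store.setArr, f1, f2, f3, hq, hw, hmark,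
      hii', ← hi, hsize, hkp, -Finset.mem_insert, -Order.lt_add_one_iff]
    refine ⟨by omega, by omega, fun hlt hcS => ⟨by omega, by omega, fun hw0 => ⟨by omega, by omega,
      insert (q i) T, hT.step_keep ho hS hin hcS hlt, hins.symm, hkp', ?_, ?_, ?_⟩,
      fun hw0 => ⟨insert (q i) T, hT.step_keep ho hS hin hcS hlt, hins.symm, hkp', ?_, ?_, ?_⟩⟩,
      fun hc => ⟨T, hT.step_drop fun hcS => not_lt.1 fun hlt => hc hlt hcS, rfl, fun _ => rfl, hemp⟩⟩
    · intro x hx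
      split_ifs
      · exact Finset.mem_insert_self _ _
      · exact Finset.mem_insert_of_mem (hemp.mem x (by omega))
    · rw [Finset.filter_insert, if_pos hw0, Finset.card_insert_of_notMem (by simp [hcT]),
        ← hemp.card]
    · intro v hv hv0
      rcases Finset.mem_insert.1 hv with rfl | hv
      · exact ⟨_, Nat.lt_succ_self _, if_pos rfl⟩
      · obtain ⟨x, hx, he⟩ := hemp.exists_eq v hv hv0
        exact ⟨x, by omega, by rw [if_neg (by omega)]; exact he⟩
    · exact fun x hx => Finset.mem_insert_of_mem (hemp.mem x hx)
    · rw [Finset.filter_insert, if_neg hw0, ← hemp.card]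
    · intro v hv hv0
      rcases Finset.mem_insert.1 hv with rfl | hv
      · exact absurd hv0 hw0
      · exact hemp.exists_eq v hv hv0
  · obtain ⟨T, hT, -, hkp, hemp⟩ := hI
    simp only [Bound.val, Nat.sub_self] at hT
    exact ⟨T, hT, hkp, hemp⟩

/-! ### Moving the pebbles onto the chosen set -/

/-- The result of sending the pebbles that start outside of `T`: the first `m'` of the `m` vertices
`f 0, …, f (m - 1)` have been filled. -/
structure SentOutside (σ : Fin k → Fin n) (T : Finset ℕ) (m : ℕ) (f : ℕ → ℕ) (i m' : ℕ)
    (μ : ℕ → ℕ) : Prop where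
  mem : ∀ p : Fin k, (p : ℕ) < i → (σ p : ℕ) ∉ T → μ p ∈ T
  filled : ∀ x < m', ∃ p : Fin k, (p : ℕ) < i ∧ (σ p : ℕ) ∉ T ∧ μ p = f x
  count : m' = min m (Finset.univ.filter fun p : Fin k => (p : ℕ) < i ∧ (σ p : ℕ) ∉ T).card

/-- These pebbles have to move anyway, so they are the first to fill empty vertices; when none is
left, any vertex of `T` will do, and the top is taken. -/
theorem sat_sendOutside {σ : Fin k → Fin n} {w : ℕ → ℕ} {T : Finset ℕ}
    (hstart : ∀ p : Fin k, h.arr .start p 0 = σ p)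
    (hkeep : ∀ v, h.arr .keep v 0 = if v ∈ T then 1 else 0) (ht : h.reg .bv ∈ T)
    (hemp : ListsEmpty w T (h.reg .ne) fun x => h.arr .emp x 0) :
    Sat n k .sendOutside h fun h' =>
      SentOutside σ T (h.reg .ne) (fun x => h.arr .emp x 0) k (h'.reg .nf) h'.raw := by
  refine wp_sound ⟨Nat.zero_le _, ?_⟩
  refine Sat.upto_rule (fun i h' => SentOutside σ T (h.reg .ne) (fun x => h.arr .emp x 0) i
    (h'.reg .nf) h'.raw) rfl ?_ (fun i hi h' hbd hf hi' hI => ?_) fun h' _ hI => hI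
  · exact ⟨by simp, by simp [Store.setReg, Expr.val], by simp [Store.setReg, Expr.val]⟩
  · have f1 : h'.arr .start = h.arr .start := hf.arr _ rfl
    have f2 : h'.arr .keep = h.arr .keep := hf.arr _ rfl
    have f3 : h'.arr .emp = h.arr .emp := hf.arr _ rfl
    have f4 : h'.reg .bv = h.reg .bv := hf.reg _ rfl
    have f5 : h'.reg .ne = h.reg .ne := hf.reg _ rfl
    have hM := le_cube n k
    simp only [Bound.val] at hi
    have hst := hstart ⟨i, hi⟩
    have hsn := (σ ⟨i, hi⟩).2
    have b1 := hbd.arr .emp (h'.reg .nf) 0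
    have b2 := hbd.reg .bv
    have b3 := hbd.reg .ne
    rw [f3] at b1
    rw [f4] at b2
    rw [f5] at b3
    simp only [] at hst
    refine wp_sound ?_
    simp [Cmd.block, Cmd.sendPebble, wp, Expr.val, Store.setReg, Store.setRaw, f1, f2,
      f3, f4, f5, hi', hst, hkeep]
    have hpi : ∀ p : Fin k, (p : ℕ) < i + 1 → (p : ℕ) ≠ i → (p : ℕ) < i := fun p _ _ => by omega
    have hcnt := hI.count
    refine ⟨by omega, fun hT => ⟨fun p hp hpT => ?_, fun x hx => ?_, ?_⟩,
      fun hT => ⟨b2, fun hlt => ⟨by omega, b1, by omega, fun p hp hpT => ?_, fun x hx => ?_, ?_⟩,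
      fun hlt => ⟨by omega, by omega, fun p hp hpT => ?_, fun x hx => ?_, ?_⟩⟩⟩
    · refine hI.mem p (hpi p hp ?_) hpT
      rintro rfl
      exact hpT hT
    · obtain ⟨p, hp, hpT⟩ := hI.filled x hx
      exact ⟨p, by omega, hpT⟩
    · rw [card_filter_lt_succ hi, if_neg (not_not.2 hT)]
      exact hcnt
    · split_ifs with he
      · exact hemp.mem _ hlt
      · exact hI.mem p (hpi p hp he) hpT
    · rcases Nat.lt_succ_iff_lt_or_eq.1 hx with hx | rfl
      · obtain ⟨p, hp, hpT, he⟩ := hI.filled x hx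
        exact ⟨p, by omega, hpT, by rw [if_neg (by omega), he]⟩
      · exact ⟨⟨i, hi⟩, Nat.lt_succ_self i, hT, if_pos rfl⟩
    · rw [card_filter_lt_succ hi, if_pos hT]
      omega
    · split_ifs with he
      · exact ht
      · exact hI.mem p (hpi p hp he) hpT
    · obtain ⟨p, hp, hpT, he⟩ := hI.filled x hx
      exact ⟨p, by omega, hpT, by rw [if_neg (by omega), he]⟩
    · rw [card_filter_lt_succ hi, if_pos hT]
      omega

/-- The result of sending the pebbles that start in `T`: all but one at every vertex fill the
vertices `f m₀, f (m₀ + 1), …` as long as there are any. -/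
structure SentInside (σ : Fin k → Fin n) (T : Finset ℕ) (rep : ℕ → ℕ) (m : ℕ) (f : ℕ → ℕ)
    (m₀ i m' : ℕ) (μ : ℕ → ℕ) : Prop where
  le : m₀ ≤ m'
  mem : ∀ p : Fin k, (p : ℕ) < i → (σ p : ℕ) ∈ T → μ p ∈ T
  filled : ∀ x, m₀ ≤ x → x < m' → ∃ p : Fin k, (p : ℕ) < i ∧ (σ p : ℕ) ∈ T ∧ μ p = f x
  count : m' = min m (m₀ + (Finset.univ.filter fun p : Fin k =>
    (p : ℕ) < i ∧ (σ p : ℕ) ∈ T ∧ rep (σ p) ≠ p).card)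
  stay : ∀ p : Fin k, (p : ℕ) < i → (σ p : ℕ) ∈ T → rep (σ p) = p → μ p = σ p
  moved : m₀ + (Finset.univ.filter fun p : Fin k =>
    (p : ℕ) < i ∧ (σ p : ℕ) ∈ T ∧ μ p ≠ σ p).card ≤ m'

/-- Representatives stay, which keeps occupied vertices occupied. Another pebble leaves its vertex
only to fill an empty one, so the moves inside `T` are at most as many as the vertices filled in
this pass. -/
theorem sat_sendInside {σ : Fin k → Fin n} {w : ℕ → ℕ} {T : Finset ℕ}
    (hstart : ∀ p : Fin k, h.arr .start p 0 = σ p)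
    (hkeep : ∀ v, h.arr .keep v 0 = if v ∈ T then 1 else 0)
    (hemp : ListsEmpty w T (h.reg .ne) fun x => h.arr .emp x 0) (hle : h.reg .nf ≤ h.reg .ne) :
    Sat n k .sendInside h fun h' => (∀ p : Fin k, (σ p : ℕ) ∉ T → h'.raw p = h.raw p) ∧
      SentInside σ T (fun v => h.arr .rep v 0) (h.reg .ne) (fun x => h.arr .emp x 0) (h.reg .nf) k
        (h'.reg .nf) h'.raw := by
  refine Sat.upto_rule (fun i h' => (∀ p : Fin k, (σ p : ℕ) ∉ T → h'.raw p = h.raw p) ∧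
      SentInside σ T (fun v => h.arr .rep v 0) (h.reg .ne) (fun x => h.arr .emp x 0) (h.reg .nf) i
        (h'.reg .nf) h'.raw) rfl ?_ (fun i hi h' hbd hf hi' hI => ?_) fun h' _ hI => hI
  · exact ⟨fun _ _ => rfl, le_rfl, by simp, fun x h1 h2 => absurd h2 (not_lt.2 h1),
      by simpa [Store.setReg] using hle, by simp, by simp [Store.setReg]⟩
  · have f1 : h'.arr .start = h.arr .start := hf.arr _ rfl
    have f2 : h'.arr .keep = h.arr .keep := hf.arr _ rfl
    have f3 : h'.arr .emp = h.arr .emp := hf.arr _ rfl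
    have f4 : h'.arr .rep = h.arr .rep := hf.arr _ rfl
    have f5 : h'.reg .ne = h.reg .ne := hf.reg _ rfl
    have hM := le_cube n k
    simp only [Bound.val] at hi
    obtain ⟨hout, hI⟩ := hI
    have hst := hstart ⟨i, hi⟩
    have hsn := (σ ⟨i, hi⟩).2
    have b1 := hbd.arr .emp (h'.reg .nf) 0
    have b3 := hbd.reg .ne
    rw [f3] at b1
    rw [f5] at b3
    simp only [] at hst
    have hpi : ∀ p : Fin k, (p : ℕ) < i + 1 → (p : ℕ) ≠ i → (p : ℕ) < i := fun p _ _ => by omega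
    have hcnt := hI.count
    have hm0 := hI.le
    have hmv := hI.moved
    have hmoved : ∀ y, (Finset.univ.filter fun p : Fin k => (p : ℕ) < i ∧ (σ p : ℕ) ∈ T ∧
        (if (p : ℕ) = i then y else h'.raw p) ≠ σ p).card
        = (Finset.univ.filter fun p : Fin k => (p : ℕ) < i ∧ (σ p : ℕ) ∈ T ∧
          h'.raw p ≠ σ p).card := fun y => by
      congr 1
      ext p
      simp only [Finset.mem_filter, Finset.mem_univ, true_and]
      refine and_congr_right fun hp => ?_
      rw [if_neg (by omega)]
    refine wp_sound ?_
    simp [Cmd.block, Cmd.sendPebble, wp, Expr.val, Store.setReg, Store.setRaw, f1, f2,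
      f3, f4, f5, hi', hst, hkeep]
    have hout' : ∀ y, (σ ⟨i, hi⟩ : ℕ) ∈ T → ∀ p : Fin k, (σ p : ℕ) ∉ T →
        (if (p : ℕ) = i then y else h'.raw p) = h.raw p := fun y hT p hp => by
      rw [if_neg]
      · exact hout p hp
      · rintro rfl
        exact hp hT
    refine ⟨by omega, fun hT => ⟨fun hrep => ⟨by omega, by omega, hout' _ hT, ?_⟩,
      fun hrep => ⟨by omega, fun hlt => ⟨by omega, b1, by omega, hout' _ hT, ?_⟩,
        fun hlt => ⟨by omega, by omega, hout' _ hT, ?_⟩⟩⟩, fun hT => ⟨hout, ?_⟩⟩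
    · refine ⟨hm0, fun p hp hpT => ?_, fun x hx hx' => ?_, ?_, fun p hp hpT hr => ?_, ?_⟩
      · split_ifs with he
        · exact hT
        · exact hI.mem p (hpi p hp he) hpT
      · obtain ⟨p, hp, hpT, he⟩ := hI.filled x hx hx'
        exact ⟨p, by omega, hpT, by rw [if_neg (by omega), he]⟩
      · rw [card_filter_lt_succ hi, if_neg (fun hh => hh.2 hrep)]
        exact hcnt
      · split_ifs with he
        · obtain rfl : p = ⟨i, hi⟩ := Fin.ext he
          rfl
        · exact hI.stay p (hpi p hp he) hpT hr
      · rw [card_filter_lt_succ hi, if_neg (fun hh => hh.2 (if_pos rfl)), hmoved]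
        exact hmv
    · refine ⟨by omega, fun p hp hpT => ?_, fun x hx hx' => ?_, ?_, fun p hp hpT hr => ?_, ?_⟩
      · split_ifs with he
        · exact hemp.mem _ hlt
        · exact hI.mem p (hpi p hp he) hpT
      · rcases Nat.lt_succ_iff_lt_or_eq.1 hx' with hx' | rfl
        · obtain ⟨p, hp, hpT, he⟩ := hI.filled x hx hx'
          exact ⟨p, by omega, hpT, by rw [if_neg (by omega), he]⟩
        · exact ⟨⟨i, hi⟩, Nat.lt_succ_self i, hT, if_pos rfl⟩
      · rw [card_filter_lt_succ hi, if_pos ⟨hT, hrep⟩]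
        omega
      · split_ifs with he
        · obtain rfl : p = ⟨i, hi⟩ := Fin.ext he
          exact absurd hr hrep
        · exact hI.stay p (hpi p hp he) hpT hr
      · rw [card_filter_lt_succ hi, hmoved]
        split_ifs <;> omega
    · refine ⟨hm0, fun p hp hpT => ?_, fun x hx hx' => ?_, ?_, fun p hp hpT hr => ?_, ?_⟩
      · split_ifs with he
        · exact hT
        · exact hI.mem p (hpi p hp he) hpT
      · obtain ⟨p, hp, hpT, he⟩ := hI.filled x hx hx'
        exact ⟨p, by omega, hpT, by rw [if_neg (by omega), he]⟩
      · rw [card_filter_lt_succ hi, if_pos ⟨hT, hrep⟩]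
        omega
      · split_ifs with he
        · obtain rfl : p = ⟨i, hi⟩ := Fin.ext he
          rfl
        · exact hI.stay p (hpi p hp he) hpT hr
      · rw [card_filter_lt_succ hi, if_neg (fun hh => hh.2 (if_pos rfl)), hmoved]
        exact hmv
    · have hlt : ∀ p : Fin k, (p : ℕ) < i + 1 → (σ p : ℕ) ∈ T → (p : ℕ) < i := fun p hp hpT => by
        refine hpi p hp ?_
        rintro rfl
        exact hT hpT
      refine ⟨hm0, fun p hp hpT => hI.mem p (hlt p hp hpT) hpT, fun x hx hx' => ?_, ?_,
        fun p hp hpT => hI.stay p (hlt p hp hpT) hpT, ?_⟩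
      · obtain ⟨p, hp, hpT⟩ := hI.filled x hx hx'
        exact ⟨p, by omega, hpT⟩
      · rw [card_filter_lt_succ hi, if_neg (fun hh => hT hh.1)]
        exact hcnt
      · rw [card_filter_lt_succ hi, if_neg (fun hh => hT hh.1)]
        exact hmv

end WordRAM

/-! ## Correctness of the program -/

namespace WordRAM

variable {n k : ℕ}

/-- The pebbles fill the chosen set, and the number of moved pebbles is as small as possible. -/
theorem exists_motion {σ : Fin k → Fin n} {T : Finset ℕ} {rep f μ₀ μ : ℕ → ℕ} {m m₀ m₁ : ℕ}
    (hTn : ∀ v ∈ T, v < n) (hTk : T.card ≤ k)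
    (hrep : ∀ p : Fin k, ∃ p' : Fin k, rep (σ p) = p' ∧ σ p' = σ p)
    (hemp : ListsEmpty (startCount σ) T m f) (hout : SentOutside σ T m f k m₀ μ₀)
    (hμ : ∀ p : Fin k, (σ p : ℕ) ∉ T → μ p = μ₀ p) (hin : SentInside σ T rep m f m₀ k m₁ μ) :
    ∃ ν : Fin k → Fin n, (∀ p : Fin k, μ p = ν p) ∧ (∀ v, v ∈ T ↔ ∃ p, (ν p : ℕ) = v) ∧
      numMoved σ ν ≤ max (k - ∑ v ∈ T, startCount σ v) (∑ v ∈ T, emptyInd (startCount σ) v) := by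
  have hmem : ∀ p : Fin k, μ p ∈ T := fun p => by
    by_cases hp : (σ p : ℕ) ∈ T
    · exact hin.mem p p.2 hp
    · rw [hμ p hp]
      exact hout.mem p p.2 hp
  have c1 := hout.count
  have c2 := hin.count
  have c3 := hin.moved
  have c4 := hemp.card
  simp only [Fin.is_lt, true_and] at c1 c2 c3
  have d1 := Finset.card_filter_add_card_filter_not (s := (Finset.univ : Finset (Fin k)))
    (fun p => (σ p : ℕ) ∈ T)
  have d2 := Finset.card_filter_add_card_filter_not
    (s := (Finset.univ : Finset (Fin k)).filter fun p => (σ p : ℕ) ∈ T) (fun p => rep (σ p) = p)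
  have d3 := Finset.card_filter_add_card_filter_not (s := T) (fun v => startCount σ v = 0)
  have d4 : (((Finset.univ : Finset (Fin k)).filter fun p => (σ p : ℕ) ∈ T).filter
      fun p => rep (σ p) = p).card ≤ (T.filter fun v => ¬ startCount σ v = 0).card := by
    refine Finset.card_le_card_of_injOn (fun p => (σ p : ℕ)) (fun p hp => ?_)
      (fun p hp p' hp' he => ?_)
    · simp only [Finset.coe_filter, Finset.mem_filter, Finset.mem_univ, true_and,
        Set.mem_ofPred_eq] at hp ⊢
      exact ⟨hp.1, startCount_pos σ p⟩
    · simp only [Finset.coe_filter, Finset.mem_filter, Finset.mem_univ, true_and,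
        Set.mem_ofPred_eq] at hp hp' he
      rw [Fin.ext_iff, ← hp.2, ← hp'.2, he]
  simp only [Finset.filter_filter] at d2 d4
  rw [Finset.card_univ, Fintype.card_fin] at d1
  simp only [ne_eq] at c2
  -- All empty vertices get filled. The pebbles available for this are all but the representatives
  -- in `T`, and these are at most as many as the occupied vertices of `T`. Since `T.card ≤ k`, at
  -- least `m` pebbles are available.
  have hm1 : m₁ = m := by omega
  refine ⟨fun p => ⟨μ p, hTn _ (hmem p)⟩, fun p => rfl, fun v => ⟨fun hv => ?_, ?_⟩, ?_⟩
  · by_cases h0 : startCount σ v = 0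
    · obtain ⟨x, hx, rfl⟩ := hemp.exists_eq v hv h0
      by_cases hx0 : x < m₀
      · obtain ⟨p, -, hp, he⟩ := hout.filled x hx0
        exact ⟨p, by rw [← he, ← hμ p hp]⟩
      · obtain ⟨p, -, hp, he⟩ := hin.filled x (by omega) (by omega)
        exact ⟨p, he⟩
    · obtain ⟨p, hp⟩ := Finset.card_pos.1 (Nat.pos_of_ne_zero h0)
      simp only [Finset.mem_filter, Finset.mem_univ, true_and] at hp
      obtain ⟨p', hr, hp'⟩ := hrep p
      refine ⟨p', ?_⟩
      rw [← hp, ← hp']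
      exact hin.stay p' p'.2 (by rwa [hp', hp]) (by rw [hp', hr])
  · rintro ⟨p, rfl⟩
    exact hmem p
  · rw [sum_startCount, sum_emptyInd, numMoved_eq_card, ← c4]
    -- With `x` pebbles outside `T`, at most `x + (m - min m x) = max x m` pebbles move.
    have hsub : (Finset.univ.filter fun p => σ p ≠ ⟨μ p, hTn _ (hmem p)⟩)
        ⊆ (Finset.univ.filter fun p : Fin k => ¬ (σ p : ℕ) ∈ T) ∪
          Finset.univ.filter fun p : Fin k => (σ p : ℕ) ∈ T ∧ μ p ≠ σ p := by
      intro p hp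
      simp only [Finset.mem_filter, Finset.mem_univ, true_and, Finset.mem_union, Ne,
        Fin.ext_iff] at hp ⊢
      by_cases hpT : (σ p : ℕ) ∈ T
      · exact .inr ⟨hpT, fun he => hp he.symm⟩
      · exact .inl hpT
    have e1 := (Finset.card_le_card hsub).trans (Finset.card_union_le _ _)
    omega

theorem sat_solve {G : SimpleGraph (Fin n)} {σ : Fin k → Fin n} {L : List (Fin n × Fin n)}
    {h : Store} (hG : G.IsTree) (hn : 0 < n) (hk : 0 < k) (hL : IsEdgeList G L)
    (hlen : L.length = n - 1)
    (hraw : ∀ i (hi : i < L.length), h.raw (2 + 2 * i) = L[i].1 ∧ h.raw (3 + 2 * i) = L[i].2)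
    (hrawσ : ∀ p : Fin k, h.raw (n + n + p) = σ p) (harr : ∀ r i j, h.arr r i j = 0) :
    Sat n k .solve h fun h' => ∃ μ : Fin k → Fin n, (∀ p : Fin k, h'.raw p = μ p) ∧
      IsOptimalMotion (IsConnectedGoal G) (numMoved σ) μ := by
  classical
  unfold Cmd.solve
  refine Sat.seq (sat_readEdges hL hlen hraw (fun v => harr _ _ _) fun v => harr _ _ _)
    fun h₁ f₁ q₁ => ?_
  have harr₁ : ∀ r, Cmd.readEdges.writesArr r = false → ∀ i j, h₁.arr r i j = 0 :=
    fun r hr i j => by rw [f₁.arr r hr, harr]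
  refine Sat.seq (sat_readPebbles (σ := σ) (fun p => by rw [f₁.raw rfl, hrawσ])
    (harr₁ _ rfl · _)) fun h₂ f₂ q₂ => ?_
  refine Sat.seq (sat_pushLeaves (G := G) hG.connected.preconnected
    (fun v => by rw [f₂.arr _ rfl, (q₁ v).1]) (fun v => by rw [f₂.arr _ rfl, (q₁ v).2]))
    fun h₃ f₃ q₃ => ?_
  refine Sat.seq (sat_eliminate hG.isAcyclic hn q₃) fun h₄ f₄ ho => ?_
  obtain ⟨q, hq⟩ : ∃ q : ℕ → ℕ, q = fun l => h₄.arr .queue l 0 := ⟨_, rfl⟩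
  obtain ⟨par, hpar⟩ : ∃ par : ℕ → ℕ, par = fun l => h₄.arr .par l 0 := ⟨_, rfl⟩
  rw [← hq, ← hpar] at ho
  have hcnt₄ : ∀ v, h₄.arr .cnt v 0 = startCount σ v := fun v => by
    rw [f₄.arr _ rfl, f₃.arr _ rfl, q₂.1]
  have hsum : ∑ l ∈ Finset.range n, startCount σ (q l) ≤ k := by
    rw [← Finset.sum_image (f := startCount σ) (fun i hi j hj he => ho.inj i (by simpa using hi) j
      (by simpa using hj) he), sum_startCount]
    simpa using Finset.card_filter_le (Finset.univ : Finset (Fin k)) _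
  refine Sat.seq sat_initTable fun h₅ f₅ q₅ => ?_
  refine Sat.seq (sat_mergeAll ho.toIsParentOrder (w := startCount σ)
    (fun l => by rw [f₅.arr _ rfl, hq]) (fun l => by rw [f₅.arr _ rfl, hpar])
    (fun v => by rw [f₅.arr _ rfl, hcnt₄]) hsum (fun v hv b hb => by rw [q₅ v hv b hb, hcnt₄]))
    fun h₆ f₆ q₆ => ?_
  refine Sat.seq (sat_findBest (q := q) (par := par) (w := startCount σ) hn hk
    (fun v => by rw [f₆.arr _ rfl, f₅.arr _ rfl, hcnt₄]) q₆.1) fun h₇ f₇ q₇ => ?_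
  obtain ⟨htn, hbk, hbest⟩ := q₇
  refine Sat.seq (sat_reconstruct ho.toIsParentOrder (w := startCount σ)
    (fun l => by rw [f₇.arr _ rfl, f₆.arr _ rfl, f₅.arr _ rfl, hq])
    (fun l => by rw [f₇.arr _ rfl, f₆.arr _ rfl, f₅.arr _ rfl, hpar])
    (fun v => by rw [f₇.arr _ rfl, f₆.arr _ rfl, f₅.arr _ rfl, hcnt₄])
    (fun v => by rw [f₇.arr _ rfl, f₆.arr _ rfl, f₅.arr _ rfl, f₄.arr _ rfl, f₃.arr _ rfl,
      f₂.arr _ rfl, harr₁ _ rfl]) rfl rfl htn hbk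
    (fun l hl b hb => by rw [f₇.arr _ rfl]; exact q₆.2 l hl b hb)) fun h₈ f₈ q₈ => ?_
  obtain ⟨S, bud, hS, hmark⟩ := q₈
  have hSn : ∀ v ∈ S, v < n := fun v hv => by
    obtain ⟨l, -, hl, rfl⟩ := hS.mem v hv
    exact ho.lt l hl
  refine Sat.seq (sat_trim ho.toIsParentOrder (w := startCount σ)
    (fun l => by rw [f₈.arr _ rfl, f₇.arr _ rfl, f₆.arr _ rfl, f₅.arr _ rfl, hq])
    (fun v => by rw [f₈.arr _ rfl, f₇.arr _ rfl, f₆.arr _ rfl, f₅.arr _ rfl, hcnt₄])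
    (fun v => by rw [f₈.arr _ rfl, f₇.arr _ rfl, f₆.arr _ rfl, f₅.arr _ rfl, f₄.arr _ rfl,
      f₃.arr _ rfl, f₂.arr _ rfl, harr₁ _ rfl]) hmark hS.isBelow) fun h₉ f₉ q₉ => ?_
  obtain ⟨T, hT, hkeep, hemp⟩ := q₉
  have hTB := hT.isBelow ho.toIsParentOrder hk hSn hS.isBelow
  have hTn : ∀ v ∈ T, v < n := fun v hv => hSn v (hT.mem v hv).1
  have hstart : ∀ p : Fin k, h₉.arr .start p 0 = σ p := fun p => by
    rw [f₉.arr _ rfl, f₈.arr _ rfl, f₇.arr _ rfl, f₆.arr _ rfl, f₅.arr _ rfl, f₄.arr _ rfl,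
      f₃.arr _ rfl, q₂.2.1]
  refine Sat.seq (sat_sendOutside hstart hkeep
    (by rw [f₉.reg _ rfl, f₈.reg _ rfl]; exact hTB.1) hemp) fun h₁₀ f₁₀ q₁₀ => ?_
  have hne : h₁₀.reg .ne = h₉.reg .ne := f₁₀.reg _ rfl
  refine (sat_sendInside (σ := σ) (T := T) (w := startCount σ)
    (fun p => by rw [f₁₀.arr _ rfl, hstart])
    (fun v => by rw [f₁₀.arr _ rfl, hkeep]) (by rw [hne, f₁₀.arr _ rfl]; exact hemp)
    (by rw [hne, q₁₀.count]; exact min_le_left _ _)).mono fun h₁₁ f₁₁ q₁₁ => ?_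
  rw [hne, f₁₀.arr .emp rfl] at q₁₁
  obtain ⟨ν, hν, hTν, hmoved⟩ := exists_motion hTn hT.card_le
    (fun p => by
      rw [f₁₀.arr _ rfl, f₉.arr _ rfl, f₈.arr _ rfl, f₇.arr _ rfl, f₆.arr _ rfl, f₅.arr _ rfl,
        f₄.arr _ rfl, f₃.arr _ rfl]
      exact q₂.2.2 p) hemp q₁₀ q₁₁.1 q₁₁.2
  refine ⟨ν, hν, ?_, fun ν' hν' => ?_⟩
  · have hset : Set.range ν = {v : Fin n | (v : ℕ) ∈ T} := by
      ext v
      rw [Set.mem_ofPred_eq, hTν, Set.mem_range]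
      simp only [Fin.ext_iff]
    rw [hset]
    exact ho.connected_of_isBelow hTB hTn
  -- The moves of `ν` are at most the cost of `T`, which is at most the cost of `S`, which is at
  -- most the value of the best table entry, which bounds the moves of every competitor from below.
  · have g1 := hT.cost_le (w := startCount σ) ho.toIsParentOrder hSn
    have g2 := hS.sum_eq
    have g3 := hS.sum_emptyInd_le
    have g4 := ho.le_numMoved hk σ (m := entryValue n k q par (startCount σ) (h₇.reg .bv)
      (h₇.reg .bj)) hbest ν' hν'
    unfold entryValue at g4
    omega

/-- Loads `n`, `k`, `n - 1` and `n + n + k` into registers. -/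
def setup : Program :=
  .seq (.assign 1 (.load (.const 0))) <| .seq (.assign 2 (.load (.const 1))) <|
    .seq (.assign 3 (.sub (.reg 1) (.const 1)))
      (.assign 0 (.add (.add (.reg 1) (.reg 1)) (.reg 2)))

theorem getD_flatMap (L : List (Fin n × Fin n)) (l : List ℕ) (i : ℕ) (hi : i < L.length) :
    ((L.flatMap fun e => [(e.1 : ℕ), (e.2 : ℕ)]) ++ l).getD (2 * i) 0 = L[i].1 ∧
    ((L.flatMap fun e => [(e.1 : ℕ), (e.2 : ℕ)]) ++ l).getD (2 * i + 1) 0 = L[i].2 := by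
  induction L generalizing i with
  | nil => simp at hi
  | cons e L ih =>
    cases i with
    | zero => simp
    | succ i =>
      have := ih i (by simpa using hi)
      simpa [Nat.mul_add] using this

theorem length_flatMap_pair (L : List (Fin n × Fin n)) :
    (L.flatMap fun e => [(e.1 : ℕ), (e.2 : ℕ)]).length = 2 * L.length := by
  simp [mul_comm]

/-- The input has length `2 + 2 * (n - 1) + k = n + n + k`, exactly where the arrays begin, so all
array entries are initially 0. The four assignments cost `3 + 3 + 4 + 6 = 16` steps. -/
theorem runs_setup {σ : Fin k → Fin n} {L : List (Fin n × Fin n)} (hn : 0 < n)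
    (hlen : L.length = n - 1) {d : ℕ} (hd : 4 ≤ d) :
    ∃ s, Runs ((n + k + 2) ^ d) setup (initState (encodeInstance L σ)) 16 s ∧
      Rep n k s ⟨fun _ => 0, fun _ _ _ => 0, fun i => (encodeInstance L σ).getD i 0⟩ := by
  have hB := le_bound n k
  have hlt : (n + k + 2) ^ 3 < (n + k + 2) ^ d := Nat.pow_lt_pow_right (by omega) (by omega)
  have hX := le_cube n k
  refine ⟨_, .seq _ _ _ _ _ _ _ (.assign _ _ _ ?_) (.seq _ _ _ _ _ _ _ (.assign _ _ _ ?_)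
    (.seq _ _ _ _ _ _ _ (.assign _ _ _ ?_) (.assign _ _ _ ?_))), ?_⟩
  · simp [Term.Fits, Term.val, initState, encodeInstance]
    omega
  · simp [Term.Fits, Term.val, initState, encodeInstance]
    omega
  · simp [Term.Fits, Term.val, initState, encodeInstance]
    omega
  · simp [Term.Fits, Term.val, initState, encodeInstance]
    omega
  · refine ⟨?_, ?_, ?_, ?_, fun x => ?_, fun r i j => ?_, fun i hi => rfl⟩
    · simp [Term.val, initState, encodeInstance]
    · simp [Term.val, initState, encodeInstance]
    · simp [Term.val, initState, encodeInstance]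
    · simp [Term.val, initState, encodeInstance]
    · cases x <;> simp [Var.code, initState]
    · have := le_addr n k r i j
      refine List.getD_eq_default _ _ ?_
      simp only [encodeInstance, List.length_append, length_flatMap_pair, hlen, List.length_ofFn,
        List.length_cons, List.length_nil]
      omega

theorem encodeInstance_getD_le (σ : Fin k → Fin n) (L : List (Fin n × Fin n)) (i : ℕ) :
    (encodeInstance L σ).getD i 0 ≤ n + k := by
  rw [List.getD_eq_getElem?_getD]
  cases hx : (encodeInstance L σ)[i]? with
  | none => simp
  | some x =>
    have hm := List.mem_of_getElem? hx
    simp only [encodeInstance, List.mem_append, List.mem_cons, List.not_mem_nil, or_false,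
      List.mem_flatMap, List.mem_ofFn] at hm
    rcases hm with ((rfl | rfl) | ⟨e, -, rfl | rfl⟩) | ⟨p, rfl⟩ <;> simp only [Option.getD_some] <;>
      omega

end WordRAM

open WordRAM in
theorem mainTheorem2 :
    ∃ (prog : WordRAM.Program) (C d : ℕ),
      ∀ (n k : ℕ) (G : SimpleGraph (Fin n)) (σ : Fin k → Fin n) (L : List (Fin n × Fin n)),
        G.IsTree → 0 < k → IsEdgeList G L →
          ∃ (t : ℕ) (s : WordRAM.State) (μ : Fin k → Fin n),
            WordRAM.Runs ((n + k + 2) ^ d) prog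
              (WordRAM.initState (encodeInstance L σ)) t s ∧
            t ≤ C * (n * k ^ 2 * (Nat.log 2 n + 1)) ∧
            (∀ p : Fin k, s.mem p = μ p) ∧
            IsOptimalMotion (IsConnectedGoal G) (numMoved σ) μ := by
  obtain ⟨C, hC⟩ := Cmd.exists_cost_le .solve
  refine ⟨.seq setup Cmd.solve.compile, 16 + C, Cmd.solve.compile.deg + 4,
    fun n k G σ L hG hk hL => ?_⟩
  classical
  have hn : 0 < n := by
    obtain ⟨v⟩ := hG.connected.nonempty
    exact v.pos
  -- The edge count of a tree fixes the layout of the input: the start vertices occupy the cells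
  -- from `n + n` on.
  have hlen : L.length = n - 1 := by
    have h1 := hG.card_edgeFinset
    have h2 : (L.map fun e => s(e.1, e.2)).toFinset = G.edgeFinset := by
      ext e
      rw [List.mem_toFinset, hL.2, SimpleGraph.mem_edgeFinset]
    rw [← h2, List.toFinset_card_of_nodup hL.1, List.length_map, Fintype.card_fin] at h1
    omega
  have hB := le_cube n k
  obtain ⟨s₀, hr₀, hs₀⟩ := runs_setup (σ := σ) hn hlen (d := Cmd.solve.compile.deg + 4) (by omega)
  have hsat := sat_solve (n := n) (k := k) (σ := σ)
    (h := ⟨fun _ => 0, fun _ _ _ => 0, fun i => (encodeInstance L σ).getD i 0⟩) hG hn hk hL hlen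
    (fun i hi => by
      have := getD_flatMap L (List.ofFn fun p => (σ p : ℕ)) i hi
      have h2 : 2 + 2 * i = 2 * i + 1 + 1 := by omega
      have h3 : 3 + 2 * i = 2 * i + 1 + 1 + 1 := by omega
      simp only [encodeInstance, List.cons_append, List.nil_append, h2, h3,
        List.getD_cons_succ]
      exact this)
    (fun p => by
      have h1 : n + n + (p : ℕ) = 2 + (2 * L.length + p) := by omega
      have h2 := length_flatMap_pair L
      simp only [encodeInstance, h1, List.append_assoc]
      rw [List.getD_append_right _ _ _ _ (by simp), List.getD_append_right _ _ _ _ (by simp [h2]), h2]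
      simp)
    (fun _ _ _ => rfl)
  obtain ⟨t, s, h', hr, ht, hs, -, -, μ, hμ, hopt⟩ := hsat ⟨fun _ => Nat.zero_le _,
    fun _ _ _ => Nat.zero_le _, fun i => (encodeInstance_getD_le σ L i).trans (by omega)⟩ _
    (Nat.le_add_right _ 4) s₀ hs₀
  refine ⟨16 + t, s, μ, .seq _ _ _ _ _ _ _ hr₀ hr, ?_, fun p => ?_, hopt⟩
  · have h1 := hC n k hn hk
    rw [Cmd.degN_solve, Cmd.degK_solve, pow_one] at h1
    have h2 : 1 ≤ n * k ^ 2 := Nat.mul_pos hn (Nat.pow_pos hk)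
    calc 16 + t ≤ 16 * (n * k ^ 2) + C * (n * k ^ 2) := by omega
      _ = (16 + C) * (n * k ^ 2) := by ring
      -- The algorithm already meets the bound `n * k ^ 2`; the logarithmic factor is slack.
      _ ≤ (16 + C) * (n * k ^ 2 * (Nat.log 2 n + 1)) :=
        Nat.mul_le_mul_left _ (Nat.le_mul_of_pos_right _ (Nat.succ_pos _))
  · rw [hs.raw p (by omega), hμ]
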